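/- Let $N\ge 3$, $1<p<\frac{3N+2}{N-2}$, and let $V\in C^1(\mathbb{R}^N)$ satisfy: (V1) there are constants $V_0,V_\infty\in\mathbb{R}$ with $0<V_0\le V(x)\le V_\infty=\lim_{|y|\to+\infty}V(y)$ for all $x\in\mathbb{R}^N$; (V2) the function $x\mapsto x\cdot\nabla V(x)$ belongs to $L^\infty(\mathbb{R}^N)$; (V3) for every $x\in\mathbb{R}^N$ the map $s\mapsto s^{\frac{N+2}{N+p+1}}\,V\bigl(s^{\frac{1}{N+p+1}}x\bigr)$ is concave on $(0,+\infty)$. Let $X=\{u\in H^1(\mathbb{R}^N): u^2\in H^1(\mathbb{R}^N)\}$ (real-valued functions) and, for $u\in X$, put $$I(u)=\frac12\int_{\mathbb{R}^N}\bigl(|\nabla u|^2+V(x)u^2+u^2|\nabla u|^2\bigr)\,dx-\frac1{p+1}\int_{\mathbb{R}^N}|u|^{p+1}\,dx,$$ $$J(u)=\frac N2\int_{\mathbb{R}^N}|\nabla u|^2\,dx+\frac{N+2}2\int_{\mathbb{R}^N}\bigl(V(x)u^2+u^2|\nabla u|^2\bigr)\,dx+\frac12\int_{\mathbb{R}^N}\bigl(\nabla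 V(x)\cdot x\bigr)u^2\,dx-\frac{N+p+1}{p+1}\int_{\mathbb{R}^N}|u|^{p+1}\,dx,$$ and $M=\{u\in X\setminus\{0\}: J(u)=0\}$. Then $J(u)=\frac{d}{dt}I(u_t)\big|_{t=1}$ for every $u\in X$, where $u_t(x)=t\,u(x/t)$ for $t>0$; and $m:=\inf_M I$ is positive and is attained at some $u\in M$. -/

import Mathlib

open MeasureTheory Filter Topology Set
open scoped ContDiff

namespace ModNLS

noncomputable section

/-- The Euclidean space `ℝ^N`. -/
abbrev E (N : ℕ) : Type := EuclideanSpace ℝ (Fin N)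

/-- `G` is a weak (distributional) gradient of `u` on `ℝ^N`: both are locally integrable and
`∫ u ∂_v φ = - ∫ (G · v) φ` for all test functions `φ ∈ C_c^∞(ℝ^N)` and all directions `v`. -/
def HasWeakGradient {N : ℕ} (u : E N → ℝ) (G : E N → E N) : Prop :=
  LocallyIntegrable u volume ∧ LocallyIntegrable G volume ∧
    ∀ φ : E N → ℝ, ContDiff ℝ ∞ φ → HasCompactSupport φ → ∀ v : E N,
      ∫ x, u x * fderiv ℝ φ x v = -∫ x, inner ℝ (G x) v * φ x

/-- Weak gradients are unique almost everywhere. -/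
theorem HasWeakGradient.ae_eq {N : ℕ} {u : E N → ℝ} {G H : E N → E N}
    (hG : HasWeakGradient u G) (hH : HasWeakGradient u H) : G =ᵐ[volume] H := by
  have key : ∀ v : E N, ∀ᵐ x, inner ℝ (G x - H x) v = 0 := by
    intro v
    have hGv : LocallyIntegrable (fun x => inner ℝ (G x) v) volume := by
      intro x
      obtain ⟨s, hs, hi⟩ := hG.2.1 x
      exact ⟨s, hs, hi.inner_const v⟩
    have hHv : LocallyIntegrable (fun x => inner ℝ (H x) v) volume := by
      intro x
      obtain ⟨s, hs, hi⟩ := hH.2.1 x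
      exact ⟨s, hs, hi.inner_const v⟩
    have hloc : LocallyIntegrable (fun x => inner ℝ (G x - H x) v) volume := by
      have := hGv.sub hHv
      refine this.congr (Eventually.of_forall fun x => ?_)
      simp [inner_sub_left]
    refine ae_eq_zero_of_integral_contDiff_smul_eq_zero hloc ?_
    intro φ hφ hc
    have h1 := hG.2.2 φ hφ hc v
    have h2 := hH.2.2 φ hφ hc v
    have i1 : Integrable (fun x => φ x • inner ℝ (G x) v) volume :=
      hGv.integrable_smul_left_of_hasCompactSupport hφ.continuous hc
    have i2 : Integrable (fun x => φ x • inner ℝ (H x) v) volume :=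
      hHv.integrable_smul_left_of_hasCompactSupport hφ.continuous hc
    have h3 : ∫ x, φ x • inner ℝ (G x - H x) v
        = (∫ x, φ x • inner ℝ (G x) v) - ∫ x, φ x • inner ℝ (H x) v := by
      rw [← integral_sub i1 i2]
      refine integral_congr_ae (Eventually.of_forall fun x => ?_)
      simp [inner_sub_left, mul_sub]
    rw [h3]
    simp only [smul_eq_mul, mul_comm (φ _)]
    linarith
  have hall : ∀ᵐ x, ∀ i : Fin N, inner ℝ (G x - H x) (EuclideanSpace.single i (1 : ℝ)) = 0 :=
    ae_all_iff.2 fun i => key _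
  filter_upwards [hall] with x hx
  ext i
  have := hx i
  simp [EuclideanSpace.inner_single_right] at this
  linarith

open Classical in
/-- The weak gradient `∇u` (well defined almost everywhere; `0` if there is none). -/
def weakGrad {N : ℕ} (u : E N → ℝ) : E N → E N :=
  if h : ∃ G, HasWeakGradient u G then h.choose else 0

/-- `u ∈ H¹(ℝ^N)`: `u ∈ L²` and `u` has a weak gradient in `L²`. -/
def MemH1 {N : ℕ} (u : E N → ℝ) : Prop :=
  MemLp u 2 volume ∧ ∃ G : E N → E N, HasWeakGradient u G ∧ MemLp G 2 volume

/-- `X = {u ∈ H¹(ℝ^N) : u² ∈ H¹(ℝ^N)}`. Its elements are represented by functions; two functions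
which agree almost everywhere represent the same element. -/
def X (N : ℕ) : Set (E N → ℝ) :=
  {u | MemH1 u ∧ MemH1 (fun x => u x ^ 2)}

/-- The functional
`I(u) = ½ ∫ (|∇u|² + V u² + u² |∇u|²) - 1/(p+1) ∫ |u|^(p+1)`. -/
def I {N : ℕ} (p : ℝ) (V : E N → ℝ) (u : E N → ℝ) : ℝ :=
  (1 / 2) * (∫ x, (‖weakGrad u x‖ ^ 2 + V x * u x ^ 2 + u x ^ 2 * ‖weakGrad u x‖ ^ 2))
    - (1 / (p + 1)) * ∫ x, |u x| ^ (p + 1)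

/-- The rescaled function `u_t(x) = t u(x / t)`. -/
def dilate {N : ℕ} (t : ℝ) (u : E N → ℝ) : E N → ℝ :=
  fun x => t * u (t⁻¹ • x)

/-- The functional `J`; here `fderiv ℝ V x x` is `∇V(x) · x`. -/
def J {N : ℕ} (p : ℝ) (V : E N → ℝ) (u : E N → ℝ) : ℝ :=
  ((N : ℝ) / 2) * (∫ x, ‖weakGrad u x‖ ^ 2)
    + (((N : ℝ) + 2) / 2) * (∫ x, (V x * u x ^ 2 + ‖weakGrad u x‖ ^ 2 * u x ^ 2))
    + (1 / 2) * (∫ x, fderiv ℝ V x x * u x ^ 2)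
    - (((N : ℝ) + p + 1) / (p + 1)) * ∫ x, |u x| ^ (p + 1)

/-- The constraint set `M = {u ∈ X \ {0} : J(u) = 0}` (`u ≠ 0` as an element of `X`, that is,
`u` does not vanish almost everywhere). -/
def M {N : ℕ} (p : ℝ) (V : E N → ℝ) : Set (E N → ℝ) :=
  {u | u ∈ X N ∧ ¬ (u =ᵐ[volume] 0) ∧ J p V u = 0}

/-- `m = inf_M I`. (If `M` were empty or `I` unbounded below on `M`, this real infimum would
be `0`; so `0 < m` includes that it is a genuine infimum.) -/
def m {N : ℕ} (p : ℝ) (V : E N → ℝ) : ℝ :=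
  sInf (I p V '' M p V)

end

end ModNLS

open scoped ENNReal NNReal Convolution

namespace ModNLS

/-! Put q = N + p + 1 and parametrize the dilations by s = t ^ q. In I(u_t) the two gradient terms
are multiples of s ^ (N / q) and s ^ ((N + 2) / q), concave because p > 1 puts both exponents in (0,
1); the potential term is concave by (V3); the power term is linear in s. So I(u_t) is a concave
function of s whose slope at s = 1 is J(u) / q, and its tangent there gives I(u_t) ≤ P(u) + t ^ q *
J(u) / q with P = I - J / q (`I_dilate_le`). The number P(u) is the value of the tangent at s = 0.
The power term cancels in it and the remaining coefficients are positive: for the weight of u² this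
holds because it is half the intercept at s = 0 of the tangent to a concave profile that is bounded
below by V₀ s ^ ((N + 2) / q) (`exists_weightP_lower`). Hence P is coercive and weakly lower
semicontinuous.

Every dilation orbit of a nonzero function meets M (`exists_J_dilate_eq_zero`), so the tangent
inequality yields m ≤ P(u) for all u ≠ 0 with J(u) ≤ 0 (`m_le_P`). The constraint may thus be
relaxed to an inequality, which leaves room for cutting functions and for passing to limits.

Positivity: the Sobolev inequality for u², whose gradient is 2u∇u, controls the norm of exponent 4N
/ (N - 2) > p + 1 by ∫ u²|∇u|². On J ≤ 0 this bounds ∫ u²|∇u|² and ∫ |u| ^ (p + 1) away from zero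
(`exists_lower_of_J_nonpos`); the first bound and the coercivity of P give m > 0.

Attainment: a minimizing sequence is bounded by coercivity, and its power integral does not vanish,
so by Lions' lemma a fixed mass of u² stays in balls of radius 2 about points y_n
(`exists_local_mass`). If y_n is bounded along a subsequence the potential is kept; otherwise the
functions are translated by y_n and V is replaced by V' = V_∞, the weights converging at infinity
thanks to concavity. Rellich's theorem gives a nonzero weak limit v, and P'(v) ≤ m by
semicontinuity. Moreover J'(v) ≤ 0: if it were positive, removing a large ball from v_n, cut along
an annulus of small energy, would leave a function with J < 0 and P < m, which the relaxed problem
forbids (`exists_limit_of_minimizing`). Finally, for t with J(v_t) = 0, one has m ≤ I(v_t) ≤ I'(v_t)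
≤ P'(v) ≤ m because V ≤ V', so v_t is a minimizer.

For the derivative formula, a change of variables takes t out of every integral except the one with
V, which is differentiated under the integral sign. -/

/-- Cauchy-Schwarz inequality for a weighted integral. -/
theorem lintegral_mul_sq_le {α : Type*} [MeasurableSpace α] {μ : Measure α} {a b : α → ℝ≥0∞}
    (ha : AEMeasurable a μ) (hb : AEMeasurable b μ) :
    (∫⁻ x, a x * b x ∂μ) ^ 2 ≤ (∫⁻ x, a x ∂μ) * ∫⁻ x, a x * b x ^ 2 ∂μ := by
  have h := ENNReal.lintegral_mul_le_Lp_mul_Lq μ (Real.HolderConjugate.two_two)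
    (f := fun x => a x ^ (1 / 2 : ℝ)) (g := fun x => a x ^ (1 / 2 : ℝ) * b x)
    (ha.pow_const _) ((ha.pow_const _).mul hb)
  have e1 : ∀ x, a x ^ (1 / 2 : ℝ) * a x ^ (1 / 2 : ℝ) = a x := fun x => by
    rw [← ENNReal.rpow_add_of_nonneg _ _ (by norm_num) (by norm_num)]; norm_num
  have e2 : ∀ y : ℝ≥0∞, (y ^ (1 / 2 : ℝ)) ^ 2 = y := fun y => by
    rw [← ENNReal.rpow_natCast, ← ENNReal.rpow_mul]; norm_num
  simp only [Pi.mul_apply, ← mul_assoc, e1] at h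
  have e3 : ∀ x, (a x ^ (1 / 2 : ℝ)) ^ (2 : ℝ) = a x := fun x => by
    rw [← ENNReal.rpow_mul]; norm_num
  have e4 : ∀ x, (a x ^ (1 / 2 : ℝ) * b x) ^ (2 : ℝ) = a x * b x ^ 2 := fun x => by
    rw [ENNReal.mul_rpow_of_nonneg _ _ (by norm_num), e3]; norm_num
  simp only [e3, e4] at h
  calc _ ≤ _ := pow_le_pow_left' h 2
    _ = _ := by rw [mul_pow, e2, e2]

theorem eLpNorm_two_sq {α F : Type*} [MeasurableSpace α] [NormedAddCommGroup F] {μ : Measure α}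
    (f : α → F) : eLpNorm f 2 μ ^ 2 = ∫⁻ x, ‖f x‖ₑ ^ 2 ∂μ := by
  have := eLpNorm_nnreal_pow_eq_lintegral (p := 2) (f := f) (μ := μ) (by norm_num)
  simpa using this

/-! ### Mollification and smooth approximation in `H¹` -/

section

variable {N : ℕ} {F : Type*} [NormedAddCommGroup F] [NormedSpace ℝ F]

/-- The mollification of `f` by the normalized bump function `φ`. -/
noncomputable def mollify (φ : ContDiffBump (0 : E N)) (f : E N → F) : E N → F :=
  φ.normed volume ⋆[ContinuousLinearMap.lsmul ℝ ℝ, volume] f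

theorem mollify_apply (φ : ContDiffBump (0 : E N)) (f : E N → F) (x : E N) :
    mollify φ f x = ∫ y, φ.normed volume y • f (x - y) := rfl

theorem integrable_mollify (φ : ContDiffBump (0 : E N)) {f : E N → F}
    (hf : LocallyIntegrable f volume) (x : E N) :
    Integrable (fun y => φ.normed volume y • f (x - y)) volume :=
  (φ.hasCompactSupport_normed.convolutionExists_left (ContinuousLinearMap.lsmul ℝ ℝ)
    φ.continuous_normed hf x)

/-- Jensen's inequality for the probability density of the bump, in the form of the weighted
Cauchy-Schwarz inequality with total weight 1. -/
theorem enorm_mollify_sub_sq_le [CompleteSpace F] (φ : ContDiffBump (0 : E N)) {f : E N → F}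
    (hf : LocallyIntegrable f volume) (x : E N) :
    ‖mollify φ f x - f x‖ₑ ^ 2
      ≤ ∫⁻ y, ‖φ.normed volume y‖ₑ * ‖f (x - y) - f x‖ₑ ^ 2 := by
  have hi := integrable_mollify φ hf x
  have hc : Integrable (fun y => φ.normed volume y • f x) volume :=
    (φ.integrable_normed).smul_const _
  have e : mollify φ f x - f x = ∫ y, φ.normed volume y • (f (x - y) - f x) := by
    simp only [smul_sub]
    rw [integral_sub hi hc, φ.integral_normed_smul, mollify_apply]
  have h1 : ∫⁻ y, ‖φ.normed volume y‖ₑ = 1 := by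
    rw [← ofReal_integral_norm_eq_lintegral_enorm φ.integrable_normed]
    simp [abs_of_nonneg (φ.nonneg_normed _), φ.integral_normed]
  have hm : AEStronglyMeasurable (fun y => f (x - y) - f x) volume :=
    (hf.aestronglyMeasurable.comp_measurePreserving
      (Measure.measurePreserving_sub_left volume x)).sub aestronglyMeasurable_const
  calc ‖mollify φ f x - f x‖ₑ ^ 2
      ≤ (∫⁻ y, ‖φ.normed volume y‖ₑ * ‖f (x - y) - f x‖ₑ) ^ 2 := by
        rw [e]
        gcongr
        refine (enorm_integral_le_lintegral_enorm _).trans_eq ?_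
        simp [enorm_smul]
    _ ≤ _ := lintegral_mul_sq_le φ.continuous_normed.aestronglyMeasurable.enorm hm.enorm
    _ = _ := by rw [h1, one_mul]

/-- Mollification moves a function at most as much as the translations by vectors of the support
of the bump function. -/
theorem eLpNorm_mollify_sub_le [CompleteSpace F] (φ : ContDiffBump (0 : E N)) {f : E N → F}
    (hf : LocallyIntegrable f volume) {C : ℝ≥0∞}
    (hC : ∀ y ∈ Metric.ball (0 : E N) φ.rOut,
      eLpNorm (fun x => f (x - y) - f x) 2 volume ≤ C) :
    eLpNorm (fun x => mollify φ f x - f x) 2 volume ≤ C := by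
  rcases eq_or_ne C ⊤ with rfl | hCt
  · exact le_top
  have h1 : ∫⁻ y, ‖φ.normed volume y‖ₑ = 1 := by
    rw [← ofReal_integral_norm_eq_lintegral_enorm φ.integrable_normed]
    simp [abs_of_nonneg (φ.nonneg_normed _), φ.integral_normed]
  have hm : AEStronglyMeasurable (fun z : E N × E N => f (z.1 - z.2) - f z.1)
      (volume.prod volume) := by
    refine AEStronglyMeasurable.sub ?_ hf.aestronglyMeasurable.comp_fst
    exact hf.aestronglyMeasurable.comp_quasiMeasurePreserving
      (quasiMeasurePreserving_sub volume volume)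
  have key : eLpNorm (fun x => mollify φ f x - f x) 2 volume ^ 2 ≤ C ^ 2 := by
    rw [eLpNorm_two_sq]
    calc ∫⁻ x, ‖mollify φ f x - f x‖ₑ ^ 2
        ≤ ∫⁻ x, ∫⁻ y, ‖φ.normed volume y‖ₑ * ‖f (x - y) - f x‖ₑ ^ 2 :=
          lintegral_mono fun x => enorm_mollify_sub_sq_le φ hf x
      _ = ∫⁻ y, ∫⁻ x, ‖φ.normed volume y‖ₑ * ‖f (x - y) - f x‖ₑ ^ 2 := by
          refine lintegral_lintegral_swap ?_
          refine AEMeasurable.mul ?_ (hm.enorm.pow_const 2)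
          exact (φ.continuous_normed.comp continuous_snd).aestronglyMeasurable.enorm
      _ ≤ ∫⁻ y, ‖φ.normed volume y‖ₑ * C ^ 2 := by
          refine lintegral_mono fun y => ?_
          rw [lintegral_const_mul' _ _ enorm_ne_top]
          by_cases hy : y ∈ Metric.ball (0 : E N) φ.rOut
          · gcongr
            rw [← eLpNorm_two_sq]
            exact pow_le_pow_left' (hC y hy) 2
          · have : φ.normed volume y = 0 := by
              rw [← Function.notMem_support, φ.support_normed_eq]; exact hy
            simp [this]
      _ = C ^ 2 := by
          rw [lintegral_mul_const' _ _ (ENNReal.pow_ne_top hCt), h1, one_mul]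
  exact (ENNReal.pow_le_pow_left_iff two_ne_zero).1 key

/-- Translations are continuous in `L²`. -/
theorem tendsto_eLpNorm_translate_sub {F : Type*} [NormedAddCommGroup F] {f : E N → F} (hf : MemLp f 2 volume) :
    Tendsto (fun y : E N => eLpNorm (fun x => f (x - y) - f x) 2 volume) (𝓝 0) (𝓝 0) := by
  -- Translations form a continuous family of measure preserving maps, and composition with such a
  -- family is continuous on `Lp`.
  let g : E N → C(E N, E N) := fun y => ⟨fun x => x - y, by fun_prop⟩
  have hg : Continuous g := ContinuousMap.continuous_of_continuous_uncurry _
    (continuous_snd.sub continuous_fst)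
  have hgm : ∀ y, MeasurePreserving (g y) volume volume := fun y =>
    measurePreserving_sub_right volume y
  have h := (Continuous.compMeasurePreservingLp (f := fun _ : E N => hf.toLp f) continuous_const
    hg hgm (by norm_num)).tendsto 0
  have h2 := tendsto_iff_edist_tendsto_0.1 h
  refine h2.congr fun y => ?_
  rw [Lp.edist_def]
  refine eLpNorm_congr_ae ?_
  have a1 := Lp.coeFn_compMeasurePreserving (hf.toLp f) (hgm y)
  have a2 := Lp.coeFn_compMeasurePreserving (hf.toLp f) (hgm 0)
  have a3 := (hgm y).quasiMeasurePreserving.ae_eq_comp hf.coeFn_toLp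
  have a4 := (hgm 0).quasiMeasurePreserving.ae_eq_comp hf.coeFn_toLp
  filter_upwards [a1, a2, a3, a4] with x h1 h2 h3 h4
  simp only [Pi.sub_apply, h1, h2, h3, h4]
  simp [g]

/-- A sequence of bump functions shrinking to the origin. -/
noncomputable def shrinkingBump (N k : ℕ) : ContDiffBump (0 : E N) where
  rIn := 1 / (2 * ((k : ℝ) + 1))
  rOut := 1 / ((k : ℝ) + 1)
  rIn_pos := by positivity
  rIn_lt_rOut := by
    apply one_div_lt_one_div_of_lt <;> linarith [(Nat.cast_nonneg k : (0 : ℝ) ≤ k)]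

theorem tendsto_rOut_shrinkingBump (N : ℕ) :
    Tendsto (fun k => (shrinkingBump N k).rOut) atTop (𝓝 0) :=
  tendsto_one_div_add_atTop_nhds_zero_nat

theorem tendsto_eLpNorm_mollify_sub [CompleteSpace F] {f : E N → F} (hf : MemLp f 2 volume) :
    Tendsto (fun k => eLpNorm (fun x => mollify (shrinkingBump N k) f x - f x) 2 volume)
      atTop (𝓝 0) := by
  rw [ENNReal.tendsto_atTop_zero]
  intro ε hε
  have h := (tendsto_eLpNorm_translate_sub hf).eventually (gt_mem_nhds hε)
  obtain ⟨r, hr, hb⟩ := Metric.eventually_nhds_iff.1 h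
  obtain ⟨k0, hk0⟩ := eventually_atTop.1
    ((tendsto_rOut_shrinkingBump N).eventually (gt_mem_nhds hr))
  refine ⟨k0, fun k hk => eLpNorm_mollify_sub_le _ (hf.locallyIntegrable (by norm_num)) ?_⟩
  intro y hy
  exact (hb (lt_trans hy (hk0 k hk))).le

/-- The mollification of a function with a weak gradient is differentiable, and its gradient is
the mollified weak gradient. -/
theorem HasWeakGradient.fderiv_mollify {u : E N → ℝ} {G : E N → E N} (h : HasWeakGradient u G)
    (φ : ContDiffBump (0 : E N)) (x v : E N) :
    fderiv ℝ (mollify φ u) x v = inner ℝ (mollify φ G x) v := by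
  have hd : HasFDerivAt (mollify φ u) _ x :=
    φ.hasCompactSupport_normed.hasFDerivAt_convolution_left (ContinuousLinearMap.lsmul ℝ ℝ)
    (φ.contDiff_normed (n := 1)) h.1 x
  have hη1 : ContDiff ℝ 1 (φ.normed volume) := φ.contDiff_normed
  have hint : Integrable (fun t => ((ContinuousLinearMap.lsmul ℝ ℝ).precompL (E N))
      (fderiv ℝ (φ.normed volume) t) (u (x - t))) volume :=
    (φ.hasCompactSupport_normed.fderiv ℝ).convolutionExists_left _
      (hη1.continuous_fderiv one_ne_zero) h.1 x
  rw [hd.fderiv, convolution_def, ContinuousLinearMap.integral_apply hint]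
  have e1 : ∫ t, (((ContinuousLinearMap.lsmul ℝ ℝ).precompL (E N))
      (fderiv ℝ (φ.normed volume) t) (u (x - t))) v
      = ∫ t, u t * fderiv ℝ (φ.normed volume) (x - t) v := by
    rw [← integral_sub_left_eq_self _ volume x]
    refine integral_congr_ae (Eventually.of_forall fun t => ?_)
    simp [ContinuousLinearMap.precompL_apply, mul_comm]
  have hd2 : ∀ t, fderiv ℝ (fun t => φ.normed volume (x - t)) t v
      = - fderiv ℝ (φ.normed volume) (x - t) v := by
    intro t
    have := ((hη1.differentiable one_ne_zero) (x - t)).hasFDerivAt.comp t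
      ((hasFDerivAt_const x t).sub (hasFDerivAt_id t))
    have e : fderiv ℝ (fun t => φ.normed volume (x - t)) t = _ := this.fderiv
    rw [e]
    simp
  -- Testing against the reflected and translated kernel: its derivative in t is minus that of the
  -- kernel, and the minus sign of the weak gradient identity cancels it.
  have h2 := h.2.2 (fun t => φ.normed volume (x - t))
    ((φ.contDiff_normed (n := ⊤)).comp (contDiff_const.sub contDiff_id))
    (φ.hasCompactSupport_normed.comp_homeomorph (Homeomorph.subLeft x)) v
  simp only [hd2, mul_neg, integral_neg, neg_inj] at h2
  have hi := integrable_mollify φ h.2.1 x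
  rw [e1, h2, mollify_apply, real_inner_comm, ← integral_inner hi,
    ← integral_sub_left_eq_self _ volume x]
  refine integral_congr_ae (Eventually.of_forall fun t => ?_)
  simp [inner_smul_right, real_inner_comm, mul_comm]

theorem HasWeakGradient.contDiff_mollify {u : E N → ℝ} {G : E N → E N} (h : HasWeakGradient u G)
    (φ : ContDiffBump (0 : E N)) : ContDiff ℝ ∞ (mollify φ u) :=
  φ.hasCompactSupport_normed.contDiff_convolution_left (ContinuousLinearMap.lsmul ℝ ℝ)
    (φ.contDiff_normed (n := ⊤)) h.1

theorem integrable_inner_of_memLp {α F : Type*} [MeasurableSpace α] {μ : Measure α}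
    [NormedAddCommGroup F] [InnerProductSpace ℝ F] {f g : α → F} (hf : MemLp f 2 μ)
    (hg : MemLp g 2 μ) : Integrable (fun x => inner ℝ (f x) (g x)) μ := by
  refine (L2.integrable_inner (𝕜 := ℝ) (hf.toLp f) (hg.toLp g)).congr ?_
  filter_upwards [hf.coeFn_toLp, hg.coeFn_toLp] with x h1 h2
  rw [h1, h2]

theorem abs_integral_inner_le {α F : Type*} [MeasurableSpace α] {μ : Measure α}
    [NormedAddCommGroup F] [InnerProductSpace ℝ F] {f g : α → F} (hf : MemLp f 2 μ)
    (hg : MemLp g 2 μ) :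
    |∫ x, inner ℝ (f x) (g x) ∂μ| ≤ (eLpNorm f 2 μ).toReal * (eLpNorm g 2 μ).toReal := by
  have e : ∫ x, inner ℝ (f x) (g x) ∂μ = inner ℝ (hf.toLp f) (hg.toLp g) := by
    rw [L2.inner_def]
    refine integral_congr_ae ?_
    filter_upwards [hf.coeFn_toLp, hg.coeFn_toLp] with x h1 h2
    rw [h1, h2]
  rw [e, ← Lp.norm_toLp f hf, ← Lp.norm_toLp g hg]
  exact abs_real_inner_le_norm _ _

/-- Pairing of a strongly convergent and a bounded sequence of `L²`. -/
theorem tendsto_integral_inner_of_tendsto {α F : Type*} [MeasurableSpace α] {μ : Measure α}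
    [NormedAddCommGroup F] [InnerProductSpace ℝ F] {f g : ℕ → α → F} {f₀ : α → F} {L : ℝ}
    (hf : ∀ n, MemLp (f n) 2 μ) (hf₀ : MemLp f₀ 2 μ) (hg : ∀ n, MemLp (g n) 2 μ) {C : ℝ≥0∞}
    (hC : C ≠ ⊤) (hgC : ∀ᶠ n in atTop, eLpNorm (g n) 2 μ ≤ C)
    (hfl : Tendsto (fun n => eLpNorm (fun x => f n x - f₀ x) 2 μ) atTop (𝓝 0))
    (hL : Tendsto (fun n => ∫ x, inner ℝ (f₀ x) (g n x) ∂μ) atTop (𝓝 L)) :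
    Tendsto (fun n => ∫ x, inner ℝ (f n x) (g n x) ∂μ) atTop (𝓝 L) := by
  have e : ∀ n, ∫ x, inner ℝ (f n x) (g n x) ∂μ
      = (∫ x, inner ℝ (f n x - f₀ x) (g n x) ∂μ) + ∫ x, inner ℝ (f₀ x) (g n x) ∂μ := by
    intro n
    have h1 : Integrable (fun x => inner ℝ (f n x - f₀ x) (g n x)) μ :=
      integrable_inner_of_memLp ((hf n).sub hf₀) (hg n)
    rw [← integral_add h1 (integrable_inner_of_memLp hf₀ (hg n))]
    simp [← inner_add_left]
  simp only [e]
  rw [← zero_add L]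
  refine Tendsto.add ?_ hL
  have h1 : Tendsto (fun n => (eLpNorm (fun x => f n x - f₀ x) 2 μ).toReal * C.toReal) atTop
      (𝓝 0) := by
    have := (ENNReal.tendsto_toReal ENNReal.zero_ne_top).comp hfl
    simpa using this.mul_const C.toReal
  refine squeeze_zero_norm' ?_ h1
  filter_upwards [hgC] with n hn
  refine (abs_integral_inner_le ((hf n).sub hf₀) (hg n)).trans ?_
  exact mul_le_mul_of_nonneg_left (ENNReal.toReal_mono hC hn) ENNReal.toReal_nonneg

/-- A continuously differentiable function has its gradient as weak gradient. -/
theorem hasWeakGradient_of_contDiff {u : E N → ℝ} {G : E N → E N} (hu : ContDiff ℝ 1 u)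
    (hG : Continuous G) (h : ∀ x v, fderiv ℝ u x v = inner ℝ (G x) v) : HasWeakGradient u G := by
  refine ⟨hu.continuous.locallyIntegrable, hG.locallyIntegrable, fun φ hφ hc v => ?_⟩
  have hφ1 : ContDiff ℝ 1 φ := hφ.of_le (by exact_mod_cast le_top)
  have hc' : HasCompactSupport (fun x => fderiv ℝ φ x v) := hc.fderiv_apply ℝ v
  have c1 : Continuous (fun x => fderiv ℝ φ x v) :=
    (hφ1.continuous_fderiv one_ne_zero).clm_apply continuous_const
  have c2 : Continuous (fun x => fderiv ℝ u x v) :=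
    (hu.continuous_fderiv one_ne_zero).clm_apply continuous_const
  rw [integral_mul_fderiv_eq_neg_fderiv_mul_of_integrable]
  · simp [h]
  · exact (c2.mul hφ.continuous).integrable_of_hasCompactSupport hc.mul_left
  · exact (hu.continuous.mul c1).integrable_of_hasCompactSupport hc'.mul_left
  · exact (hu.continuous.mul hφ.continuous).integrable_of_hasCompactSupport hc.mul_left
  · exact fun x _ => hu.differentiable one_ne_zero x
  · exact fun x _ => hφ1.differentiable one_ne_zero x

/-- Smooth approximation of `H¹` functions. -/
theorem HasWeakGradient.exists_approx {u : E N → ℝ} {G : E N → E N} (h : HasWeakGradient u G)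
    (hu : MemLp u 2 volume) (hG : MemLp G 2 volume) :
    ∃ (U : ℕ → E N → ℝ) (H : ℕ → E N → E N), (∀ k, ContDiff ℝ ∞ (U k)) ∧
      (∀ k, Continuous (H k)) ∧ (∀ k x v, fderiv ℝ (U k) x v = inner ℝ (H k x) v) ∧
      (∀ k, MemLp (U k) 2 volume) ∧ (∀ k, MemLp (H k) 2 volume) ∧
      Tendsto (fun k => eLpNorm (fun x => U k x - u x) 2 volume) atTop (𝓝 0) ∧
      Tendsto (fun k => eLpNorm (fun x => H k x - G x) 2 volume) atTop (𝓝 0) := by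
  have t1 := tendsto_eLpNorm_mollify_sub hu
  have t2 := tendsto_eLpNorm_mollify_sub hG
  have c2 : ∀ k, Continuous (mollify (shrinkingBump N k) G) := fun k =>
    ((shrinkingBump N k).hasCompactSupport_normed.contDiff_convolution_left
      (ContinuousLinearMap.lsmul ℝ ℝ) ((shrinkingBump N k).contDiff_normed (n := 0))
      h.2.1).continuous
  -- Membership in `L²` is read off from a finite distance to the limit, which convergence gives
  -- only for large indices; the sequences are therefore shifted by `k0`.
  obtain ⟨k0, hk0⟩ := eventually_atTop.1 ((t1.eventually (gt_mem_nhds ENNReal.zero_lt_top)).and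
    (t2.eventually (gt_mem_nhds ENNReal.zero_lt_top)))
  refine ⟨fun k => mollify (shrinkingBump N (k + k0)) u,
    fun k => mollify (shrinkingBump N (k + k0)) G, fun k => h.contDiff_mollify _, fun k => c2 _,
    fun k x v => h.fderiv_mollify _ x v, fun k => ?_, fun k => ?_,
    t1.comp (tendsto_add_atTop_nat k0), t2.comp (tendsto_add_atTop_nat k0)⟩
  · have m : MemLp (fun x => mollify (shrinkingBump N (k + k0)) u x - u x) 2 volume :=
      ⟨(h.contDiff_mollify _).continuous.aestronglyMeasurable.sub hu.1, (hk0 _ (by omega)).1⟩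
    exact (m.add hu).ae_eq (Eventually.of_forall fun x => by simp)
  · have m : MemLp (fun x => mollify (shrinkingBump N (k + k0)) G x - G x) 2 volume :=
      ⟨(c2 _).aestronglyMeasurable.sub hG.1, (hk0 _ (by omega)).2⟩
    exact (m.add hG).ae_eq (Eventually.of_forall fun x => by simp)

theorem eventually_eLpNorm_le {α F : Type*} [MeasurableSpace α] {μ : Measure α}
    [NormedAddCommGroup F] {f : ℕ → α → F} {f₀ : α → F}
    (hf : ∀ n, AEStronglyMeasurable (f n) μ) (hf₀ : AEStronglyMeasurable f₀ μ)
    (hfl : Tendsto (fun n => eLpNorm (fun x => f n x - f₀ x) 2 μ) atTop (𝓝 0)) :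
    ∀ᶠ n in atTop, eLpNorm (f n) 2 μ ≤ 1 + eLpNorm f₀ 2 μ := by
  filter_upwards [hfl.eventually (gt_mem_nhds one_pos)] with n hn
  calc eLpNorm (f n) 2 μ = eLpNorm ((fun x => f n x - f₀ x) + f₀) 2 μ := by
        congr 1; ext x; simp
    _ ≤ _ := eLpNorm_add_le ((hf n).sub hf₀) hf₀ (by norm_num)
    _ ≤ _ := by gcongr

theorem tendsto_integral_inner_of_tendsto_of_tendsto {α F : Type*} [MeasurableSpace α]
    {μ : Measure α} [NormedAddCommGroup F] [InnerProductSpace ℝ F] {f g : ℕ → α → F}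
    {f₀ g₀ : α → F} (hf : ∀ n, MemLp (f n) 2 μ) (hf₀ : MemLp f₀ 2 μ) (hg : ∀ n, MemLp (g n) 2 μ)
    (hg₀ : MemLp g₀ 2 μ)
    (hfl : Tendsto (fun n => eLpNorm (fun x => f n x - f₀ x) 2 μ) atTop (𝓝 0))
    (hgl : Tendsto (fun n => eLpNorm (fun x => g n x - g₀ x) 2 μ) atTop (𝓝 0)) :
    Tendsto (fun n => ∫ x, inner ℝ (f n x) (g n x) ∂μ) atTop
      (𝓝 (∫ x, inner ℝ (f₀ x) (g₀ x) ∂μ)) := by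
  refine tendsto_integral_inner_of_tendsto hf hf₀ hg
    (C := 1 + eLpNorm g₀ 2 μ) (by simp [hg₀.2.ne])
    (eventually_eLpNorm_le (fun n => (hg n).1) hg₀.1 hgl) hfl ?_
  have := tendsto_integral_inner_of_tendsto (g := fun _ => f₀) hg hg₀ (fun _ => hf₀)
    hf₀.2.ne (Eventually.of_forall fun _ => le_rfl) hgl tendsto_const_nhds
  simpa only [real_inner_comm] using this

theorem tendsto_integral_mul_of_tendsto {α : Type*} [MeasurableSpace α]
    {μ : Measure α} {f g : ℕ → α → ℝ}
    {f₀ g₀ : α → ℝ} (hf : ∀ n, MemLp (f n) 2 μ) (hf₀ : MemLp f₀ 2 μ) (hg : ∀ n, MemLp (g n) 2 μ)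
    (hg₀ : MemLp g₀ 2 μ)
    (hfl : Tendsto (fun n => eLpNorm (fun x => f n x - f₀ x) 2 μ) atTop (𝓝 0))
    (hgl : Tendsto (fun n => eLpNorm (fun x => g n x - g₀ x) 2 μ) atTop (𝓝 0)) :
    Tendsto (fun n => ∫ x, f n x * g n x ∂μ) atTop (𝓝 (∫ x, f₀ x * g₀ x ∂μ)) := by
  simpa [mul_comm] using
    tendsto_integral_inner_of_tendsto_of_tendsto hf hf₀ hg hg₀ hfl hgl

theorem tendsto_eLpNorm_of_norm_le {α F F' : Type*} [MeasurableSpace α] {μ : Measure α}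
    [NormedAddCommGroup F] [NormedAddCommGroup F'] {f : ℕ → α → F} {g : ℕ → α → F'} {c : ℝ}
    (h : ∀ n x, ‖g n x‖ ≤ c * ‖f n x‖)
    (hf : Tendsto (fun n => eLpNorm (f n) 2 μ) atTop (𝓝 0)) :
    Tendsto (fun n => eLpNorm (g n) 2 μ) atTop (𝓝 0) := by
  refine tendsto_of_tendsto_of_tendsto_of_le_of_le tendsto_const_nhds
    (g := fun _ => 0) (h := fun n => ENNReal.ofReal c * eLpNorm (f n) 2 μ) ?_
    (fun n => bot_le) (fun n => ?_)
  · have := ENNReal.Tendsto.const_mul (a := ENNReal.ofReal c) hf (Or.inr ENNReal.ofReal_ne_top)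
    simpa using this
  · exact eLpNorm_le_mul_eLpNorm_of_ae_le_mul (Eventually.of_forall (h n)) 2

theorem _root_.MeasureTheory.MemLp.mul_bdd {α : Type*} [MeasurableSpace α] {μ : Measure α}
    {f g : α → ℝ} (hf : MemLp f 2 μ) (hg : AEStronglyMeasurable g μ) {C : ℝ}
    (hC : ∀ x, ‖g x‖ ≤ C) : MemLp (fun x => f x * g x) 2 μ := by
  refine hf.of_le_mul (c := C) (hf.1.mul hg) (Eventually.of_forall fun x => ?_)
  rw [norm_mul, mul_comm]
  exact mul_le_mul_of_nonneg_right (hC x) (norm_nonneg _)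

/-! ### Calculus of weak gradients -/

/-- Chain rule: the weak gradient of `u²` is `2 u ∇u`. -/
theorem HasWeakGradient.sq {u : E N → ℝ} {G : E N → E N} (h : HasWeakGradient u G)
    (hu : MemLp u 2 volume) (hG : MemLp G 2 volume) :
    HasWeakGradient (fun x => u x ^ 2) (fun x => (2 * u x) • G x) := by
  have hi : Integrable (fun x => (2 * u x) • G x) volume := by
    have := MemLp.smul (r := 1) hG (hu.const_mul 2)
    exact memLp_one_iff_integrable.1 this
  refine ⟨hu.integrable_sq.locallyIntegrable, hi.locallyIntegrable, fun φ hφ hc v => ?_⟩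
  obtain ⟨U, H, hU, hHc, hUH, hU2, hH2, tU, tH⟩ := h.exists_approx hu hG
  have hφ1 : ContDiff ℝ 1 φ := hφ.of_le (by exact_mod_cast le_top)
  have c1 : Continuous (fun x => fderiv ℝ φ x v) :=
    (hφ1.continuous_fderiv one_ne_zero).clm_apply continuous_const
  obtain ⟨C1, hC1⟩ := (hc.fderiv_apply ℝ v).exists_bound_of_continuous c1
  obtain ⟨C2, hC2⟩ := hc.exists_bound_of_continuous hφ.continuous
  -- The identity is classical for smooth functions. Both sides are grouped as a product of two `L²`
  -- factors, each convergent in `L²`, so that the limit can be taken.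
  have key : ∀ k, ∫ x, U k x * (U k x * fderiv ℝ φ x v)
      = -∫ x, inner ℝ (H k x) v * ((2 * U k x) * φ x) := by
    intro k
    have hw : HasWeakGradient (fun x => U k x ^ 2) (fun x => (2 * U k x) • H k x) := by
      refine hasWeakGradient_of_contDiff (((hU k).of_le (by exact_mod_cast le_top)).pow 2)
        (((hU k).continuous.const_mul 2).smul (hHc k)) fun x w => ?_
      have hd : DifferentiableAt ℝ (U k) x :=
        (hU k).differentiable (by simp) x
      rw [(hd.hasFDerivAt.pow 2).fderiv]
      simp [hUH, inner_smul_left]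
    have := hw.2.2 φ hφ hc v
    calc _ = ∫ x, U k x ^ 2 * fderiv ℝ φ x v := by
          refine integral_congr_ae (Eventually.of_forall fun x => ?_)
          simp only []; ring
      _ = _ := this
      _ = _ := by
          congr 1
          refine integral_congr_ae (Eventually.of_forall fun x => ?_)
          simp only [inner_smul_left, conj_trivial]; ring
  have L1 : Tendsto (fun k => ∫ x, U k x * (U k x * fderiv ℝ φ x v)) atTop
      (𝓝 (∫ x, u x * (u x * fderiv ℝ φ x v))) := by
    refine tendsto_integral_mul_of_tendsto hU2 hu
      (fun k => (hU2 k).mul_bdd c1.aestronglyMeasurable hC1)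
      (hu.mul_bdd c1.aestronglyMeasurable hC1) tU
      (tendsto_eLpNorm_of_norm_le (c := C1) (fun n x => ?_) tU)
    rw [← sub_mul, norm_mul, mul_comm]
    exact mul_le_mul_of_nonneg_right (hC1 x) (norm_nonneg _)
  have L2 : Tendsto (fun k => ∫ x, inner ℝ (H k x) v * ((2 * U k x) * φ x)) atTop
      (𝓝 (∫ x, inner ℝ (G x) v * ((2 * u x) * φ x))) := by
    refine tendsto_integral_mul_of_tendsto (fun k => (hH2 k).inner_const v) (hG.inner_const v)
      (fun k => ((hU2 k).const_mul 2).mul_bdd hφ.continuous.aestronglyMeasurable hC2)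
      ((hu.const_mul 2).mul_bdd hφ.continuous.aestronglyMeasurable hC2)
      (tendsto_eLpNorm_of_norm_le (c := ‖v‖) (fun n x => ?_) tH)
      (tendsto_eLpNorm_of_norm_le (c := 2 * C2) (fun n x => ?_) tU)
    · rw [← inner_sub_left, mul_comm]
      exact norm_inner_le_norm _ _
    · rw [← sub_mul, ← mul_sub, norm_mul, norm_mul, Real.norm_ofNat]
      have := mul_le_mul_of_nonneg_left (hC2 x) (norm_nonneg (U n x - u x))
      linarith
  have L3 := tendsto_nhds_unique L1 ((L2.neg).congr fun k => (key k).symm)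
  calc _ = ∫ x, u x * (u x * fderiv ℝ φ x v) := by
        refine integral_congr_ae (Eventually.of_forall fun x => ?_)
        simp only []; ring
    _ = _ := L3
    _ = _ := by
        congr 1
        refine integral_congr_ae (Eventually.of_forall fun x => ?_)
        simp only [inner_smul_left, conj_trivial]; ring

/-- Product rule with a smooth factor. -/
theorem HasWeakGradient.smooth_mul {u : E N → ℝ} {G : E N → E N} (h : HasWeakGradient u G)
    {χ : E N → ℝ} (hχ : ContDiff ℝ ∞ χ) :
    HasWeakGradient (fun x => χ x * u x) (fun x => χ x • G x + u x • gradient χ x) := by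
  have hχ1 : ContDiff ℝ 1 χ := hχ.of_le (by exact_mod_cast le_top)
  have hgc : Continuous (gradient χ) :=
    (InnerProductSpace.toDual ℝ (E N)).symm.continuous.comp (hχ1.continuous_fderiv one_ne_zero)
  have i1 : LocallyIntegrable (fun x => χ x * u x) volume := by
    rw [← locallyIntegrableOn_univ] at *
    exact (locallyIntegrableOn_univ.2 h.1).continuousOn_mul hχ.continuous.continuousOn isOpen_univ.isLocallyClosed
  have i2 : LocallyIntegrable (fun x => χ x • G x) volume := by
    rw [← locallyIntegrableOn_univ] at *
    exact (locallyIntegrableOn_univ.2 h.2.1).continuousOn_smul isOpen_univ.isLocallyClosed hχ.continuous.continuousOn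
  have i3 : LocallyIntegrable (fun x => u x • gradient χ x) volume := by
    rw [← locallyIntegrableOn_univ] at *
    exact (locallyIntegrableOn_univ.2 h.1).smul_continuousOn isOpen_univ.isLocallyClosed hgc.continuousOn
  refine ⟨i1, i2.add i3, fun φ hφ hc v => ?_⟩
  have hφ1 : ContDiff ℝ 1 φ := hφ.of_le (by exact_mod_cast le_top)
  have hg : ∀ x, inner ℝ (gradient χ x) v = fderiv ℝ χ x v := fun x => by
    exact inner_gradient_left
  have c1 : Continuous (fun x => fderiv ℝ χ x v) :=
    (hχ1.continuous_fderiv one_ne_zero).clm_apply continuous_const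
  have hd : ∀ x, fderiv ℝ (fun x => χ x * φ x) x v
      = χ x * fderiv ℝ φ x v + φ x * fderiv ℝ χ x v := fun x => by
    have := (hχ1.differentiable one_ne_zero x).hasFDerivAt.mul
      (hφ1.differentiable one_ne_zero x).hasFDerivAt
    have e : fderiv ℝ (fun x => χ x * φ x) x = _ := this.fderiv
    rw [e]; simp
  -- The product `χ φ` is itself a test function for `u`; the term `φ ∇χ` of its derivative moves to
  -- the other side and becomes the second summand of the new gradient.
  have h1 := h.2.2 (fun x => χ x * φ x) (hχ.mul hφ) hc.mul_left v
  simp only [hd] at h1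
  have j1 : Integrable (fun x => u x * (χ x * fderiv ℝ φ x v)) volume := by
    have := h.1.integrable_smul_right_of_hasCompactSupport
      (g := fun x => χ x * fderiv ℝ φ x v)
      (hχ.continuous.mul ((hφ1.continuous_fderiv one_ne_zero).clm_apply continuous_const))
      (hc.fderiv_apply ℝ v).mul_left
    simpa using this
  have j2 : Integrable (fun x => u x * (φ x * fderiv ℝ χ x v)) volume := by
    have := h.1.integrable_smul_right_of_hasCompactSupport
      (g := fun x => φ x * fderiv ℝ χ x v)
      (hφ.continuous.mul c1) hc.mul_right
    simpa using this
  have j3 : Integrable (fun x => inner ℝ (G x) v * (χ x * φ x)) volume := by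
    have := (h.2.1.integrable_smul_left_of_hasCompactSupport
      (g := fun x => χ x * φ x) (hχ.continuous.mul hφ.continuous) hc.mul_left).inner_const (𝕜 := ℝ) v
    refine this.congr (Eventually.of_forall fun x => ?_)
    simp [inner_smul_left]; ring
  have e1 : ∫ x, χ x * u x * fderiv ℝ φ x v = (∫ x, u x * (χ x * fderiv ℝ φ x v + φ x * fderiv ℝ χ x v))
      - ∫ x, u x * (φ x * fderiv ℝ χ x v) := by
    simp only [mul_add]
    rw [integral_add j1 j2, add_sub_cancel_right]
    refine integral_congr_ae (Eventually.of_forall fun x => ?_)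
    simp only []; ring
  rw [e1, h1, ← sub_eq_zero]
  rw [show ∀ a b c : ℝ, -a - b - -c = c - (a + b) by intros; ring, ← integral_add j3 j2, sub_eq_zero]
  refine integral_congr_ae (Eventually.of_forall fun x => ?_)
  simp only [inner_add_left, inner_smul_left, conj_trivial, hg]; ring

theorem HasWeakGradient.translate {u : E N → ℝ} {G : E N → E N} (h : HasWeakGradient u G)
    (z : E N) : HasWeakGradient (fun x => u (x + z)) (fun x => G (x + z)) := by
  have li : ∀ {F : Type} [NormedAddCommGroup F] {f : E N → F}, LocallyIntegrable f volume →
      LocallyIntegrable (fun x => f (x + z)) volume := by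
    intro F _ f hf
    rw [MeasureTheory.locallyIntegrable_iff] at hf ⊢
    intro K hK
    have := hf _ (hK.image (continuous_add_const z))
    rw [← (measurePreserving_add_right volume z).integrableOn_comp_preimage
      (measurableEmbedding_addRight z)] at this
    exact this.mono_set (subset_preimage_image _ _)
  refine ⟨li h.1, li h.2.1, fun φ hφ hc v => ?_⟩
  have h1 := h.2.2 (fun x => φ (x - z)) (hφ.comp (contDiff_id.sub contDiff_const))
    (hc.comp_homeomorph (Homeomorph.subRight z)) v
  simp only [fderiv_comp_sub] at h1
  rw [← integral_add_right_eq_self (fun x => u x * _) z,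
    ← integral_add_right_eq_self (fun x => inner ℝ (G x) v * _) z] at h1
  simpa using h1

theorem integral_comp_inv_smul_E {t : ℝ} (ht : 0 < t) (f : E N → ℝ) :
    ∫ x, f (t⁻¹ • x) = t ^ N * ∫ x, f x := by
  rw [Measure.integral_comp_inv_smul_of_nonneg volume f ht.le]
  simp

theorem integral_comp_smul_E {t : ℝ} (ht : 0 < t) (f : E N → ℝ) :
    ∫ x, f x = t ^ N * ∫ x, f (t • x) := by
  rw [← integral_comp_inv_smul_E ht]
  simp [smul_smul, ht.ne']

theorem locallyIntegrable_comp_smul {F : Type*} [NormedAddCommGroup F] {f : E N → F}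
    (hf : LocallyIntegrable f volume) {t : ℝ} (ht : t ≠ 0) :
    LocallyIntegrable (fun x => f (t • x)) volume := by
  rw [MeasureTheory.locallyIntegrable_iff] at hf ⊢
  intro K hK
  have h := hf _ (hK.image (continuous_const_smul t))
  have h2 := (integrableOn_map_equiv (μ := volume)
    (Homeomorph.smulOfNeZero t ht).toMeasurableEquiv (f := f) (s := (t • ·) '' K)).1
  have e : Measure.map (Homeomorph.smulOfNeZero t ht : E N ≃ₜ E N).toMeasurableEquiv
      (volume : Measure (E N)) = ENNReal.ofReal |(t ^ (Module.finrank ℝ (E N)))⁻¹| • volume :=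
    Measure.map_addHaar_smul volume ht
  rw [e] at h2
  have h3 := h2 (by
    rw [IntegrableOn, Measure.restrict_smul]
    exact h.smul_measure ENNReal.ofReal_ne_top)
  exact h3.mono_set (subset_preimage_image _ _)

/-- The weak gradient of the rescaled function `dilate t u`. -/
theorem HasWeakGradient.dilate {u : E N → ℝ} {G : E N → E N} (h : HasWeakGradient u G)
    {t : ℝ} (ht : 0 < t) : HasWeakGradient (dilate t u) (fun x => G (t⁻¹ • x)) := by
  have ht' : t⁻¹ ≠ 0 := inv_ne_zero ht.ne'
  refine ⟨(locallyIntegrable_comp_smul h.1 ht').smul t, locallyIntegrable_comp_smul h.2.1 ht',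
    fun φ hφ hc v => ?_⟩
  have h1 := h.2.2 (fun x => φ (t • x)) (hφ.comp (contDiff_const_smul t))
    (hc.comp_homeomorph (Homeomorph.smulOfNeZero t ht.ne')) v
  have hd : ∀ x, fderiv ℝ (fun x => φ (t • x)) x v = t * fderiv ℝ φ (t • x) v := fun x => by
    rw [fderiv_comp_smul]; simp
  simp only [hd] at h1
  have e1 := integral_comp_smul_E ht (fun x => ModNLS.dilate t u x * fderiv ℝ φ x v)
  have e2 := integral_comp_smul_E ht (fun x => inner ℝ (G (t⁻¹ • x)) v * φ x)
  simp only [ModNLS.dilate, smul_smul, inv_mul_cancel₀ ht.ne', one_smul] at e1 e2 ⊢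
  rw [e1, e2, ← mul_neg, ← h1]
  congr 1
  refine integral_congr_ae (Eventually.of_forall fun x => ?_)
  simp only []; ring

/-! ### Cutoff functions and the Sobolev inequality -/

/-- A fixed bump function equal to `1` on the unit ball and supported in the ball of radius 2. -/
noncomputable def unitBump (N : ℕ) : ContDiffBump (0 : E N) := ⟨1, 2, one_pos, one_lt_two⟩

/-- The cutoff function at scale `R`. -/
noncomputable def cutoff (N : ℕ) (R : ℝ) (x : E N) : ℝ := unitBump N (R⁻¹ • x)

theorem contDiff_cutoff (R : ℝ) {n : ℕ∞} : ContDiff ℝ n (cutoff N R) :=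
  (unitBump N).contDiff.comp (contDiff_const_smul _)

theorem cutoff_nonneg (R : ℝ) (x : E N) : 0 ≤ cutoff N R x := (unitBump N).nonneg

theorem cutoff_le_one (R : ℝ) (x : E N) : cutoff N R x ≤ 1 := (unitBump N).le_one

theorem cutoff_eq_one {R : ℝ} (hR : 0 < R) {x : E N} (hx : ‖x‖ ≤ R) : cutoff N R x = 1 := by
  refine (unitBump N).one_of_mem_closedBall ?_
  rw [mem_closedBall_zero_iff, norm_smul, norm_inv, Real.norm_of_nonneg hR.le]
  change R⁻¹ * ‖x‖ ≤ 1
  rw [inv_mul_le_iff₀ hR]; simpa using hx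

theorem cutoff_eq_zero {R : ℝ} (hR : 0 < R) {x : E N} (hx : 2 * R ≤ ‖x‖) : cutoff N R x = 0 := by
  refine (unitBump N).zero_of_le_dist ?_
  rw [dist_zero_right, norm_smul, norm_inv, Real.norm_of_nonneg hR.le]
  change 2 ≤ R⁻¹ * ‖x‖
  rw [le_inv_mul_iff₀ hR]; linarith

theorem hasCompactSupport_cutoff {R : ℝ} (hR : 0 < R) : HasCompactSupport (cutoff N R) :=
  (unitBump N).hasCompactSupport.comp_homeomorph
    (Homeomorph.smulOfNeZero R⁻¹ (inv_ne_zero hR.ne'))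

/-- All cutoffs are rescalings of one bump, so a single constant serves every scale. Errors of
truncation then vanish as `R → ∞` and are uniform for `R ≥ 1`. -/
theorem exists_norm_fderiv_cutoff_le (N : ℕ) : ∃ C : ℝ, 0 ≤ C ∧ ∀ R > 0, ∀ x : E N,
    ‖fderiv ℝ (cutoff N R) x‖ ≤ C / R := by
  obtain ⟨C, hC⟩ := ((unitBump N).hasCompactSupport.fderiv ℝ).exists_bound_of_continuous
    (((unitBump N).contDiff (n := 1)).continuous_fderiv one_ne_zero)
  refine ⟨C, (norm_nonneg _).trans (hC 0), fun R hR x => ?_⟩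
  change ‖fderiv ℝ (fun x => unitBump N (R⁻¹ • x)) x‖ ≤ _
  rw [fderiv_comp_smul, norm_smul, norm_inv, Real.norm_of_nonneg hR.le, div_eq_inv_mul]
  exact mul_le_mul_of_nonneg_left (hC _) (inv_nonneg.2 hR.le)

theorem norm_fderiv_le_of_inner {U : E N → ℝ} {x h : E N}
    (hx : ∀ v, fderiv ℝ U x v = inner ℝ h v) : ‖fderiv ℝ U x‖ ≤ ‖h‖ :=
  ContinuousLinearMap.opNorm_le_bound _ (norm_nonneg _) fun v => by
    rw [hx]; exact norm_inner_le_norm _ _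

/-- The Sobolev exponent `2N / (N - 2)`. -/
noncomputable def sobolevExp (N : ℕ) : ℝ≥0 := (2 * (N : ℝ) / (N - 2)).toNNReal

/-- The **Sobolev inequality** on `H¹(ℝ^N)`. -/
theorem exists_sobolev (hN : 3 ≤ N) : ∃ C : ℝ≥0, ∀ (u : E N → ℝ) (G : E N → E N),
    HasWeakGradient u G → MemLp u 2 volume → MemLp G 2 volume →
    eLpNorm u (sobolevExp N) volume ≤ C * eLpNorm G 2 volume := by
  have hN' : (3 : ℝ) ≤ N := by exact_mod_cast hN
  refine ⟨SNormLESNormFDerivOfEqConst ℝ (volume : Measure (E N)) 2, fun u G h hu hG => ?_⟩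
  let S : ℝ≥0 := SNormLESNormFDerivOfEqConst ℝ (volume : Measure (E N)) 2
  obtain ⟨U, H, hU, hHc, hUH, hU2, hH2, tU, tH⟩ := h.exists_approx hu hG
  obtain ⟨C, hC0, hC⟩ := exists_norm_fderiv_cutoff_le N
  obtain ⟨ns, hns, hae⟩ := (tendstoInMeasure_of_tendsto_eLpNorm (by norm_num)
    (fun n => (hU2 n).1) hu.1 (g := u) tU).exists_seq_tendsto_ae
  have hR : ∀ k : ℕ, (0 : ℝ) < k + 1 := fun k => by positivity
  -- The Gagliardo-Nirenberg-Sobolev inequality concerns compactly supported C¹ functions, so the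
  -- smooth approximations are truncated at radius `k + 1`; this costs `C / (k + 1)` times their
  -- `L²` norm.
  let W : ℕ → E N → ℝ := fun k x => cutoff N (k + 1) x * U (ns k) x
  have hW : ∀ k, ContDiff ℝ 1 (W k) := fun k =>
    ((contDiff_cutoff _ (n := 1))).mul ((hU (ns k)).of_le (by exact_mod_cast le_top))
  have hWc : ∀ k, HasCompactSupport (W k) := fun k => (hasCompactSupport_cutoff (hR k)).mul_right
  have hGNS : ∀ k, eLpNorm (W k) (sobolevExp N) volume ≤ S * eLpNorm (fderiv ℝ (W k)) 2 volume := by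
    intro k
    refine eLpNorm_le_eLpNorm_fderiv_of_eq volume (hW k) (hWc k) (p := 2) (by norm_num)
      (by simp; omega) ?_
    rw [sobolevExp, Real.coe_toNNReal _ (by apply div_nonneg <;> linarith)]
    have : (N : ℝ) - 2 ≠ 0 := by linarith
    have : (N : ℝ) ≠ 0 := by linarith
    simp
    field_simp
  have hgrad : ∀ k, eLpNorm (fderiv ℝ (W k)) 2 volume
      ≤ eLpNorm (H (ns k)) 2 volume
        + ENNReal.ofReal (C / (k + 1)) * eLpNorm (U (ns k)) 2 volume := by
    intro k
    have hd : ∀ x, ‖fderiv ℝ (W k) x‖ ≤ ‖H (ns k) x‖ + C / (k + 1) * ‖U (ns k) x‖ := by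
      intro x
      have e := (((contDiff_cutoff (N := N) ((k : ℝ) + 1) (n := 1)).differentiable
        one_ne_zero x).hasFDerivAt.mul ((hU (ns k)).differentiable (by simp) x).hasFDerivAt).fderiv
      have e' : fderiv ℝ (W k) x = _ := e
      rw [e']
      refine (norm_add_le _ _).trans (add_le_add ?_ ?_)
      · rw [norm_smul, Real.norm_of_nonneg (cutoff_nonneg _ _)]
        exact (mul_le_of_le_one_left (norm_nonneg _) (cutoff_le_one _ _)).trans
          (norm_fderiv_le_of_inner (hUH _ x))
      · rw [norm_smul, mul_comm]
        exact mul_le_mul_of_nonneg_right (hC _ (hR k) x) (norm_nonneg _)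
    calc _ ≤ eLpNorm (fun x => ‖H (ns k) x‖ + C / (k + 1) * ‖U (ns k) x‖) 2 volume :=
          eLpNorm_mono_real hd
      _ ≤ eLpNorm (fun x => ‖H (ns k) x‖) 2 volume
          + eLpNorm (fun x => C / (k + 1) * ‖U (ns k) x‖) 2 volume :=
          eLpNorm_add_le (hH2 _).1.norm ((hU2 _).1.norm.const_mul _) (by norm_num)
      _ ≤ _ := by
          rw [eLpNorm_norm]
          gcongr
          refine eLpNorm_le_mul_eLpNorm_of_ae_le_mul (Eventually.of_forall fun x => ?_) 2
          rw [norm_mul, norm_norm, Real.norm_of_nonneg (div_nonneg hC0 (hR k).le)]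
  have hlim : Tendsto (fun k => (S : ℝ≥0∞) * ((eLpNorm G 2 volume
      + eLpNorm (fun x => H (ns k) x - G x) 2 volume)
        + ENNReal.ofReal (C / (k + 1)) * (1 + eLpNorm u 2 volume))) atTop
      (𝓝 (S * ((eLpNorm G 2 volume + 0) + 0 * (1 + eLpNorm u 2 volume)))) := by
    have hz : Tendsto (fun k : ℕ => ENNReal.ofReal (C / (k + 1))) atTop (𝓝 0) := by
      have := ENNReal.tendsto_ofReal ((tendsto_const_div_atTop_nhds_zero_nat C).comp
        (tendsto_add_atTop_nat 1))
      simpa using this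
    refine ENNReal.Tendsto.const_mul ?_ (Or.inr ENNReal.coe_ne_top)
    refine Tendsto.add (tendsto_const_nhds.add (tH.comp hns.tendsto_atTop)) ?_
    exact ENNReal.Tendsto.mul_const hz (Or.inr (by simp [hu.2.ne]))
  rw [add_zero, zero_mul, add_zero] at hlim
  have hUb := (hns.tendsto_atTop).eventually (eventually_eLpNorm_le (fun n => (hU2 n).1) hu.1 tU)
  -- By Fatou, a bound for almost all `W k` passes to the a.e. limit `u`; any `c` above the limit of
  -- the right-hand sides is such a bound.
  refine le_of_forall_gt_imp_ge_of_dense fun c hc => ?_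
  refine Lp.eLpNorm_le_of_ae_tendsto (u := atTop) (f := W) ?_
    (fun k => (hW k).continuous.aestronglyMeasurable) ?_
  · filter_upwards [hlim.eventually (gt_mem_nhds hc), hUb] with k hk hk2
    refine ((hGNS k).trans ?_).trans hk.le
    gcongr
    refine (hgrad k).trans ?_
    gcongr
    calc eLpNorm (H (ns k)) 2 volume = eLpNorm (G + fun x => H (ns k) x - G x) 2 volume := by
          congr 1; ext1 x; simp
      _ ≤ _ := eLpNorm_add_le hG.1 ((hH2 _).1.sub hG.1) (by norm_num)
  · filter_upwards [hae] with x hx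
    refine hx.congr' ?_
    filter_upwards [eventually_ge_atTop ⌈‖x‖⌉₊] with k hk
    have : ‖x‖ ≤ (k : ℝ) + 1 := by
      have := Nat.ceil_le.1 hk
      linarith
    simp [W, cutoff_eq_one (hR k) this]

/-! ### Translation estimates in `H¹` -/

/-- The increment is the integral of the gradient along the segment from `x` to `x - y`;
Cauchy-Schwarz in the parameter, Tonelli and translation invariance do the rest. -/
theorem eLpNorm_translate_sub_le_of_contDiff {U : E N → ℝ} {H : E N → E N} (hU : ContDiff ℝ 1 U)
    (hH : Continuous H) (hUH : ∀ x v, fderiv ℝ U x v = inner ℝ (H x) v) (y : E N) :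
    eLpNorm (fun x => U (x - y) - U x) 2 volume ≤ ‖y‖ₑ * eLpNorm H 2 volume := by
  -- The factor `1` is the weight to which `lintegral_mul_sq_le` is applied below.
  have h1 : ∀ x, ‖U (x - y) - U x‖ₑ ≤ ∫⁻ t in Icc (0 : ℝ) 1, 1 * (‖H (x - t • y)‖ₑ * ‖y‖ₑ) := by
    intro x
    have hd : ∀ t : ℝ, HasDerivAt (fun t : ℝ => U (x - t • y)) (inner ℝ (H (x - t • y)) (-y)) t := by
      intro t
      have h2 : HasDerivAt (fun t : ℝ => x - t • y) (-y) t := by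
        simpa using ((hasDerivAt_id t).smul_const y).const_sub x
      have := ((hU.differentiable one_ne_zero) (x - t • y)).hasFDerivAt.comp_hasDerivAt t h2
      rw [hUH] at this
      exact this
    have hc : Continuous fun t : ℝ => inner ℝ (H (x - t • y)) (-y) := by fun_prop
    have e := intervalIntegral.integral_eq_sub_of_hasDerivAt (a := 0) (b := 1)
      (fun t _ => hd t) (hc.intervalIntegrable _ _)
    simp only [one_smul, zero_smul, sub_zero] at e
    rw [← e, intervalIntegral.integral_of_le zero_le_one, ← integral_Icc_eq_integral_Ioc]
    refine (enorm_integral_le_lintegral_enorm _).trans (lintegral_mono fun t => ?_)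
    rw [one_mul, ← enorm_neg y]
    rw [← ofReal_norm, ← ofReal_norm, ← ofReal_norm, ← ENNReal.ofReal_mul (norm_nonneg _)]
    exact ENNReal.ofReal_le_ofReal (norm_inner_le_norm _ _)
  have key : eLpNorm (fun x => U (x - y) - U x) 2 volume ^ 2
      ≤ (‖y‖ₑ * eLpNorm H 2 volume) ^ 2 := by
    rw [eLpNorm_two_sq, mul_pow, eLpNorm_two_sq]
    calc ∫⁻ x, ‖U (x - y) - U x‖ₑ ^ 2
        ≤ ∫⁻ x, ∫⁻ t in Icc (0 : ℝ) 1, 1 * (‖H (x - t • y)‖ₑ * ‖y‖ₑ) ^ 2 := by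
          refine lintegral_mono fun x => (pow_le_pow_left' (h1 x) 2).trans ?_
          refine (lintegral_mul_sq_le (by fun_prop) ?_).trans_eq ?_
          · exact (Continuous.enorm (by fun_prop)).measurable.aemeasurable.mul_const _
          · simp
      _ = ∫⁻ t in Icc (0 : ℝ) 1, ∫⁻ x, 1 * (‖H (x - t • y)‖ₑ * ‖y‖ₑ) ^ 2 := by
          refine lintegral_lintegral_swap ?_
          simp only [one_mul]
          refine (((Continuous.enorm ?_).measurable.mul_const _).pow_const 2).aemeasurable
          fun_prop
      _ = ∫⁻ t in Icc (0 : ℝ) 1, ‖y‖ₑ ^ 2 * ∫⁻ x, ‖H x‖ₑ ^ 2 := by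
          refine lintegral_congr fun t => ?_
          rw [← lintegral_sub_right_eq_self (fun x => ‖H x‖ₑ ^ 2) (t • y),
            ← lintegral_const_mul' _ _ (by simp)]
          refine lintegral_congr fun x => ?_
          rw [one_mul, mul_pow, mul_comm]
      _ = _ := by simp
  exact (ENNReal.pow_le_pow_left_iff two_ne_zero).1 key

/-- Translations of `H¹` functions are Lipschitz in `L²`. -/
theorem HasWeakGradient.eLpNorm_translate_sub_le {u : E N → ℝ} {G : E N → E N}
    (h : HasWeakGradient u G) (hu : MemLp u 2 volume) (hG : MemLp G 2 volume) (y : E N) :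
    eLpNorm (fun x => u (x - y) - u x) 2 volume ≤ ‖y‖ₑ * eLpNorm G 2 volume := by
  obtain ⟨U, H, hU, hHc, hUH, hU2, hH2, tU, tH⟩ := h.exists_approx hu hG
  obtain ⟨ns, hns, hae⟩ := (tendstoInMeasure_of_tendsto_eLpNorm (by norm_num)
    (fun n => (hU2 n).1) hu.1 (g := u) tU).exists_seq_tendsto_ae
  have hae' := (measurePreserving_sub_right volume y).quasiMeasurePreserving.ae hae
  have hlim : Tendsto (fun k => ‖y‖ₑ * (eLpNorm G 2 volume
      + eLpNorm (fun x => H (ns k) x - G x) 2 volume)) atTop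
      (𝓝 (‖y‖ₑ * (eLpNorm G 2 volume + 0))) :=
    ENNReal.Tendsto.const_mul (tendsto_const_nhds.add (tH.comp hns.tendsto_atTop)) (by simp)
  rw [add_zero] at hlim
  refine le_of_forall_gt_imp_ge_of_dense fun c hc => ?_
  refine Lp.eLpNorm_le_of_ae_tendsto (u := atTop) (f := fun k x => U (ns k) (x - y) - U (ns k) x)
    ?_ (fun k => ?_) ?_
  · filter_upwards [hlim.eventually (gt_mem_nhds hc)] with k hk
    refine ((eLpNorm_translate_sub_le_of_contDiff ((hU _).of_le (by exact_mod_cast le_top))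
      (hHc _) (hUH _) y).trans ?_).trans hk.le
    gcongr
    calc eLpNorm (H (ns k)) 2 volume = eLpNorm (G + fun x => H (ns k) x - G x) 2 volume := by
          congr 1; ext1 x; simp
      _ ≤ _ := eLpNorm_add_le hG.1 ((hH2 _).1.sub hG.1) (by norm_num)
  · have := (hU (ns k)).continuous
    exact Continuous.aestronglyMeasurable (by fun_prop)
  · filter_upwards [hae, hae'] with x hx hx'
    exact hx'.sub hx

/-- The rate depends only on the radius of the bump and on the norm of the gradient, hence is
uniform on bounded subsets of `H¹`. Rellich's theorem rests on this uniformity. -/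
theorem HasWeakGradient.eLpNorm_mollify_sub_le {u : E N → ℝ} {G : E N → E N}
    (h : HasWeakGradient u G) (hu : MemLp u 2 volume) (hG : MemLp G 2 volume)
    (φ : ContDiffBump (0 : E N)) :
    eLpNorm (fun x => mollify φ u x - u x) 2 volume
      ≤ ENNReal.ofReal φ.rOut * eLpNorm G 2 volume := by
  refine ModNLS.eLpNorm_mollify_sub_le φ h.1 fun y hy => ?_
  refine (h.eLpNorm_translate_sub_le hu hG y).trans ?_
  gcongr
  rw [← ofReal_norm]
  exact ENNReal.ofReal_le_ofReal (mem_ball_zero_iff.1 hy).le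

end

/-! ### Weak convergence in `L²` and Rellich's theorem -/

section

variable {N : ℕ} {F : Type*} [NormedAddCommGroup F] [InnerProductSpace ℝ F]

/-- Weak convergence in `L²(ℝ^N)`. -/
def TendstoWeakly (f : ℕ → E N → F) (g : E N → F) : Prop :=
  ∀ h : E N → F, MemLp h 2 volume →
    Tendsto (fun n => ∫ x, inner ℝ (f n x) (h x)) atTop (𝓝 (∫ x, inner ℝ (g x) (h x)))

theorem TendstoWeakly.comp {f : ℕ → E N → F} {g : E N → F} (h : TendstoWeakly f g) {φ : ℕ → ℕ}
    (hφ : StrictMono φ) : TendstoWeakly (fun n => f (φ n)) g :=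
  fun k hk => (h k hk).comp hφ.tendsto_atTop

/-- Bounded sequences in `L²` have weakly convergent subsequences. -/
theorem exists_tendstoWeakly [CompleteSpace F] [SecondCountableTopology F] {f : ℕ → E N → F}
    (hf : ∀ n, MemLp (f n) 2 volume) {C : ℝ≥0∞} (hC : C ≠ ⊤)
    (hb : ∀ n, eLpNorm (f n) 2 volume ≤ C) :
    ∃ φ : ℕ → ℕ, StrictMono φ ∧ ∃ g, MemLp g 2 volume ∧ TendstoWeakly (fun n => f (φ n)) g := by
  -- This gives the separability of `L²`, needed for sequential compactness of balls in the weak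
  -- dual. The sequence is carried to the dual and its limit back by the Riesz isometry.
  have : Fact ((2 : ℝ≥0∞) ≠ ⊤) := ⟨by norm_num⟩
  let H := Lp F 2 (volume : Measure (E N))
  let T := InnerProductSpace.toDual ℝ H
  let x : ℕ → WeakDual ℝ H := fun n => StrongDual.toWeakDual (T ((hf n).toLp (f n)))
  have hx : ∀ n, x n ∈ WeakDual.toStrongDual ⁻¹' Metric.closedBall (0 : StrongDual ℝ H) C.toReal := by
    intro n
    have e : WeakDual.toStrongDual (x n) = T ((hf n).toLp (f n)) := rfl
    rw [mem_preimage, e]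
    refine (dist_zero_right (T ((hf n).toLp (f n)))).trans_le ?_
    rw [LinearIsometryEquiv.norm_map, Lp.norm_toLp]
    exact ENNReal.toReal_mono hC (hb n)
  obtain ⟨a, -, φ, hφ, hlim⟩ := WeakDual.isSeqCompact_closedBall ℝ H 0 C.toReal hx
  let g : H := T.symm (WeakDual.toStrongDual a)
  refine ⟨φ, hφ, g, Lp.memLp g, fun h hh => ?_⟩
  have h1 := ((WeakDual.eval_continuous (hh.toLp h)).tendsto a).comp hlim
  have e1 : ∀ n, (x n) (hh.toLp h) = ∫ y, inner ℝ (f n y) (h y) := by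
    intro n
    change T ((hf n).toLp (f n)) (hh.toLp h) = _
    rw [InnerProductSpace.toDual_apply_apply, L2.inner_def]
    refine integral_congr_ae ?_
    filter_upwards [hh.coeFn_toLp, (hf n).coeFn_toLp] with y h1 h2
    rw [h1, h2]
  have e2 : a (hh.toLp h) = ∫ y, inner ℝ (g y) (h y) := by
    have : a (hh.toLp h) = T g (hh.toLp h) := by
      simp only [g, LinearIsometryEquiv.apply_symm_apply]; rfl
    rw [this, InnerProductSpace.toDual_apply_apply, L2.inner_def]
    refine integral_congr_ae ?_
    filter_upwards [hh.coeFn_toLp] with y h1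
    rw [h1]
  rw [← e2]
  refine h1.congr fun n => ?_
  simp [e1]

/-- The value at a point is a pairing with a fixed `L²` function, so weak convergence makes
mollifications converge pointwise. -/
theorem mollify_eq_integral_inner (φ : ContDiffBump (0 : E N)) (f : E N → ℝ) (x : E N) :
    mollify φ f x = ∫ y, inner ℝ (f y) (φ.normed volume (x - y)) := by
  rw [mollify_apply, ← integral_sub_left_eq_self _ volume x]
  simp

theorem memLp_normed_sub (φ : ContDiffBump (0 : E N)) (x : E N) :
    MemLp (fun y => φ.normed volume (x - y)) 2 volume :=
  Continuous.memLp_of_hasCompactSupport (φ.continuous_normed.comp (by fun_prop))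
    (φ.hasCompactSupport_normed.comp_homeomorph (Homeomorph.subLeft x))

theorem norm_mollify_le (φ : ContDiffBump (0 : E N)) {f : E N → ℝ} (hf : MemLp f 2 volume)
    (x : E N) : ‖mollify φ f x‖ ≤ (eLpNorm f 2 volume).toReal
      * (eLpNorm (φ.normed (volume : Measure (E N))) 2 volume).toReal := by
  rw [mollify_eq_integral_inner, Real.norm_eq_abs]
  refine (abs_integral_inner_le hf (memLp_normed_sub φ x)).trans_eq ?_
  have := eLpNorm_comp_measurePreserving (p := 2) (g := φ.normed (volume : Measure (E N)))
    φ.continuous_normed.aestronglyMeasurable (Measure.measurePreserving_sub_left volume x)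
  rw [← this]
  rfl

/-- **Rellich's theorem**: weak convergence in `L²` with bounded gradients implies strong
convergence in `L²` of balls. -/
theorem TendstoWeakly.tendsto_eLpNorm_restrict_ball {v : ℕ → E N → ℝ} {v₀ : E N → ℝ}
    {G : ℕ → E N → E N} (hw : TendstoWeakly v v₀) (h : ∀ n, HasWeakGradient (v n) (G n))
    (hv : ∀ n, MemLp (v n) 2 volume) (hv₀ : MemLp v₀ 2 volume) (hG : ∀ n, MemLp (G n) 2 volume)
    {C : ℝ≥0∞} (hC : C ≠ ⊤) (hvC : ∀ n, eLpNorm (v n) 2 volume ≤ C)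
    (hGC : ∀ n, eLpNorm (G n) 2 volume ≤ C) (R : ℝ) :
    Tendsto (fun n => eLpNorm (fun x => v n x - v₀ x) 2 (volume.restrict (Metric.ball 0 R)))
      atTop (𝓝 0) := by
  rw [ENNReal.tendsto_atTop_zero]
  intro ε hε
  have hε3 : 0 < ε / 3 := ENNReal.div_pos hε.ne' (by norm_num)
  have l1 : Tendsto (fun k => ENNReal.ofReal (shrinkingBump N k).rOut * C) atTop (𝓝 0) := by
    have := ENNReal.Tendsto.mul_const (b := C)
      (ENNReal.tendsto_ofReal (tendsto_rOut_shrinkingBump N)) (Or.inr hC)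
    simpa using this
  -- One mollifier is fixed for all `n`: the gradient bound makes its error on every `v n` at most
  -- `ε / 3`, and its error on `v₀` is small for large `k`.
  obtain ⟨k, hk1, hk2⟩ := ((l1.eventually (gt_mem_nhds hε3)).and
    ((tendsto_eLpNorm_mollify_sub hv₀).eventually (gt_mem_nhds hε3))).exists
  set φ := shrinkingBump N k
  have cv : ∀ n, Continuous (mollify φ (v n)) := fun n => ((h n).contDiff_mollify φ).continuous
  have cv₀ : Continuous (mollify φ v₀) := (φ.hasCompactSupport_normed.contDiff_convolution_left
      (ContinuousLinearMap.lsmul ℝ ℝ) (φ.contDiff_normed (n := 0))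
      (hv₀.locallyIntegrable (by norm_num))).continuous
  -- With the mollifier fixed, the mollified functions converge pointwise and are uniformly bounded,
  -- so dominated convergence applies on the ball, which has finite measure.
  have l2 : Tendsto (fun n => eLpNorm (fun x => mollify φ (v n) x - mollify φ v₀ x) 2
      (volume.restrict (Metric.ball 0 R))) atTop (𝓝 0) := by
    have hp : ∀ x, Tendsto (fun n => mollify φ (v n) x - mollify φ v₀ x) atTop (𝓝 0) := by
      intro x
      have := (hw _ (memLp_normed_sub φ x)).sub_const (mollify φ v₀ x)
      simp only [← mollify_eq_integral_inner, sub_self] at this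
      exact this
    set M := (eLpNorm (φ.normed (volume : Measure (E N))) 2 volume).toReal
    set K := C.toReal * M + (eLpNorm v₀ 2 volume).toReal * M
    have hb : ∀ n x, ‖mollify φ (v n) x - mollify φ v₀ x‖ ≤ K := by
      intro n x
      refine (norm_sub_le _ _).trans (add_le_add ((norm_mollify_le φ (hv n) x).trans ?_)
        (norm_mollify_le φ hv₀ x))
      exact mul_le_mul_of_nonneg_right (ENNReal.toReal_mono hC (hvC n)) ENNReal.toReal_nonneg
    have l3 : Tendsto (fun n => ∫⁻ x in Metric.ball 0 R,
        ‖mollify φ (v n) x - mollify φ v₀ x‖ₑ ^ 2) atTop (𝓝 (∫⁻ x in Metric.ball (0 : E N) R, 0)) := by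
      refine tendsto_lintegral_of_dominated_convergence' (fun _ => ENNReal.ofReal K ^ 2)
        (fun n => (((cv n).sub cv₀).enorm.measurable.pow_const 2).aemeasurable)
        (fun n => Eventually.of_forall fun x => ?_) ?_ (Eventually.of_forall fun x => ?_)
      · change ‖mollify φ (v n) x - mollify φ v₀ x‖ₑ ^ 2 ≤ ENNReal.ofReal K ^ 2
        rw [← ofReal_norm]
        gcongr
        exact hb n x
      · rw [setLIntegral_const]
        exact ENNReal.mul_ne_top (by simp) measure_ball_lt_top.ne
      · have := ENNReal.Tendsto.pow (n := 2) (hp x).enorm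
        simpa using this
    rw [lintegral_zero] at l3
    simp only [← eLpNorm_two_sq] at l3
    have := l3.ennrpow_const (1 / 2)
    rw [ENNReal.zero_rpow_of_pos (by norm_num)] at this
    refine this.congr fun n => ?_
    rw [← ENNReal.rpow_natCast, ← ENNReal.rpow_mul]
    norm_num
  obtain ⟨n0, hn0⟩ := eventually_atTop.1 (l2.eventually (gt_mem_nhds hε3))
  refine ⟨n0, fun n hn => ?_⟩
  have m1 : AEStronglyMeasurable (fun x => mollify φ (v n) x - v n x)
      (volume.restrict (Metric.ball 0 R)) :=
    ((cv n).aestronglyMeasurable.sub (hv n).1).restrict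
  have m2 : AEStronglyMeasurable (fun x => mollify φ v₀ x - v₀ x)
      (volume.restrict (Metric.ball 0 R)) :=
    (cv₀.aestronglyMeasurable.sub hv₀.1).restrict
  have m3 : AEStronglyMeasurable (fun x => mollify φ (v n) x - mollify φ v₀ x)
      (volume.restrict (Metric.ball 0 R)) :=
    ((cv n).sub cv₀).aestronglyMeasurable
  have b1 : eLpNorm (fun x => mollify φ (v n) x - v n x) 2 (volume.restrict (Metric.ball 0 R))
      ≤ ε / 3 := by
    refine (eLpNorm_mono_measure _ Measure.restrict_le_self).trans ?_
    refine ((h n).eLpNorm_mollify_sub_le (hv n) (hG n) φ).trans (le_trans ?_ hk1.le)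
    gcongr
    exact hGC n
  have b2 : eLpNorm (fun x => mollify φ v₀ x - v₀ x) 2 (volume.restrict (Metric.ball 0 R))
      ≤ ε / 3 :=
    (eLpNorm_mono_measure _ Measure.restrict_le_self).trans hk2.le
  calc eLpNorm (fun x => v n x - v₀ x) 2 (volume.restrict (Metric.ball 0 R))
      = eLpNorm (((fun x => mollify φ v₀ x - v₀ x)
        + fun x => mollify φ (v n) x - mollify φ v₀ x)
          - fun x => mollify φ (v n) x - v n x) 2 (volume.restrict (Metric.ball 0 R)) := by
        congr 1; ext x; simp only [Pi.add_apply, Pi.sub_apply]; ring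
    _ ≤ (ε / 3 + ε / 3) + ε / 3 :=
        (eLpNorm_sub_le (m2.add m3) m1 (by norm_num)).trans (add_le_add
          ((eLpNorm_add_le m2 m3 (by norm_num)).trans (add_le_add b2 (hn0 n hn).le)) b1)
    _ = ε := ENNReal.add_thirds ε

end

/-! ### Interpolation and Lions' vanishing lemma -/

variable {N : ℕ}

theorem coe_sobolevExp (hN : 3 ≤ N) : (sobolevExp N : ℝ) = 2 * (N : ℝ) / (N - 2) := by
  have : (3 : ℝ) ≤ N := by exact_mod_cast hN
  exact Real.coe_toNNReal _ (by apply div_nonneg <;> linarith)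

theorem sobolevExp_pos (hN : 3 ≤ N) : 0 < (sobolevExp N : ℝ) := by
  have : (3 : ℝ) ≤ N := by exact_mod_cast hN
  rw [coe_sobolevExp hN]; apply div_pos <;> linarith

theorem two_lt_sobolevExp (hN : 3 ≤ N) : 2 < (sobolevExp N : ℝ) := by
  have : (3 : ℝ) ≤ N := by exact_mod_cast hN
  rw [coe_sobolevExp hN, lt_div_iff₀ (by linarith)]; linarith

/-- Interpolation between `L²` and the Sobolev exponent. -/
theorem lintegral_interpolation (hN : 3 ≤ N) {w : E N → ℝ} (hw : AEStronglyMeasurable w volume) :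
    ∫⁻ x, ‖w x‖ₑ ^ (2 + 4 / (N : ℝ))
      ≤ (∫⁻ x, ‖w x‖ₑ ^ 2) ^ (2 / (N : ℝ)) * eLpNorm w (sobolevExp N) volume ^ 2 := by
  have hN' : (3 : ℝ) ≤ N := by exact_mod_cast hN
  have hq := sobolevExp_pos hN
  -- Hölder with exponents N / 2 and N / (N - 2) for |w| ^ (4 / N) · |w|². The Sobolev norm then
  -- appears to the power 2 exactly, which is why 2 + 4 / N is the convenient exponent: the local
  -- bounds stay quadratic and can be integrated over all centres.
  have hconj : (((N : ℝ) / 2)).HolderConjugate ((N : ℝ) / (N - 2)) := by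
    rw [Real.holderConjugate_iff]
    constructor
    · linarith
    · rw [inv_div, inv_div]; field_simp; ring
  have h := ENNReal.lintegral_mul_le_Lp_mul_Lq volume hconj
    (f := fun x => ‖w x‖ₑ ^ (4 / (N : ℝ))) (g := fun x => ‖w x‖ₑ ^ (2 : ℝ))
    (hw.enorm.pow_const _) (hw.enorm.pow_const _)
  have e1 : ∀ x, ((fun x => ‖w x‖ₑ ^ (4 / (N : ℝ))) * fun x => ‖w x‖ₑ ^ (2 : ℝ)) x
      = ‖w x‖ₑ ^ (2 + 4 / (N : ℝ)) := fun x => by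
    simp only [Pi.mul_apply]
    rw [← ENNReal.rpow_add_of_nonneg _ _ (by positivity) (by norm_num), add_comm]
  have e2 : ∀ x, (‖w x‖ₑ ^ (4 / (N : ℝ))) ^ ((N : ℝ) / 2) = ‖w x‖ₑ ^ 2 := fun x => by
    rw [← ENNReal.rpow_mul, show 4 / (N : ℝ) * (N / 2) = 2 by field_simp; norm_num]; norm_num
  have e3 : ∀ x, (‖w x‖ₑ ^ (2 : ℝ)) ^ ((N : ℝ) / (N - 2)) = ‖w x‖ₑ ^ (sobolevExp N : ℝ) :=
    fun x => by
      rw [← ENNReal.rpow_mul, coe_sobolevExp hN, mul_div_assoc]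
  simp only [e1, e2, e3] at h
  refine h.trans_eq ?_
  rw [one_div_div, one_div_div]
  congr 1
  rw [eLpNorm_nnreal_eq_lintegral (by intro h0; rw [h0] at hq; simp at hq),
    ← ENNReal.rpow_natCast, ← ENNReal.rpow_mul, coe_sobolevExp hN]
  congr 1
  have : (N : ℝ) - 2 ≠ 0 := by linarith
  push_cast
  field_simp

theorem enorm_add_sq_le {F : Type*} [NormedAddCommGroup F] (a b : F) :
    ‖a + b‖ₑ ^ 2 ≤ 2 * (‖a‖ₑ ^ 2 + ‖b‖ₑ ^ 2) := by
  calc ‖a + b‖ₑ ^ 2 ≤ (‖a‖ₑ + ‖b‖ₑ) ^ 2 := pow_le_pow_left' (enorm_add_le _ _) 2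
    _ ≤ _ := by
      have := ENNReal.rpow_add_le_mul_rpow_add_rpow ‖a‖ₑ ‖b‖ₑ (p := 2) (by norm_num)
      norm_num at this
      exact this

theorem norm_gradient (χ : E N → ℝ) (x : E N) : ‖gradient χ x‖ = ‖fderiv ℝ χ x‖ := by
  rw [gradient, LinearIsometryEquiv.norm_map]

theorem lintegral_sub_swap (f : E N → ℝ≥0∞) (x : E N) : ∫⁻ y, f (x - y) = ∫⁻ y, f y :=
  lintegral_sub_left_eq_self f x

/-- Weak gradient of an `H¹` function times a translated cutoff, with integrability. -/
theorem HasWeakGradient.bddSmooth_mul {u : E N → ℝ} {G : E N → E N} (h : HasWeakGradient u G)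
    (hu : MemLp u 2 volume) (hG : MemLp G 2 volume) {χ : E N → ℝ} (hχ : ContDiff ℝ ∞ χ) {C : ℝ}
    (h1 : ∀ x, ‖χ x‖ ≤ C) (h2 : ∀ x, ‖fderiv ℝ χ x‖ ≤ C) :
    HasWeakGradient (fun x => χ x * u x) (fun x => χ x • G x + u x • gradient χ x) ∧
    MemLp (fun x => χ x * u x) 2 volume ∧
    MemLp (fun x => χ x • G x + u x • gradient χ x) 2 volume := by
  have hχ1 : ContDiff ℝ 1 χ := hχ.of_le (by exact_mod_cast le_top)
  have hgc : Continuous (gradient χ) :=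
    (InnerProductSpace.toDual ℝ (E N)).symm.continuous.comp (hχ1.continuous_fderiv one_ne_zero)
  refine ⟨h.smooth_mul hχ, ?_, MemLp.add ?_ ?_⟩
  · refine hu.of_le_mul (c := C) (hχ.continuous.aestronglyMeasurable.mul hu.1)
      (Eventually.of_forall fun x => ?_)
    rw [norm_mul]
    exact mul_le_mul_of_nonneg_right (h1 x) (norm_nonneg _)
  · refine hG.of_le_mul (c := C) (hχ.continuous.aestronglyMeasurable.smul hG.1)
      (Eventually.of_forall fun x => ?_)
    rw [norm_smul]
    exact mul_le_mul_of_nonneg_right (h1 x) (norm_nonneg _)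
  · refine hu.of_le_mul (c := C) (hu.1.smul hgc.aestronglyMeasurable)
      (Eventually.of_forall fun x => ?_)
    rw [norm_smul, norm_gradient, mul_comm]
    exact mul_le_mul_of_nonneg_right (h2 x) (norm_nonneg _)

/-- If the local mass of an `H¹` function is uniformly small, then so is its `L^(2+4/N)` norm. -/
theorem exists_lintegral_le_of_local_mass (hN : 3 ≤ N) : ∃ K : ℝ≥0∞, K ≠ ⊤ ∧
    ∀ (u : E N → ℝ) (G : E N → E N) (δ : ℝ≥0), HasWeakGradient u G → MemLp u 2 volume →
    MemLp G 2 volume → (∀ y, ∫⁻ x in Metric.ball y 2, ‖u x‖ₑ ^ 2 ≤ δ) →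
    ∫⁻ x, ‖u x‖ₑ ^ (2 + 4 / (N : ℝ))
      ≤ K * (δ : ℝ≥0∞) ^ (2 / (N : ℝ)) * ((∫⁻ x, ‖G x‖ₑ ^ 2) + ∫⁻ x, ‖u x‖ₑ ^ 2) := by
  obtain ⟨S, hS⟩ := exists_sobolev hN
  obtain ⟨C, hC0, hC⟩ := exists_norm_fderiv_cutoff_le N
  set ψ : E N → ℝ := cutoff N 1
  have hψ : ContDiff ℝ ∞ ψ := contDiff_cutoff 1
  have hψ1 : ContDiff ℝ 1 ψ := contDiff_cutoff 1
  have hψc : HasCompactSupport ψ := hasCompactSupport_cutoff one_pos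
  have hgc : Continuous (gradient ψ) :=
    (InnerProductSpace.toDual ℝ (E N)).symm.continuous.comp (hψ1.continuous_fderiv one_ne_zero)
  have hgs : HasCompactSupport (gradient ψ) :=
    (hψc.fderiv ℝ).comp_left (map_zero (InnerProductSpace.toDual ℝ (E N)).symm)
  set ρ := volume (Metric.ball (0 : E N) 1)
  have hρ0 : ρ ≠ 0 := (Metric.measure_ball_pos volume _ one_pos).ne'
  have hρt : ρ ≠ ⊤ := measure_ball_lt_top.ne
  set K1 := ∫⁻ x, ‖ψ x‖ₑ ^ 2
  set K2 := ∫⁻ x, ‖gradient ψ x‖ₑ ^ 2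
  have hK1 : K1 ≠ ⊤ := by
    simp only [K1]; rw [← eLpNorm_two_sq]
    exact ENNReal.pow_ne_top (hψ.continuous.memLp_of_hasCompactSupport hψc).2.ne
  have hK2 : K2 ≠ ⊤ := by
    simp only [K2]; rw [← eLpNorm_two_sq]
    exact ENNReal.pow_ne_top (hgc.memLp_of_hasCompactSupport hgs).2.ne
  refine ⟨ρ⁻¹ * ((S : ℝ≥0∞) ^ 2 * (2 * (K1 + K2))), ?_, fun u G δ h hu hG hδ => ?_⟩
  · exact ENNReal.mul_ne_top (ENNReal.inv_ne_top.2 hρ0) (ENNReal.mul_ne_top (by simp)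
      (ENNReal.mul_ne_top (by norm_num) (ENNReal.add_ne_top.2 ⟨hK1, hK2⟩)))
  -- Interpolation and Sobolev for `u` localized near `y`: the mass factor is at most δ ^ (2 / N),
  -- independently of `y`, and what remains is quadratic in `u` and `G`.
  have hloc : ∀ y, ∫⁻ x, ‖ψ (x - y) * u x‖ₑ ^ (2 + 4 / (N : ℝ))
      ≤ (δ : ℝ≥0∞) ^ (2 / (N : ℝ)) * (S ^ 2 * (2 * ∫⁻ x, (‖ψ (x - y)‖ₑ ^ 2 * ‖G x‖ₑ ^ 2
          + ‖gradient ψ (x - y)‖ₑ ^ 2 * ‖u x‖ₑ ^ 2))) := by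
    intro y
    have hd : ∀ x, fderiv ℝ (fun x => ψ (x - y)) x = fderiv ℝ ψ (x - y) :=
      fun x => fderiv_comp_sub y
    have hgr : ∀ x, gradient (fun x => ψ (x - y)) x = gradient ψ (x - y) := fun x => by
      rw [gradient, hd, gradient]
    obtain ⟨w1, w2, w3⟩ := h.bddSmooth_mul hu hG (χ := fun x => ψ (x - y)) (C := 1 + C)
      (hψ.comp (contDiff_id.sub contDiff_const)) (fun x => by
        rw [Real.norm_of_nonneg (cutoff_nonneg _ _)]
        have := cutoff_le_one (N := N) 1 (x - y)
        linarith) (fun x => by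
        rw [hd]
        have := hC 1 one_pos (x - y)
        rw [div_one] at this
        linarith)
    refine (lintegral_interpolation hN w2.1).trans ?_
    have m1 : ∫⁻ x, ‖ψ (x - y) * u x‖ₑ ^ 2 ≤ δ := by
      refine le_trans ?_ (hδ y)
      rw [← lintegral_indicator Metric.isOpen_ball.measurableSet]
      refine lintegral_mono fun x => ?_
      by_cases hx : x ∈ Metric.ball y 2
      · rw [indicator_of_mem hx, enorm_mul]
        refine pow_le_pow_left' (mul_le_of_le_one_left' ?_) 2
        rw [← ofReal_norm, Real.norm_of_nonneg (cutoff_nonneg _ _)]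
        exact ENNReal.ofReal_le_one.2 (cutoff_le_one _ _)
      · have : ψ (x - y) = 0 := cutoff_eq_zero one_pos (by
          rw [Metric.mem_ball, not_lt, dist_eq_norm] at hx; linarith)
        simp [this]
    refine mul_le_mul' (ENNReal.rpow_le_rpow m1 (by positivity)) ?_
    refine (pow_le_pow_left' (hS _ _ w1 w2 w3) 2).trans ?_
    rw [mul_pow, eLpNorm_two_sq]
    refine mul_le_mul_right ?_ _
    rw [← lintegral_const_mul' 2 _ (by norm_num)]
    refine lintegral_mono fun x => ?_
    refine (enorm_add_sq_le _ _).trans_eq ?_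
    rw [enorm_smul, enorm_smul, mul_pow, mul_pow, hgr, mul_comm (‖u x‖ₑ ^ 2)]
  have hm : ∀ {F : Type} [NormedAddCommGroup F] {g : E N → F}, Continuous g →
      AEMeasurable (fun z : E N × E N => ‖g (z.2 - z.1)‖ₑ) (volume.prod volume) :=
    fun hg => (hg.comp (continuous_snd.sub continuous_fst)).enorm.measurable.aemeasurable
  have hum : AEMeasurable (fun z : E N × E N => ‖u z.2‖ₑ) (volume.prod volume) :=
    hu.1.comp_snd.enorm
  have hGm : AEMeasurable (fun z : E N × E N => ‖G z.2‖ₑ) (volume.prod volume) :=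
    hG.1.comp_snd.enorm
  have hqpos : (0 : ℝ) ≤ 2 + 4 / (N : ℝ) := by positivity
  -- Integration over all centres `y` replaces a covering by balls. The cutoff is 1 on the unit
  -- ball, so every `x` is counted with weight at least the volume of that ball.
  have hleft : ρ * ∫⁻ x, ‖u x‖ₑ ^ (2 + 4 / (N : ℝ))
      ≤ ∫⁻ y, ∫⁻ x, ‖ψ (x - y) * u x‖ₑ ^ (2 + 4 / (N : ℝ)) := by
    rw [lintegral_lintegral_swap]
    · rw [← lintegral_const_mul' _ _ hρt]
      refine lintegral_mono fun x => ?_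
      have e : ∀ y, ‖ψ (x - y) * u x‖ₑ ^ (2 + 4 / (N : ℝ))
          = ‖ψ (x - y)‖ₑ ^ (2 + 4 / (N : ℝ)) * ‖u x‖ₑ ^ (2 + 4 / (N : ℝ)) := fun y => by
        rw [enorm_mul, ENNReal.mul_rpow_of_nonneg _ _ hqpos]
      simp only [e]
      rw [lintegral_mul_const' _ _ (ENNReal.rpow_ne_top_of_nonneg hqpos enorm_ne_top),
        lintegral_sub_swap (fun y => ‖ψ y‖ₑ ^ (2 + 4 / (N : ℝ)))]
      gcongr
      have : ρ = ∫⁻ x in Metric.ball (0 : E N) 1, 1 := by simp [ρ]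
      rw [this, ← lintegral_indicator Metric.isOpen_ball.measurableSet]
      refine lintegral_mono fun x => ?_
      by_cases hx : x ∈ Metric.ball (0 : E N) 1
      · have h1 : ψ x = 1 := cutoff_eq_one one_pos (mem_ball_zero_iff.1 hx).le
        rw [indicator_of_mem hx, h1]; simp
      · rw [indicator_of_notMem hx]; exact bot_le
    · simp only [Function.uncurry_def, enorm_mul]
      exact ((hm hψ.continuous).mul hum).pow_const _
  have hright : ∫⁻ y, ∫⁻ x, (‖ψ (x - y)‖ₑ ^ 2 * ‖G x‖ₑ ^ 2
          + ‖gradient ψ (x - y)‖ₑ ^ 2 * ‖u x‖ₑ ^ 2)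
      = K1 * (∫⁻ x, ‖G x‖ₑ ^ 2) + K2 * ∫⁻ x, ‖u x‖ₑ ^ 2 := by
    rw [lintegral_lintegral_swap]
    · have e : ∀ x, ∫⁻ y, (‖ψ (x - y)‖ₑ ^ 2 * ‖G x‖ₑ ^ 2
          + ‖gradient ψ (x - y)‖ₑ ^ 2 * ‖u x‖ₑ ^ 2) = K1 * ‖G x‖ₑ ^ 2 + K2 * ‖u x‖ₑ ^ 2 := by
        intro x
        rw [lintegral_add_left', lintegral_mul_const' _ _ (by simp),
          lintegral_mul_const' _ _ (by simp), lintegral_sub_swap (fun y => ‖ψ y‖ₑ ^ 2),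
          lintegral_sub_swap (fun y => ‖gradient ψ y‖ₑ ^ 2)]
        exact (((hψ.continuous.comp (continuous_const.sub
          continuous_id)).enorm.measurable.pow_const 2).mul_const _).aemeasurable
      simp only [e]
      rw [lintegral_add_left' ((hG.1.enorm.pow_const 2).const_mul _), lintegral_const_mul' _ _ hK1,
        lintegral_const_mul' _ _ hK2]
    · exact (((hm hψ.continuous).pow_const 2).mul (hGm.pow_const 2)).add
        (((hm hgc).pow_const 2).mul (hum.pow_const 2))
  have hδt : (δ : ℝ≥0∞) ^ (2 / (N : ℝ)) ≠ ⊤ :=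
    ENNReal.rpow_ne_top_of_nonneg (by positivity) ENNReal.coe_ne_top
  rw [mul_assoc, mul_assoc, ← ENNReal.mul_le_iff_le_inv hρ0 hρt]
  refine (hleft.trans (lintegral_mono hloc)).trans ?_
  rw [lintegral_const_mul' _ _ hδt, lintegral_const_mul' _ _ (by simp),
    lintegral_const_mul' _ _ (by norm_num), hright]
  set A := ∫⁻ x, ‖G x‖ₑ ^ 2
  set B := ∫⁻ x, ‖u x‖ₑ ^ 2
  calc (δ : ℝ≥0∞) ^ (2 / (N : ℝ)) * (S ^ 2 * (2 * (K1 * A + K2 * B)))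
      ≤ (δ : ℝ≥0∞) ^ (2 / (N : ℝ)) * (S ^ 2 * (2 * ((K1 + K2) * (A + B)))) := by
        gcongr
        calc K1 * A + K2 * B ≤ (K1 + K2) * A + (K1 + K2) * B := by
              gcongr
              · exact le_self_add
              · exact le_add_self
          _ = _ := by ring
    _ = _ := by ring

/-! ### The space `X` and the critical exponent -/

/-- `u` is an element of `X` and `G` is its weak gradient. -/
structure IsX (u : E N → ℝ) (G : E N → E N) : Prop where
  grad : HasWeakGradient u G
  memLp : MemLp u 2 volume
  memLp_grad : MemLp G 2 volume
  memLp_smul : MemLp (fun x => u x • G x) 2 volume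
  memLp_sq : MemLp (fun x => u x ^ 2) 2 volume

/-- By the chain rule and uniqueness of weak gradients the gradient of u² is 2u∇u, so u² ∈ H¹ is
what puts u∇u in `L²`. -/
theorem exists_isX_of_mem {u : E N → ℝ} (hu : u ∈ X N) : ∃ G, IsX u G := by
  obtain ⟨⟨hu2, G, hG, hG2⟩, hsq, H, hH, hH2⟩ := hu
  refine ⟨G, hG, hu2, hG2, ?_, hsq⟩
  have h := (hG.sq hu2 hG2).ae_eq hH
  have h2 := (hH2.ae_eq h.symm).const_smul (1 / 2 : ℝ)
  refine h2.ae_eq (Eventually.of_forall fun x => ?_)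
  simp [smul_smul]

theorem IsX.mem {u : E N → ℝ} {G : E N → E N} (h : IsX u G) : u ∈ X N := by
  refine ⟨⟨h.memLp, G, h.grad, h.memLp_grad⟩, h.memLp_sq, _, h.grad.sq h.memLp h.memLp_grad, ?_⟩
  refine (h.memLp_smul.const_smul (2 : ℝ)).ae_eq (Eventually.of_forall fun x => ?_)
  simp [smul_smul]

theorem HasWeakGradient.weakGrad_ae_eq {u : E N → ℝ} {G : E N → E N} (h : HasWeakGradient u G) :
    weakGrad u =ᵐ[volume] G := by
  have he : ∃ G, HasWeakGradient u G := ⟨G, h⟩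
  rw [weakGrad, dif_pos he]
  exact he.choose_spec.ae_eq h

theorem IsX.translate {u : E N → ℝ} {G : E N → E N} (h : IsX u G) (z : E N) :
    IsX (fun x => u (x + z)) (fun x => G (x + z)) := by
  have mp := measurePreserving_add_right (volume : Measure (E N)) z
  exact ⟨h.grad.translate z, h.memLp.comp_measurePreserving mp,
    h.memLp_grad.comp_measurePreserving mp, h.memLp_smul.comp_measurePreserving mp,
    h.memLp_sq.comp_measurePreserving mp⟩

theorem memLp_comp_smul {F : Type*} [NormedAddCommGroup F] {f : E N → F}
    (hf : MemLp f 2 volume) {t : ℝ} (ht : t ≠ 0) : MemLp (fun x => f (t • x)) 2 volume := by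
  have h1 : MemLp f 2 (Measure.map (t • ·) (volume : Measure (E N))) := by
    rw [Measure.map_addHaar_smul volume ht]
    exact hf.smul_measure ENNReal.ofReal_ne_top
  exact h1.comp_of_map (measurable_const_smul t).aemeasurable

theorem IsX.dilate {u : E N → ℝ} {G : E N → E N} (h : IsX u G) {t : ℝ} (ht : 0 < t) :
    IsX (dilate t u) (fun x => G (t⁻¹ • x)) := by
  have ht' := inv_ne_zero ht.ne'
  refine ⟨h.grad.dilate ht, (memLp_comp_smul h.memLp ht').const_mul t,
    memLp_comp_smul h.memLp_grad ht', ?_, ?_⟩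
  · refine ((memLp_comp_smul h.memLp_smul ht').const_smul t).ae_eq
      (Eventually.of_forall fun x => ?_)
    simp [ModNLS.dilate, smul_smul]
  · refine ((memLp_comp_smul h.memLp_sq ht').const_mul (t ^ 2)).ae_eq
      (Eventually.of_forall fun x => ?_)
    simp [ModNLS.dilate, mul_pow]

/-- The critical exponent `4N / (N - 2)`. -/
noncomputable def critExp (N : ℕ) : ℝ := 4 * N / (N - 2)

theorem critExp_eq (hN : 3 ≤ N) : critExp N = 2 * sobolevExp N := by
  rw [coe_sobolevExp hN, critExp]; ring

theorem four_lt_critExp (hN : 3 ≤ N) : 4 < critExp N := by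
  rw [critExp_eq hN]; linarith [two_lt_sobolevExp hN]

namespace IsX

variable {u : E N → ℝ} {G : E N → E N}

theorem integrable_sq (h : IsX u G) : Integrable (fun x => u x ^ 2) volume := h.memLp.integrable_sq

theorem integrable_grad (h : IsX u G) : Integrable (fun x => ‖G x‖ ^ 2) volume :=
  h.memLp_grad.integrable_norm_pow two_ne_zero

theorem integrable_mul (h : IsX u G) :
    Integrable (fun x => u x ^ 2 * ‖G x‖ ^ 2) volume := by
  refine (h.memLp_smul.integrable_norm_pow two_ne_zero).congr (Eventually.of_forall fun x => ?_)
  simp [norm_smul, mul_pow]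

theorem integrable_four (h : IsX u G) : Integrable (fun x => u x ^ 4) volume := by
  refine h.memLp_sq.integrable_sq.congr (Eventually.of_forall fun x => ?_)
  simp only []; ring

end IsX

/-- The Sobolev inequality for u². In the constant, the factor 4 comes from |2u∇u|² = 4u²|∇u|², and
N / (N - 2) is half the Sobolev exponent. -/
theorem exists_integral_crit_le (hN : 3 ≤ N) : ∃ S : ℝ, 0 ≤ S ∧ ∀ (u : E N → ℝ) (G : E N → E N),
    IsX u G → Integrable (fun x => |u x| ^ critExp N) volume ∧
      ∫ x, |u x| ^ critExp N ≤ S * (∫ x, u x ^ 2 * ‖G x‖ ^ 2) ^ ((N : ℝ) / (N - 2)) := by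
  obtain ⟨C, hC⟩ := exists_sobolev hN
  have hN' : (3 : ℝ) ≤ N := by exact_mod_cast hN
  set q : ℝ≥0 := sobolevExp N
  have hq : 0 < (q : ℝ) := sobolevExp_pos hN
  have hq2 : (q : ℝ) / 2 = (N : ℝ) / (N - 2) := by
    rw [coe_sobolevExp hN]; field_simp
  refine ⟨(C : ℝ) ^ (q : ℝ) * 4 ^ ((q : ℝ) / 2), by positivity, fun u G h => ?_⟩
  have hi : MemLp (fun x => (2 * u x) • G x) 2 volume := by
    refine (h.memLp_smul.const_smul (2 : ℝ)).ae_eq (Eventually.of_forall fun x => ?_)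
    simp [smul_smul]
  set B := ∫ x, u x ^ 2 * ‖G x‖ ^ 2
  have hB : 0 ≤ B := integral_nonneg fun x => by positivity
  have h1 := hC _ _ (h.grad.sq h.memLp h.memLp_grad) h.memLp_sq hi
  have h2 : eLpNorm (fun x => (2 * u x) • G x) 2 volume ^ 2 = ENNReal.ofReal (4 * B) := by
    rw [eLpNorm_two_sq, ← integral_const_mul, ofReal_integral_eq_lintegral_ofReal
      (h.integrable_mul.const_mul 4) (Eventually.of_forall fun x => by positivity)]
    refine lintegral_congr fun x => ?_
    rw [← ofReal_norm, ← ENNReal.ofReal_pow (norm_nonneg _), norm_smul, norm_mul]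
    congr 1
    rw [mul_pow, mul_pow, Real.norm_eq_abs (u x), sq_abs]; norm_num; ring
  have h3 : ∫⁻ x, ENNReal.ofReal (|u x| ^ critExp N)
      ≤ ENNReal.ofReal ((C : ℝ) ^ (q : ℝ) * 4 ^ ((q : ℝ) / 2) * B ^ ((q : ℝ) / 2)) := by
    calc ∫⁻ x, ENNReal.ofReal (|u x| ^ critExp N)
        = eLpNorm (fun x => u x ^ 2) q volume ^ (q : ℝ) := by
          rw [eLpNorm_nnreal_pow_eq_lintegral (by intro h0; rw [h0] at hq; simp at hq)]
          refine lintegral_congr fun x => ?_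
          rw [← ofReal_norm, ENNReal.ofReal_rpow_of_nonneg (norm_nonneg _) hq.le]
          congr 1
          rw [norm_pow, Real.norm_eq_abs, critExp_eq hN, Real.rpow_mul (abs_nonneg _)]
          norm_num [q]
      _ ≤ (C * eLpNorm (fun x => (2 * u x) • G x) 2 volume) ^ (q : ℝ) :=
          ENNReal.rpow_le_rpow h1 hq.le
      _ = _ := by
          rw [ENNReal.mul_rpow_of_nonneg _ _ hq.le]
          have : eLpNorm (fun x => (2 * u x) • G x) 2 volume ^ (q : ℝ)
              = ENNReal.ofReal (4 * B) ^ ((q : ℝ) / 2) := by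
            rw [← h2, ← ENNReal.rpow_natCast, ← ENNReal.rpow_mul]
            congr 1; push_cast; ring
          rw [this, ENNReal.ofReal_rpow_of_nonneg (by positivity) (by positivity),
            Real.mul_rpow (by norm_num) hB, mul_assoc,
            ENNReal.ofReal_mul (p := (C : ℝ) ^ (q : ℝ)) (by positivity),
            ← ENNReal.ofReal_rpow_of_nonneg (NNReal.coe_nonneg C) hq.le, ENNReal.ofReal_coe_nnreal]
  have hm : AEStronglyMeasurable (fun x => |u x| ^ critExp N) volume :=
    (h.memLp.1.norm.aemeasurable.pow_const _).aestronglyMeasurable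
  have hnn : 0 ≤ᵐ[volume] fun x => |u x| ^ critExp N :=
    Eventually.of_forall fun x => by positivity
  rw [← hq2]
  constructor
  · exact ⟨hm, (hasFiniteIntegral_iff_ofReal hnn).2 (h3.trans_lt ENNReal.ofReal_lt_top)⟩
  · rw [integral_eq_lintegral_of_nonneg_ae hnn hm]
    exact ENNReal.toReal_le_of_le_ofReal (by positivity) h3

theorem IsX.integrable_crit (hN : 3 ≤ N) {u : E N → ℝ} {G : E N → E N} (h : IsX u G) :
    Integrable (fun x => |u x| ^ critExp N) volume :=
  let ⟨_, _, hS⟩ := exists_integral_crit_le hN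
  (hS u G h).1

theorem rpow_le_sq_add_rpow {s a r : ℝ} (hs : 0 ≤ s) (ha : 2 ≤ a) (har : a ≤ r) :
    s ^ a ≤ s ^ 2 + s ^ r := by
  rcases le_total s 1 with h1 | h1
  · rcases hs.eq_or_lt with rfl | h0
    · rw [Real.zero_rpow (by linarith)]; positivity
    · have := Real.rpow_le_rpow_of_exponent_ge h0 h1 ha
      have h2 : 0 ≤ s ^ r := by positivity
      rw [Real.rpow_two] at this; linarith
  · have := Real.rpow_le_rpow_of_exponent_le h1 har
    have h2 : 0 ≤ s ^ 2 := by positivity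
    linarith

/-- Interpolation of a power between `2` and `r`, with small constants. -/
theorem exists_rpow_interpolation {a r q η : ℝ} (ha : 2 < a) (har : a < r) (hη : 0 < η) :
    ∃ C, 0 ≤ C ∧ ∀ s, 0 ≤ s → s ^ a ≤ η * (s ^ 2 + s ^ r) + C * s ^ q := by
  -- Below `τ` the factor s ^ (a - 2) is at most `η`, above `T` the factor s ^ (a - r) is. In
  -- between, s ^ (a - q) is bounded by its value at one of the endpoints, whichever sign a - q has.
  set τ := η ^ (1 / (a - 2))
  set T := η ^ (-1 / (r - a))
  have hτ : 0 < τ := by positivity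
  have hT : 0 < T := by positivity
  refine ⟨τ ^ (a - q) + T ^ (a - q), by positivity, fun s hs => ?_⟩
  have hτa : τ ^ (a - 2) = η := by
    rw [← Real.rpow_mul hη.le, one_div_mul_cancel (by linarith), Real.rpow_one]
  have hTa : T ^ (-(r - a)) = η := by
    rw [← Real.rpow_mul hη.le, show -1 / (r - a) * -(r - a) = 1 by
      have : r - a ≠ 0 := by linarith
      field_simp, Real.rpow_one]
  rcases hs.eq_or_lt with rfl | h0
  · rw [Real.zero_rpow (by linarith)]; positivity
  have e1 : s ^ a = s ^ 2 * s ^ (a - 2) := by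
    rw [← Real.rpow_two, ← Real.rpow_add h0]; congr 1; ring
  have e2 : s ^ a = s ^ r * s ^ (-(r - a)) := by
    rw [← Real.rpow_add h0]; congr 1; ring
  have e3 : s ^ a = s ^ q * s ^ (a - q) := by
    rw [← Real.rpow_add h0]; congr 1; ring
  have p1 : 0 ≤ s ^ 2 := by positivity
  have p2 : 0 ≤ s ^ r := by positivity
  have p3 : 0 ≤ (τ ^ (a - q) + T ^ (a - q)) * s ^ q := by positivity
  rcases le_total s τ with h1 | h1
  · have : s ^ (a - 2) ≤ η := hτa ▸ Real.rpow_le_rpow hs h1 (by linarith)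
    have := mul_le_mul_of_nonneg_left this p1
    nlinarith [mul_nonneg hη.le p2]
  rcases le_total T s with h2 | h2
  · have : s ^ (-(r - a)) ≤ η :=
      hTa ▸ Real.rpow_le_rpow_of_nonpos hT h2 (by linarith)
    have := mul_le_mul_of_nonneg_left this p2
    nlinarith [mul_nonneg hη.le p1]
  · have : s ^ (a - q) ≤ τ ^ (a - q) + T ^ (a - q) := by
      have q1 : 0 ≤ τ ^ (a - q) := by positivity
      have q2 : 0 ≤ T ^ (a - q) := by positivity
      rcases le_total 0 (a - q) with h3 | h3
      · linarith [Real.rpow_le_rpow hs h2 h3]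
      · linarith [Real.rpow_le_rpow_of_nonpos hτ h1 h3]
    have h4 := mul_le_mul_of_nonneg_left this (show 0 ≤ s ^ q by positivity)
    have : 0 ≤ η * (s ^ 2 + s ^ r) := by positivity
    rw [e3]; linarith

theorem IsX.integrable_rpow (hN : 3 ≤ N) {u : E N → ℝ} {G : E N → E N} (h : IsX u G) {a : ℝ}
    (ha : 2 ≤ a) (har : a ≤ critExp N) : Integrable (fun x => |u x| ^ a) volume := by
  refine (h.integrable_sq.add (h.integrable_crit hN)).mono'
    (h.memLp.1.norm.aemeasurable.pow_const _).aestronglyMeasurable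
    (Eventually.of_forall fun x => ?_)
  rw [Real.norm_of_nonneg (by positivity)]
  have := rpow_le_sq_add_rpow (abs_nonneg (u x)) ha har
  rwa [sq_abs] at this

/-! ### Energy density and local mass -/

/-- The density controlling all terms of the functionals. -/
noncomputable def energyDensity (u : E N → ℝ) (G : E N → E N) (x : E N) : ℝ :=
  ‖G x‖ ^ 2 + u x ^ 2 + u x ^ 2 * ‖G x‖ ^ 2 + u x ^ 4 + |u x| ^ critExp N

theorem energyDensity_nonneg (u : E N → ℝ) (G : E N → E N) (x : E N) :
    0 ≤ energyDensity u G x := by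
  unfold energyDensity; positivity

theorem IsX.integrable_energyDensity (hN : 3 ≤ N) {u : E N → ℝ} {G : E N → E N} (h : IsX u G) :
    Integrable (energyDensity u G) volume :=
  (((h.integrable_grad.add h.integrable_sq).add h.integrable_mul).add h.integrable_four).add
    (h.integrable_crit hN)

/-- Three integrals suffice: the critical power is controlled by ∫ u²|∇u|² through Sobolev, and u⁴
lies between u² and the critical power. The summand 1 only makes the bound strictly positive. -/
theorem exists_energy_le (hN : 3 ≤ N) {E₁ : ℝ} (hE : 0 ≤ E₁) : ∃ E₀ : ℝ, 0 < E₀ ∧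
    ∀ (u : E N → ℝ) (G : E N → E N), IsX u G → ∫ x, ‖G x‖ ^ 2 ≤ E₁ → ∫ x, u x ^ 2 ≤ E₁ →
      ∫ x, u x ^ 2 * ‖G x‖ ^ 2 ≤ E₁ → ∫ x, energyDensity u G x ≤ E₀ := by
  obtain ⟨S, hS, h⟩ := exists_integral_crit_le hN
  have hN' : (3 : ℝ) ≤ N := by exact_mod_cast hN
  have hr := four_lt_critExp hN
  refine ⟨4 * E₁ + 2 * (S * E₁ ^ ((N : ℝ) / (N - 2))) + 1, by positivity,
    fun u G hu h1 h2 h3 => ?_⟩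
  obtain ⟨hi, hle⟩ := h u G hu
  have hle2 : ∫ x, |u x| ^ critExp N ≤ S * E₁ ^ ((N : ℝ) / (N - 2)) := by
    refine hle.trans (mul_le_mul_of_nonneg_left (Real.rpow_le_rpow ?_ h3 ?_) hS)
    · exact integral_nonneg fun x => by positivity
    · apply div_nonneg <;> linarith
  have h4 : ∫ x, u x ^ 4 ≤ (∫ x, u x ^ 2) + ∫ x, |u x| ^ critExp N := by
    rw [← integral_add hu.integrable_sq hi]
    refine integral_mono hu.integrable_four (hu.integrable_sq.add hi) fun x => ?_
    have := rpow_le_sq_add_rpow (abs_nonneg (u x)) (a := 4) (by norm_num) hr.le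
    rw [sq_abs, show (4 : ℝ) = ((4 : ℕ) : ℝ) by norm_num, Real.rpow_natCast,
      Even.pow_abs ⟨2, rfl⟩] at this
    exact this
  have e : ∫ x, energyDensity u G x = (∫ x, ‖G x‖ ^ 2) + (∫ x, u x ^ 2)
      + (∫ x, u x ^ 2 * ‖G x‖ ^ 2) + (∫ x, u x ^ 4) + ∫ x, |u x| ^ critExp N := by
    have i1 : Integrable (fun x => ‖G x‖ ^ 2 + u x ^ 2) volume :=
      hu.integrable_grad.add hu.integrable_sq
    have i2 : Integrable (fun x => ‖G x‖ ^ 2 + u x ^ 2 + u x ^ 2 * ‖G x‖ ^ 2) volume :=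
      i1.add hu.integrable_mul
    have i3 : Integrable (fun x => ‖G x‖ ^ 2 + u x ^ 2 + u x ^ 2 * ‖G x‖ ^ 2 + u x ^ 4) volume :=
      i2.add hu.integrable_four
    unfold energyDensity
    rw [integral_add i3 hi, integral_add i2 hu.integrable_four, integral_add i1 hu.integrable_mul,
      integral_add hu.integrable_grad hu.integrable_sq]
  rw [e]; linarith

/-- Bounded sequences whose `L^a` norm does not vanish carry some mass in a ball of fixed size. -/
theorem exists_local_mass (hN : 3 ≤ N) {a : ℝ} (ha : 2 < a) (har : a < critExp N) {d E₀ : ℝ}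
    (hd : 0 < d) (hE : 0 < E₀) : ∃ δ : ℝ, 0 < δ ∧ ∀ (u : E N → ℝ) (G : E N → E N), IsX u G →
      ∫ x, energyDensity u G x ≤ E₀ → d ≤ ∫ x, |u x| ^ a →
      ∃ y, δ ≤ ∫ x in Metric.ball y 2, u x ^ 2 := by
  obtain ⟨K, hKt, hK⟩ := exists_lintegral_le_of_local_mass hN
  have hN' : (3 : ℝ) ≤ N := by exact_mod_cast hN
  -- With this `η` the first part of the interpolation contributes at most `d / 2`.
  obtain ⟨C, hC0, hC⟩ := exists_rpow_interpolation (q := 2 + 4 / (N : ℝ)) ha har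
    (η := d / (2 * E₀)) (by positivity)
  set κ := K.toReal
  have hκ : 0 ≤ κ := ENNReal.toReal_nonneg
  -- Makes the contribution of the exponent 2 + 4 / N at most `d / 4`. The mass threshold is ε ^ (N
  -- / 2) because the vanishing lemma returns it to the power 2 / N.
  set ε := d / (4 * ((C + 1) * (κ + 1) * E₀))
  have hε : 0 < ε := by positivity
  refine ⟨ε ^ ((N : ℝ) / 2), by positivity, fun u G hu hEu hdu => ?_⟩
  by_contra! hlt
  have hsq : ∀ s : Set (E N), ∫⁻ x in s, ‖u x‖ₑ ^ 2 = ENNReal.ofReal (∫ x in s, u x ^ 2) := by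
    intro s
    rw [ofReal_integral_eq_lintegral_ofReal hu.integrable_sq.integrableOn
      (Eventually.of_forall fun x => by positivity)]
    refine lintegral_congr fun x => ?_
    rw [← ofReal_norm, ← ENNReal.ofReal_pow (norm_nonneg _), Real.norm_eq_abs, sq_abs]
  have hsqG : ∫⁻ x, ‖G x‖ₑ ^ 2 = ENNReal.ofReal (∫ x, ‖G x‖ ^ 2) := by
    rw [ofReal_integral_eq_lintegral_ofReal hu.integrable_grad
      (Eventually.of_forall fun x => by positivity)]
    refine lintegral_congr fun x => ?_
    rw [← ofReal_norm, ← ENNReal.ofReal_pow (norm_nonneg _)]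
  have h1 := hK u G (ε ^ ((N : ℝ) / 2)).toNNReal hu.grad hu.memLp hu.memLp_grad (fun y => by
    rw [hsq]; exact ENNReal.ofReal_le_ofReal (hlt y).le)
  have hcoe : (((ε ^ ((N : ℝ) / 2)).toNNReal : ℝ≥0∞)) ^ (2 / (N : ℝ)) = ENNReal.ofReal ε := by
    change ENNReal.ofReal _ ^ (2 / (N : ℝ)) = _
    rw [ENNReal.ofReal_rpow_of_nonneg (by positivity) (by positivity), ← Real.rpow_mul hε.le]
    congr 1
    rw [show (N : ℝ) / 2 * (2 / N) = 1 by field_simp, Real.rpow_one]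
  have hdens : (∫ x, ‖G x‖ ^ 2) + ∫ x, u x ^ 2 ≤ E₀ := by
    refine le_trans ?_ hEu
    rw [← integral_add hu.integrable_grad hu.integrable_sq]
    refine integral_mono (hu.integrable_grad.add hu.integrable_sq)
      (hu.integrable_energyDensity hN) fun x => ?_
    have h1 : 0 ≤ u x ^ 2 * ‖G x‖ ^ 2 := by positivity
    have h2 : 0 ≤ u x ^ 4 := by positivity
    have h3 : 0 ≤ |u x| ^ critExp N := by positivity
    simp only [energyDensity]; linarith
  have hdens2 : ∫ x, (u x ^ 2 + |u x| ^ critExp N) ≤ E₀ := by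
    refine le_trans ?_ hEu
    refine integral_mono (hu.integrable_sq.add (hu.integrable_crit hN))
      (hu.integrable_energyDensity hN) fun x => ?_
    have h1 : 0 ≤ u x ^ 2 * ‖G x‖ ^ 2 := by positivity
    have h2 : 0 ≤ u x ^ 4 := by positivity
    have h3 : 0 ≤ ‖G x‖ ^ 2 := by positivity
    simp only [energyDensity]; linarith
  have hu1 : ∫⁻ x, ‖u x‖ₑ ^ 2 = ENNReal.ofReal (∫ x, u x ^ 2) := by
    simpa using hsq univ
  have h2 : ∫⁻ x, ENNReal.ofReal (|u x| ^ (2 + 4 / (N : ℝ))) ≤ ENNReal.ofReal (κ * ε * E₀) := by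
    have hA : 0 ≤ ∫ x, ‖G x‖ ^ 2 := integral_nonneg fun x => by positivity
    have hB : 0 ≤ ∫ x, u x ^ 2 := integral_nonneg fun x => by positivity
    rw [hcoe, hsqG, hu1, ← ENNReal.ofReal_add hA hB, ← ENNReal.ofReal_toReal hKt,
      ← ENNReal.ofReal_mul hκ, ← ENNReal.ofReal_mul (by positivity)] at h1
    refine le_trans (lintegral_mono fun x => ?_) (h1.trans (ENNReal.ofReal_le_ofReal ?_))
    · rw [← ofReal_norm, ENNReal.ofReal_rpow_of_nonneg (norm_nonneg _) (by positivity)]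
      exact le_rfl
    · exact mul_le_mul_of_nonneg_left hdens (by positivity)
  have hm : AEStronglyMeasurable (fun x => |u x| ^ (2 + 4 / (N : ℝ))) volume :=
    (hu.memLp.1.norm.aemeasurable.pow_const _).aestronglyMeasurable
  have hnn : 0 ≤ᵐ[volume] fun x => |u x| ^ (2 + 4 / (N : ℝ)) :=
    Eventually.of_forall fun x => by positivity
  have hi : Integrable (fun x => |u x| ^ (2 + 4 / (N : ℝ))) volume :=
    ⟨hm, (hasFiniteIntegral_iff_ofReal hnn).2 (h2.trans_lt ENNReal.ofReal_lt_top)⟩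
  have h3 : ∫ x, |u x| ^ (2 + 4 / (N : ℝ)) ≤ κ * ε * E₀ := by
    rw [integral_eq_lintegral_of_nonneg_ae hnn hm]
    exact ENNReal.toReal_le_of_le_ofReal (by positivity) h2
  have h4 : ∫ x, |u x| ^ a ≤ d / (2 * E₀) * E₀ + C * (κ * ε * E₀) := by
    calc ∫ x, |u x| ^ a ≤ ∫ x, (d / (2 * E₀) * (u x ^ 2 + |u x| ^ critExp N)
          + C * |u x| ^ (2 + 4 / (N : ℝ))) := by
          refine integral_mono (hu.integrable_rpow hN ha.le har.le)
            (((hu.integrable_sq.add (hu.integrable_crit hN)).const_mul _).add (hi.const_mul _))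
            fun x => ?_
          have := hC |u x| (abs_nonneg _)
          rwa [sq_abs] at this
      _ = d / (2 * E₀) * (∫ x, (u x ^ 2 + |u x| ^ critExp N))
          + C * ∫ x, |u x| ^ (2 + 4 / (N : ℝ)) := by
          have i1 : Integrable (fun x => d / (2 * E₀) * (u x ^ 2 + |u x| ^ critExp N)) volume :=
            (hu.integrable_sq.add (hu.integrable_crit hN)).const_mul _
          rw [integral_add i1 (hi.const_mul _), integral_const_mul, integral_const_mul]
      _ ≤ _ := add_le_add (mul_le_mul_of_nonneg_left hdens2 (by positivity))
          (mul_le_mul_of_nonneg_left h3 hC0)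
  have h5 : d / (2 * E₀) * E₀ = d / 2 := by field_simp
  have h6 : (C + 1) * (κ + 1) * ε * E₀ = d / 4 := by
    simp only [ε]; field_simp
  have h7 : C * (κ * ε * E₀) ≤ (C + 1) * (κ + 1) * ε * E₀ := by
    have : 0 ≤ ε * E₀ := by positivity
    nlinarith [mul_nonneg hC0 this, mul_nonneg hκ this]
  linarith

/-! ### Lower semicontinuity on balls -/

/-- One-sided continuity estimate for powers between `2` and `r`. -/
theorem exists_rpow_le_rpow_add {a r η : ℝ} (ha : 2 < a) (har : a < r) (hη : 0 < η) :
    ∃ C, 0 ≤ C ∧ ∀ s t : ℝ, 0 ≤ s → 0 ≤ t →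
      s ^ a ≤ t ^ a + η * (s ^ 2 + s ^ r) + C * (s - t) ^ 2 := by
  set T := η ^ (-1 / (r - a))
  have hT : 0 < T := by positivity
  have hTa : T ^ (-(r - a)) = η := by
    rw [← Real.rpow_mul hη.le, show -1 / (r - a) * -(r - a) = 1 by
      have : r - a ≠ 0 := by linarith
      field_simp, Real.rpow_one]
  -- Above `T` the power is at most η s ^ r. Below `T` the constant comes from Young's inequality s
  -- y ≤ η s² + y² / (4η) with y = a s ^ (a - 2) (s - t) and s ≤ T.
  refine ⟨(a * T ^ (a - 2)) ^ 2 / (4 * η), by positivity, fun s t hs ht => ?_⟩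
  have p1 : 0 ≤ s ^ 2 := by positivity
  have p2 : 0 ≤ s ^ r := by positivity
  have p3 : 0 ≤ t ^ a := by positivity
  have p4 : 0 ≤ (a * T ^ (a - 2)) ^ 2 / (4 * η) * (s - t) ^ 2 := by positivity
  rcases hs.eq_or_lt with rfl | h0
  · rw [Real.zero_rpow (by linarith)]; positivity
  rcases le_total T s with h2 | h2
  · have e2 : s ^ a = s ^ r * s ^ (-(r - a)) := by
      rw [← Real.rpow_add h0]; congr 1; ring
    have : s ^ (-(r - a)) ≤ η := hTa ▸ Real.rpow_le_rpow_of_nonpos hT h2 (by linarith)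
    have := mul_le_mul_of_nonneg_left this p2
    nlinarith [mul_nonneg hη.le p1]
  rcases le_total s t with h3 | h3
  · have := Real.rpow_le_rpow hs h3 (show 0 ≤ a by linarith)
    have : 0 ≤ η * (s ^ 2 + s ^ r) := by positivity
    linarith
  -- Bernoulli's inequality at t / s is the tangent inequality t ^ a ≥ s ^ a - a s ^ (a - 1) (s -
  -- t).
  have hb := one_add_mul_self_le_rpow_one_add (s := t / s - 1) (p := a)
    (by linarith [div_nonneg ht hs]) (by linarith)
  rw [add_sub_cancel, Real.div_rpow ht hs, le_div_iff₀ (by positivity)] at hb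
  have e1 : s ^ a = s ^ 2 * s ^ (a - 2) := by
    rw [← Real.rpow_two, ← Real.rpow_add h0]; congr 1; ring
  have e4 : (1 + a * (t / s - 1)) * s ^ a = s ^ a - s * (a * s ^ (a - 2) * (s - t)) := by
    rw [e1]; field_simp; ring
  rw [e4] at hb
  have h5 : s ^ (a - 2) ≤ T ^ (a - 2) := Real.rpow_le_rpow hs h2 (by linarith)
  have h6 : (a * s ^ (a - 2) * (s - t)) ^ 2 ≤ (a * T ^ (a - 2)) ^ 2 * (s - t) ^ 2 := by
    rw [mul_pow]
    gcongr
  have h7 : s * (a * s ^ (a - 2) * (s - t)) ≤ η * s ^ 2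
      + (a * s ^ (a - 2) * (s - t)) ^ 2 / (4 * η) := by
    set y := a * s ^ (a - 2) * (s - t)
    have : 0 ≤ (2 * η * s - y) ^ 2 / (4 * η) := by positivity
    have e : (2 * η * s - y) ^ 2 / (4 * η) = η * s ^ 2 - s * y + y ^ 2 / (4 * η) := by
      field_simp; ring
    linarith
  have h8 : (a * s ^ (a - 2) * (s - t)) ^ 2 / (4 * η)
      ≤ (a * T ^ (a - 2)) ^ 2 / (4 * η) * (s - t) ^ 2 := by
    rw [div_mul_eq_mul_div]; gcongr
  nlinarith [mul_nonneg hη.le p2]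

/-- The density of a functional
`c₁ ∫ |∇u|² + c₂ ∫ u² |∇u|² + ∫ w u² - κ ∫ |u|^(p+1)`. -/
noncomputable def dens (c₁ c₂ κ p : ℝ) (w : E N → ℝ) (u : E N → ℝ) (G : E N → E N) (x : E N) : ℝ :=
  c₁ * ‖G x‖ ^ 2 + c₂ * (u x ^ 2 * ‖G x‖ ^ 2) + w x * u x ^ 2 - κ * |u x| ^ (p + 1)

theorem IsX.integrable_weight {u : E N → ℝ} {G : E N → E N} (h : IsX u G) {w : E N → ℝ}
    (hw : Measurable w) {W : ℝ} (hW : ∀ x, |w x| ≤ W) :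
    Integrable (fun x => w x * u x ^ 2) volume :=
  h.integrable_sq.bdd_mul hw.aestronglyMeasurable (Eventually.of_forall hW)

theorem IsX.integrable_dens (hN : 3 ≤ N) {p : ℝ} (hp : 1 < p) (hpc : p + 1 < critExp N)
    {u : E N → ℝ} {G : E N → E N} (h : IsX u G) {w : E N → ℝ}
    (hw : Measurable w) {W : ℝ} (hW : ∀ x, |w x| ≤ W) (c₁ c₂ κ : ℝ) :
    Integrable (dens c₁ c₂ κ p w u G) volume :=
  (((h.integrable_grad.const_mul c₁).add (h.integrable_mul.const_mul c₂)).add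
    (h.integrable_weight hw hW)).sub ((h.integrable_rpow hN (by linarith) hpc.le).const_mul κ)

theorem IsX.integral_dens (hN : 3 ≤ N) {p : ℝ} (hp : 1 < p) (hpc : p + 1 < critExp N)
    {u : E N → ℝ} {G : E N → E N} (h : IsX u G) {w : E N → ℝ}
    (hw : Measurable w) {W : ℝ} (hW : ∀ x, |w x| ≤ W) (c₁ c₂ κ : ℝ) (s : Set (E N)) :
    ∫ x in s, dens c₁ c₂ κ p w u G x = c₁ * (∫ x in s, ‖G x‖ ^ 2)
      + c₂ * (∫ x in s, u x ^ 2 * ‖G x‖ ^ 2) + (∫ x in s, w x * u x ^ 2)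
      - κ * ∫ x in s, |u x| ^ (p + 1) := by
  have i1 : Integrable (fun x => c₁ * ‖G x‖ ^ 2) (volume.restrict s) :=
    (h.integrable_grad.const_mul c₁).restrict
  have i2 : Integrable (fun x => c₂ * (u x ^ 2 * ‖G x‖ ^ 2)) (volume.restrict s) :=
    (h.integrable_mul.const_mul c₂).restrict
  have i3 : Integrable (fun x => w x * u x ^ 2) (volume.restrict s) :=
    (h.integrable_weight hw hW).restrict
  have i4 : Integrable (fun x => κ * |u x| ^ (p + 1)) (volume.restrict s) :=
    ((h.integrable_rpow hN (by linarith) hpc.le).const_mul κ).restrict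
  have i12 : Integrable (fun x => c₁ * ‖G x‖ ^ 2 + c₂ * (u x ^ 2 * ‖G x‖ ^ 2))
    (volume.restrict s) := i1.add i2
  have i123 : Integrable (fun x => c₁ * ‖G x‖ ^ 2 + c₂ * (u x ^ 2 * ‖G x‖ ^ 2) + w x * u x ^ 2)
    (volume.restrict s) := i12.add i3
  simp only [dens]
  rw [integral_sub i123 i4, integral_add i12 i3, integral_add i1 i2, integral_const_mul,
    integral_const_mul, integral_const_mul]

/-- Weak lower semicontinuity of the `L²` norm on measurable sets. -/
theorem TendstoWeakly.eventually_sub_le {F : Type*} [NormedAddCommGroup F]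
    [InnerProductSpace ℝ F] {f : ℕ → E N → F} {g : E N → F} (h : TendstoWeakly f g)
    (hf : ∀ n, MemLp (f n) 2 volume) (hg : MemLp g 2 volume) {s : Set (E N)}
    (hs : MeasurableSet s) {η : ℝ} (hη : 0 < η) :
    ∀ᶠ n in atTop, (∫ x in s, ‖g x‖ ^ 2) - η ≤ ∫ x in s, ‖f n x‖ ^ 2 := by
  have h1 := h (s.indicator g) (hg.indicator hs)
  have e : ∀ k : E N → F, ∫ x, inner ℝ (k x) (s.indicator g x) = ∫ x in s, inner ℝ (k x) (g x) := by
    intro k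
    rw [← integral_indicator hs]
    congr 1; ext x
    by_cases hx : x ∈ s <;> simp [hx]
  simp only [e, real_inner_self_eq_norm_sq] at h1
  filter_upwards [h1.eventually (lt_mem_nhds (show (∫ x in s, ‖g x‖ ^ 2) - η / 2 < _ by linarith))]
    with n hn
  have i1 : Integrable (fun x => 2 * inner ℝ (f n x) (g x)) (volume.restrict s) :=
    ((integrable_inner_of_memLp (hf n) hg).const_mul 2).restrict
  have i2 : Integrable (fun x => ‖g x‖ ^ 2) (volume.restrict s) :=
    (hg.integrable_norm_pow two_ne_zero).restrict
  have i3 : Integrable (fun x => ‖f n x‖ ^ 2) (volume.restrict s) :=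
    ((hf n).integrable_norm_pow two_ne_zero).restrict
  have h2 : ∫ x in s, (2 * inner ℝ (f n x) (g x) - ‖g x‖ ^ 2) ≤ ∫ x in s, ‖f n x‖ ^ 2 := by
    refine integral_mono (i1.sub i2) i3 fun x => ?_
    have := norm_sub_sq_real (f n x) (g x)
    have h3 : 0 ≤ ‖f n x - g x‖ ^ 2 := by positivity
    simp only []; linarith
  rw [integral_sub i1 i2, integral_const_mul] at h2
  linarith

/-- Lower semicontinuity on balls of the functionals with densities `dens`. -/
theorem eventually_integral_dens_sub_le (hN : 3 ≤ N) {p : ℝ} (hp : 1 < p)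
    (hpc : p + 1 < critExp N) {c₁ c₂ κ : ℝ} (hc₁ : 0 ≤ c₁) (hc₂ : 0 ≤ c₂) (hκ : 0 ≤ κ)
    {w : ℕ → E N → ℝ} {w₀ : E N → ℝ} (hw : ∀ n, Measurable (w n)) (hw₀ : Measurable w₀) {W : ℝ}
    (hW : ∀ n x, |w n x| ≤ W) (hW₀ : ∀ x, |w₀ x| ≤ W)
    (hwl : ∀ x, Tendsto (fun n => w n x) atTop (𝓝 (w₀ x)))
    {v : ℕ → E N → ℝ} {G : ℕ → E N → E N} {v₀ : E N → ℝ} {G₀ : E N → E N}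
    (hv : ∀ n, IsX (v n) (G n)) (hv₀ : IsX v₀ G₀) {E₀ : ℝ}
    (hE : ∀ n, ∫ x, energyDensity (v n) (G n) x ≤ E₀)
    (t1 : TendstoWeakly G G₀) (t2 : TendstoWeakly (fun n x => v n x • G n x) (fun x => v₀ x • G₀ x))
    (R : ℝ) (t3 : Tendsto (fun n => eLpNorm (fun x => v n x - v₀ x) 2
      (volume.restrict (Metric.ball 0 R))) atTop (𝓝 0)) {η : ℝ} (hη : 0 < η) :
    ∀ᶠ n in atTop, (∫ x in Metric.ball 0 R, dens c₁ c₂ κ p w₀ v₀ G₀ x) - η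
      ≤ ∫ x in Metric.ball 0 R, dens c₁ c₂ κ p (w n) (v n) (G n) x := by
  set B := Metric.ball (0 : E N) R
  set μ := (volume : Measure (E N)).restrict B
  have hE0 : 0 ≤ E₀ := (integral_nonneg (energyDensity_nonneg _ _)).trans (hE 0)
  have m1 := t1.eventually_sub_le (fun n => (hv n).memLp_grad) hv₀.memLp_grad
    (s := B) Metric.isOpen_ball.measurableSet (η := η / (4 * (c₁ + 1))) (by positivity)
  have m2 := t2.eventually_sub_le (fun n => (hv n).memLp_smul) hv₀.memLp_smul
    (s := B) Metric.isOpen_ball.measurableSet (η := η / (4 * (c₂ + 1))) (by positivity)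
  -- The difference `w n * (v n ^ 2 - v₀ ^ 2)` pairs `v n - v₀`, which tends to 0 in `L²` of the
  -- ball, with the bounded factor `(v n + v₀) * w n`; dominated convergence handles the change of
  -- weight.
  have m3 : Tendsto (fun n => ∫ x, w n x * v n x ^ 2 ∂μ) atTop (𝓝 (∫ x, w₀ x * v₀ x ^ 2 ∂μ)) := by
    have s1 : Tendsto (fun n => ∫ x, w n x * v₀ x ^ 2 ∂μ) atTop (𝓝 (∫ x, w₀ x * v₀ x ^ 2 ∂μ)) := by
      refine tendsto_integral_of_dominated_convergence (fun x => W * v₀ x ^ 2)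
        (fun n => ((hv₀.integrable_weight (hw n) (hW n)).restrict).1)
        (hv₀.integrable_sq.const_mul W).restrict (fun n => Eventually.of_forall fun x => ?_)
        (Eventually.of_forall fun x => (hwl x).mul_const _)
      rw [norm_mul, Real.norm_of_nonneg (sq_nonneg (v₀ x))]
      exact mul_le_mul_of_nonneg_right (hW n x) (sq_nonneg _)
    have hd : ∀ n, MemLp (fun x => v n x - v₀ x) 2 μ := fun n =>
      ((hv n).memLp.sub hv₀.memLp).restrict _
    have hs : ∀ n, MemLp (fun x => v n x + v₀ x) 2 μ := fun n =>
      ((hv n).memLp.add hv₀.memLp).restrict _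
    have hg : ∀ n, MemLp (fun x => (v n x + v₀ x) * w n x) 2 μ := fun n =>
      (hs n).mul_bdd (hw n).aestronglyMeasurable (hW n)
    have hgb : ∀ᶠ n in atTop, eLpNorm (fun x => (v n x + v₀ x) * w n x) 2 μ
        ≤ ENNReal.ofReal W * (1 + eLpNorm (fun x => v₀ x + v₀ x) 2 μ) := by
      have := eventually_eLpNorm_le (f := fun n x => v n x + v₀ x) (f₀ := fun x => v₀ x + v₀ x)
        (fun n => (hs n).1) (hv₀.memLp.add hv₀.memLp).1.restrict (μ := μ) (by simpa using t3)
      filter_upwards [this] with n hn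
      refine (eLpNorm_le_mul_eLpNorm_of_ae_le_mul (c := W) (g := fun x => v n x + v₀ x)
        (Eventually.of_forall fun x => ?_) 2).trans ?_
      · rw [norm_mul, mul_comm]
        exact mul_le_mul_of_nonneg_right (hW n x) (norm_nonneg _)
      · gcongr
    have s2 := tendsto_integral_inner_of_tendsto (μ := μ) (L := 0) (f₀ := fun _ => (0 : ℝ)) hd
      (MemLp.zero' (p := 2)) hg (C := ENNReal.ofReal W * (1 + eLpNorm (fun x => v₀ x + v₀ x) 2 μ))
      (ENNReal.mul_ne_top (by simp) (ENNReal.add_ne_top.2 ⟨by simp,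
        ((hv₀.memLp.add hv₀.memLp).restrict _).2.ne⟩)) hgb (by simpa using t3) (by simp)
    have s3 := s2.add s1
    rw [zero_add] at s3
    refine s3.congr fun n => ?_
    rw [← integral_add (integrable_inner_of_memLp (hd n) (hg n))
      (hv₀.integrable_weight (hw n) (hW n)).restrict]
    refine integral_congr_ae (Eventually.of_forall fun x => ?_)
    simp only [RCLike.inner_apply, conj_trivial]; ring
  -- The power enters with a negative sign, so only an upper bound is needed. The one-sided estimate
  -- gives it: its first error is absorbed by the energy bound, its second by strong local
  -- convergence, and each costs at most η / 8 after multiplication by `κ`.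
  have m4 : ∀ᶠ n in atTop, κ * (∫ x, |v n x| ^ (p + 1) ∂μ)
      ≤ κ * (∫ x, |v₀ x| ^ (p + 1) ∂μ) + η / 4 := by
    obtain ⟨C, hC0, hC⟩ := exists_rpow_le_rpow_add (a := p + 1) (by linarith) hpc
      (η := η / (8 * (κ + 1) * (E₀ + 1))) (by positivity)
    have s1 : Tendsto (fun n => ∫ x, (v n x - v₀ x) ^ 2 ∂μ) atTop (𝓝 0) := by
      have := ((ENNReal.tendsto_toReal ENNReal.zero_ne_top).comp t3).pow 2
      simp only [ENNReal.toReal_zero, ne_eq, OfNat.ofNat_ne_zero, not_false_eq_true,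
        zero_pow] at this
      refine this.congr fun n => ?_
      have hd : MemLp (fun x => v n x - v₀ x) 2 μ := ((hv n).memLp.sub hv₀.memLp).restrict _
      simp only [Function.comp]
      rw [← ENNReal.toReal_pow, eLpNorm_two_sq, integral_eq_lintegral_of_nonneg_ae
        (Eventually.of_forall fun x => by positivity) hd.integrable_sq.1]
      congr 1
      refine lintegral_congr fun x => ?_
      rw [← ofReal_norm, ← ENNReal.ofReal_pow (norm_nonneg _), Real.norm_eq_abs, sq_abs]
    filter_upwards [s1.eventually (gt_mem_nhds (show 0 < η / (8 * (κ + 1) * (C + 1)) by positivity))]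
      with n hn
    have hd : MemLp (fun x => v n x - v₀ x) 2 μ := ((hv n).memLp.sub hv₀.memLp).restrict _
    have ie : Integrable (fun x => v n x ^ 2 + |v n x| ^ critExp N) volume :=
      (hv n).integrable_sq.add ((hv n).integrable_crit hN)
    have i0 : Integrable (fun x => |v₀ x| ^ (p + 1)) μ :=
      (hv₀.integrable_rpow hN (by linarith) hpc.le).restrict
    have i1 : Integrable (fun x => η / (8 * (κ + 1) * (E₀ + 1))
      * (v n x ^ 2 + |v n x| ^ critExp N)) μ := (ie.const_mul _).restrict
    have i2 : Integrable (fun x => C * (v n x - v₀ x) ^ 2) μ := hd.integrable_sq.const_mul C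
    have i01 : Integrable (fun x => |v₀ x| ^ (p + 1) + η / (8 * (κ + 1) * (E₀ + 1))
      * (v n x ^ 2 + |v n x| ^ critExp N)) μ := i0.add i1
    have hle : ∫ x, (v n x ^ 2 + |v n x| ^ critExp N) ∂μ ≤ E₀ := by
      refine le_trans (setIntegral_le_integral ie (Eventually.of_forall fun x => ?_))
        (le_trans (integral_mono ie ((hv n).integrable_energyDensity hN) fun x => ?_) (hE n))
      · simp only [Pi.zero_apply]; positivity
      · have h1 : 0 ≤ v n x ^ 2 * ‖G n x‖ ^ 2 := by positivity
        have h2 : 0 ≤ v n x ^ 4 := by positivity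
        have h3 : 0 ≤ ‖G n x‖ ^ 2 := by positivity
        simp only [energyDensity]; linarith
    have h1 : ∫ x, |v n x| ^ (p + 1) ∂μ ≤ (∫ x, |v₀ x| ^ (p + 1) ∂μ)
        + η / (8 * (κ + 1) * (E₀ + 1)) * (∫ x, (v n x ^ 2 + |v n x| ^ critExp N) ∂μ)
        + C * ∫ x, (v n x - v₀ x) ^ 2 ∂μ := by
      rw [← integral_const_mul, ← integral_const_mul, ← integral_add i0 i1, ← integral_add i01 i2]
      refine integral_mono ((hv n).integrable_rpow hN (by linarith) hpc.le).restrict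
        (i01.add i2) fun x => ?_
      have := hC |v n x| |v₀ x| (abs_nonneg _) (abs_nonneg _)
      rw [sq_abs] at this
      have h2 : (|v n x| - |v₀ x|) ^ 2 ≤ (v n x - v₀ x) ^ 2 :=
        sq_le_sq.2 (abs_abs_sub_abs_le (v n x) (v₀ x))
      have := mul_le_mul_of_nonneg_left h2 hC0
      simp only []; linarith
    have h2 : η / (8 * (κ + 1) * (E₀ + 1)) * (∫ x, (v n x ^ 2 + |v n x| ^ critExp N) ∂μ)
        ≤ η / (8 * (κ + 1)) := by
      calc _ ≤ η / (8 * (κ + 1) * (E₀ + 1)) * (E₀ + 1) :=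
            mul_le_mul_of_nonneg_left (by linarith) (by positivity)
        _ = _ := by field_simp
    have h3 : C * ∫ x, (v n x - v₀ x) ^ 2 ∂μ ≤ η / (8 * (κ + 1)) := by
      calc _ ≤ (C + 1) * (η / (8 * (κ + 1) * (C + 1))) :=
            mul_le_mul (by linarith) hn.le (integral_nonneg fun x => by positivity) (by linarith)
        _ = _ := by field_simp
    have h4 : κ * (η / (8 * (κ + 1)) + η / (8 * (κ + 1))) ≤ η / 4 := by
      rw [show κ * (η / (8 * (κ + 1)) + η / (8 * (κ + 1))) = η / 4 * (κ / (κ + 1)) by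
        field_simp; ring]
      exact mul_le_of_le_one_right (by positivity) ((div_le_one (by positivity)).2 (by linarith))
    nlinarith [mul_le_mul_of_nonneg_left h1 hκ, mul_le_mul_of_nonneg_left h2 hκ,
      mul_le_mul_of_nonneg_left h3 hκ]
  filter_upwards [m1, m2, m3.eventually (lt_mem_nhds (show (∫ x, w₀ x * v₀ x ^ 2 ∂μ) - η / 4 < _ by
    linarith)), m4] with n h1 h2 h3 h4
  rw [(hv n).integral_dens hN hp hpc (hw n) (hW n), hv₀.integral_dens hN hp hpc hw₀ hW₀]
  have k1 := mul_le_mul_of_nonneg_left h1 hc₁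
  have k2 := mul_le_mul_of_nonneg_left h2 hc₂
  simp only [norm_smul, mul_pow, Real.norm_eq_abs, sq_abs] at k2
  have k3 : c₁ * (η / (4 * (c₁ + 1))) ≤ η / 4 := by
    rw [show c₁ * (η / (4 * (c₁ + 1))) = η / 4 * (c₁ / (c₁ + 1)) by field_simp]
    exact mul_le_of_le_one_right (by positivity) ((div_le_one (by positivity)).2 (by linarith))
  have k4 : c₂ * (η / (4 * (c₂ + 1))) ≤ η / 4 := by
    rw [show c₂ * (η / (4 * (c₂ + 1))) = η / 4 * (c₂ / (c₂ + 1)) by field_simp]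
    exact mul_le_of_le_one_right (by positivity) ((div_le_one (by positivity)).2 (by linarith))
  rw [mul_sub] at k1 k2
  linarith

/-! ### Weak compactness in `X` -/

/-- A weak `L²` limit is determined by testing against smooth compactly supported functions. -/
theorem TendstoWeakly.ae_eq_of_test {F : Type*} [NormedAddCommGroup F] [InnerProductSpace ℝ F]
    [CompleteSpace F] {f : ℕ → E N → F} {g g' : E N → F} (h : TendstoWeakly f g)
    (hg : MemLp g 2 volume) (hg' : LocallyIntegrable g' volume)
    (ht : ∀ ψ : E N → ℝ, ContDiff ℝ ∞ ψ → HasCompactSupport ψ → ∀ e : F,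
      Tendsto (fun n => ∫ x, inner ℝ (f n x) (ψ x • e)) atTop
        (𝓝 (∫ x, inner ℝ (g' x) (ψ x • e)))) : g =ᵐ[volume] g' := by
  have hgl : LocallyIntegrable g volume := hg.locallyIntegrable (by norm_num)
  refine ae_eq_of_integral_contDiff_smul_eq hgl hg' fun ψ hψ hc => ?_
  refine ext_inner_left ℝ fun e => ?_
  have i1 := hgl.integrable_smul_left_of_hasCompactSupport hψ.continuous hc
  have i2 := hg'.integrable_smul_left_of_hasCompactSupport hψ.continuous hc
  rw [← integral_inner i1, ← integral_inner i2]
  have hm : MemLp (fun x => ψ x • e) 2 volume :=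
    (hψ.continuous.smul continuous_const).memLp_of_hasCompactSupport hc.smul_right
  have := tendsto_nhds_unique (h _ hm) (ht ψ hψ hc e)
  simp only [inner_smul_right, real_inner_comm] at this ⊢
  exact this

theorem tendsto_eLpNorm_mul_test {v : ℕ → E N → ℝ} {v₀ : E N → ℝ}
    (t : ∀ R : ℝ, Tendsto (fun n => eLpNorm (fun x => v n x - v₀ x) 2
      (volume.restrict (Metric.ball 0 R))) atTop (𝓝 0))
    {ψ : E N → ℝ} (hψ : Continuous ψ) (hc : HasCompactSupport ψ) :
    Tendsto (fun n => eLpNorm (fun x => v n x * ψ x - v₀ x * ψ x) 2 volume) atTop (𝓝 0) := by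
  obtain ⟨C, hC⟩ := hc.exists_bound_of_continuous hψ
  obtain ⟨R, hR⟩ := hc.isCompact.isBounded.subset_ball (0 : E N)
  have e : ∀ n, eLpNorm (fun x => v n x * ψ x - v₀ x * ψ x) 2 volume
      = eLpNorm (fun x => v n x * ψ x - v₀ x * ψ x) 2 (volume.restrict (Metric.ball 0 R)) := by
    intro n
    rw [← eLpNorm_indicator_eq_eLpNorm_restrict Metric.isOpen_ball.measurableSet]
    congr 1
    refine (indicator_eq_self.2 fun x hx => hR (subset_tsupport ψ ?_)).symm
    intro h0
    simp [h0] at hx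
  simp only [e]
  refine tendsto_eLpNorm_of_norm_le (c := C) (fun n x => ?_) (t R)
  rw [← sub_mul, norm_mul, mul_comm]
  exact mul_le_mul_of_nonneg_right (hC x) (norm_nonneg _)

theorem eLpNorm_two_le_of_integral_le {F : Type*} [NormedAddCommGroup F] {f : E N → F}
    (hf : MemLp f 2 volume) {C : ℝ} (h : ∫ x, ‖f x‖ ^ 2 ≤ C) :
    eLpNorm f 2 volume ≤ ENNReal.ofReal C ^ (1 / 2 : ℝ) := by
  have h1 : eLpNorm f 2 volume ^ 2 ≤ ENNReal.ofReal C := by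
    rw [eLpNorm_two_sq]
    refine le_trans (le_of_eq ?_) (ENNReal.ofReal_le_ofReal h)
    rw [ofReal_integral_eq_lintegral_ofReal (hf.integrable_norm_pow two_ne_zero)
      (Eventually.of_forall fun x => by positivity)]
    refine lintegral_congr fun x => ?_
    rw [← ofReal_norm, ← ENNReal.ofReal_pow (norm_nonneg _)]
  have h2 := ENNReal.rpow_le_rpow h1 (show (0 : ℝ) ≤ 1 / 2 by norm_num)
  rw [← ENNReal.rpow_natCast, ← ENNReal.rpow_mul] at h2
  norm_num at h2
  simpa using h2

theorem IsX.integral_le_energy (hN : 3 ≤ N) {u : E N → ℝ} {G : E N → E N} (h : IsX u G) {E₀ : ℝ}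
    (hE : ∫ x, energyDensity u G x ≤ E₀) {f : E N → ℝ} (hf : Integrable f volume)
    (hle : ∀ x, f x ≤ energyDensity u G x) : ∫ x, f x ≤ E₀ :=
  (integral_mono hf (h.integrable_energyDensity hN) hle).trans hE

/-- Compactness: bounded sequences in `X` have subsequences which converge weakly in `X`. -/
theorem exists_isX_weak_limit (hN : 3 ≤ N) {v : ℕ → E N → ℝ} {G : ℕ → E N → E N}
    (hv : ∀ n, IsX (v n) (G n)) {E₀ : ℝ} (hE : ∀ n, ∫ x, energyDensity (v n) (G n) x ≤ E₀) :
    ∃ φ : ℕ → ℕ, StrictMono φ ∧ ∃ v₀ G₀, IsX v₀ G₀ ∧ TendstoWeakly (fun n => G (φ n)) G₀ ∧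
      TendstoWeakly (fun n x => v (φ n) x • G (φ n) x) (fun x => v₀ x • G₀ x) ∧
      ∀ R : ℝ, Tendsto (fun n => eLpNorm (fun x => v (φ n) x - v₀ x) 2
        (volume.restrict (Metric.ball 0 R))) atTop (𝓝 0) := by
  set C : ℝ≥0∞ := ENNReal.ofReal E₀ ^ (1 / 2 : ℝ)
  have hC : C ≠ ⊤ := ENNReal.rpow_ne_top_of_nonneg (by norm_num) ENNReal.ofReal_ne_top
  have pos : ∀ n x, 0 ≤ ‖G n x‖ ^ 2 ∧ 0 ≤ v n x ^ 2 ∧ 0 ≤ v n x ^ 2 * ‖G n x‖ ^ 2 ∧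
      0 ≤ v n x ^ 4 ∧ 0 ≤ |v n x| ^ critExp N := fun n x =>
    ⟨by positivity, by positivity, by positivity, by positivity, by positivity⟩
  have b1 : ∀ n, eLpNorm (v n) 2 volume ≤ C := fun n =>
    eLpNorm_two_le_of_integral_le (hv n).memLp ((hv n).integral_le_energy hN (hE n)
      ((hv n).memLp.integrable_norm_pow two_ne_zero) fun x => by
        obtain ⟨_, _, _, _, _⟩ := pos n x
        rw [Real.norm_eq_abs, sq_abs, energyDensity]; linarith)
  have b2 : ∀ n, eLpNorm (G n) 2 volume ≤ C := fun n =>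
    eLpNorm_two_le_of_integral_le (hv n).memLp_grad ((hv n).integral_le_energy hN (hE n)
      (hv n).integrable_grad fun x => by
        obtain ⟨_, _, _, _, _⟩ := pos n x
        rw [energyDensity]; linarith)
  have b3 : ∀ n, eLpNorm (fun x => v n x • G n x) 2 volume ≤ C := fun n =>
    eLpNorm_two_le_of_integral_le (hv n).memLp_smul ((hv n).integral_le_energy hN (hE n)
      ((hv n).memLp_smul.integrable_norm_pow two_ne_zero) fun x => by
        obtain ⟨_, _, _, _, _⟩ := pos n x
        rw [norm_smul, mul_pow, Real.norm_eq_abs, sq_abs, energyDensity]; linarith)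
  have b4 : ∀ n, eLpNorm (fun x => v n x ^ 2) 2 volume ≤ C := fun n =>
    eLpNorm_two_le_of_integral_le (hv n).memLp_sq ((hv n).integral_le_energy hN (hE n)
      ((hv n).memLp_sq.integrable_norm_pow two_ne_zero) fun x => by
        obtain ⟨_, _, _, _, _⟩ := pos n x
        rw [Real.norm_eq_abs, sq_abs, ← pow_mul, energyDensity, show 2 * 2 = 4 from rfl]; linarith)
  obtain ⟨φ1, h1, v₀, hv₀, w1⟩ := exists_tendstoWeakly (fun n => (hv n).memLp) hC b1
  obtain ⟨φ2, h2, G₀, hG₀, w2⟩ := exists_tendstoWeakly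
    (fun n => (hv (φ1 n)).memLp_grad) hC (fun n => b2 (φ1 n))
  obtain ⟨φ3, h3, H, hH, w3⟩ := exists_tendstoWeakly
    (fun n => (hv (φ1 (φ2 n))).memLp_smul) hC (fun n => b3 (φ1 (φ2 n)))
  obtain ⟨φ4, h4, Z, hZ, w4⟩ := exists_tendstoWeakly
    (fun n => (hv (φ1 (φ2 (φ3 n)))).memLp_sq) hC (fun n => b4 (φ1 (φ2 (φ3 n))))
  set φ : ℕ → ℕ := fun n => φ1 (φ2 (φ3 (φ4 n)))
  have hφ : StrictMono φ := h1.comp (h2.comp (h3.comp h4))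
  have w1' : TendstoWeakly (fun n => v (φ n)) v₀ := w1.comp (h2.comp (h3.comp h4))
  have w2' : TendstoWeakly (fun n => G (φ n)) G₀ := w2.comp (h3.comp h4)
  have w3' : TendstoWeakly (fun n x => v (φ n) x • G (φ n) x) H := w3.comp h4
  have w4' : TendstoWeakly (fun n x => v (φ n) x ^ 2) Z := w4
  have t : ∀ R : ℝ, Tendsto (fun n => eLpNorm (fun x => v (φ n) x - v₀ x) 2
      (volume.restrict (Metric.ball 0 R))) atTop (𝓝 0) := fun R =>
    w1'.tendsto_eLpNorm_restrict_ball (fun n => (hv (φ n)).grad) (fun n => (hv (φ n)).memLp)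
      hv₀ (fun n => (hv (φ n)).memLp_grad) hC (fun n => b1 _) (fun n => b2 _) R
  have hgrad : HasWeakGradient v₀ G₀ := by
    refine ⟨hv₀.locallyIntegrable (by norm_num), hG₀.locallyIntegrable (by norm_num),
      fun ψ hψ hc e => ?_⟩
    have hψ1 : ContDiff ℝ 1 ψ := hψ.of_le (by exact_mod_cast le_top)
    have m1 : MemLp (fun x => fderiv ℝ ψ x e) 2 volume :=
      Continuous.memLp_of_hasCompactSupport
        ((hψ1.continuous_fderiv one_ne_zero).clm_apply continuous_const) (hc.fderiv_apply ℝ e)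
    have m2 : MemLp (fun x => ψ x • e) 2 volume :=
      (hψ.continuous.smul continuous_const).memLp_of_hasCompactSupport hc.smul_right
    have l1 := w1' _ m1
    have l2 := (w2' _ m2).neg
    have e1 : ∀ n, ∫ x, inner ℝ (v (φ n) x) (fderiv ℝ ψ x e)
        = -∫ x, inner ℝ (G (φ n) x) (ψ x • e) := by
      intro n
      have := (hv (φ n)).grad.2.2 ψ hψ hc e
      simpa [inner_smul_right, mul_comm] using this
    simp only [e1] at l1
    have := tendsto_nhds_unique l1 l2
    simpa [inner_smul_right, mul_comm] using this
  have strong : ∀ ψ : E N → ℝ, ContDiff ℝ ∞ ψ → HasCompactSupport ψ →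
      (∀ n, MemLp (fun x => v (φ n) x * ψ x) 2 volume) ∧ MemLp (fun x => v₀ x * ψ x) 2 volume ∧
      Tendsto (fun n => eLpNorm (fun x => v (φ n) x * ψ x - v₀ x * ψ x) 2 volume) atTop (𝓝 0) := by
    intro ψ hψ hc
    obtain ⟨K, hK⟩ := hc.exists_bound_of_continuous hψ.continuous
    exact ⟨fun n => (hv (φ n)).memLp.mul_bdd hψ.continuous.aestronglyMeasurable hK,
      hv₀.mul_bdd hψ.continuous.aestronglyMeasurable hK,
      tendsto_eLpNorm_mul_test t hψ.continuous hc⟩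
  -- At this stage the product is only known to be integrable; that it lies in `L²` follows from its
  -- identification with the weak limit `H`.
  have i3 : Integrable (fun x => v₀ x • G₀ x) volume :=
    memLp_one_iff_integrable.1 (MemLp.smul (r := 1) hG₀ hv₀)
  -- Against a test function, `v n` times the test function converges strongly and `G n` weakly, so
  -- the product passes to the limit.
  have hHeq : H =ᵐ[volume] fun x => v₀ x • G₀ x := by
    refine w3'.ae_eq_of_test hH i3.locallyIntegrable fun ψ hψ hc e => ?_
    obtain ⟨s1, s2, s3⟩ := strong ψ hψ hc
    have hL : Tendsto (fun n => ∫ x, inner ℝ (v₀ x * ψ x) (inner ℝ (G (φ n) x) e)) atTop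
        (𝓝 (∫ x, inner ℝ (v₀ x • G₀ x) (ψ x • e))) := by
      have hm : MemLp (fun x => (v₀ x * ψ x) • e) 2 volume :=
        s2.of_le_mul (c := ‖e‖) (s2.1.smul aestronglyMeasurable_const)
          (Eventually.of_forall fun x => by rw [norm_smul, mul_comm])
      have := w2' _ hm
      simp only [inner_smul_right, inner_smul_left, RCLike.inner_apply, conj_trivial] at this ⊢
      convert this using 2
      · refine integral_congr_ae (Eventually.of_forall fun x => ?_)
        simp only []; ring
      · refine integral_congr_ae (Eventually.of_forall fun x => ?_)
        simp only []; ring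
    have := tendsto_integral_inner_of_tendsto s1 s2
      (fun n => (hv (φ n)).memLp_grad.inner_const e) (C := ENNReal.ofReal ‖e‖ * C)
      (ENNReal.mul_ne_top (by simp) hC) (Eventually.of_forall fun n => ?_) s3 hL
    · refine this.congr fun n => ?_
      simp only [inner_smul_right, inner_smul_left, RCLike.inner_apply, conj_trivial]
      congr 1; ext x; ring
    · refine (eLpNorm_le_mul_eLpNorm_of_ae_le_mul (c := ‖e‖) (g := G (φ n))
        (Eventually.of_forall fun x => ?_) 2).trans ?_
      · rw [mul_comm]; exact norm_inner_le_norm _ _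
      · gcongr; exact b2 _
  have hZeq : Z =ᵐ[volume] fun x => v₀ x ^ 2 := by
    refine w4'.ae_eq_of_test hZ hv₀.integrable_sq.locallyIntegrable fun ψ hψ hc e => ?_
    obtain ⟨s1, s2, s3⟩ := strong ψ hψ hc
    have hL : Tendsto (fun n => ∫ x, inner ℝ (v₀ x * ψ x) (v (φ n) x)) atTop
        (𝓝 (∫ x, inner ℝ (v₀ x * ψ x) (v₀ x))) := by
      simpa only [real_inner_comm] using w1' _ s2
    have := (tendsto_integral_inner_of_tendsto s1 s2 (fun n => (hv (φ n)).memLp) hC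
      (Eventually.of_forall fun n => b1 _) s3 hL).mul_const e
    simp only [← integral_mul_const] at this
    convert this using 2
    · refine integral_congr_ae (Eventually.of_forall fun x => ?_)
      simp only [smul_eq_mul, RCLike.inner_apply, conj_trivial]; ring
    · refine integral_congr_ae (Eventually.of_forall fun x => ?_)
      simp only [smul_eq_mul, RCLike.inner_apply, conj_trivial]; ring
  refine ⟨φ, hφ, v₀, G₀, ⟨hgrad, hv₀, hG₀, hH.ae_eq hHeq, hZ.ae_eq hZeq⟩, w2', ?_, t⟩
  intro h hh
  have := w3' h hh
  rwa [integral_congr_ae (g := fun x => inner ℝ (v₀ x • G₀ x) (h x))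
    (by filter_upwards [hHeq] with x hx; rw [hx])] at this

/-! ### Exterior cutoffs and their energy -/

/-- The exterior cutoff of `v`. -/
noncomputable def extCut (R : ℝ) (v : E N → ℝ) (x : E N) : ℝ := (1 - cutoff N R x) * v x

/-- The weak gradient of the exterior cutoff. -/
noncomputable def extCutGrad (R : ℝ) (v : E N → ℝ) (G : E N → E N) (x : E N) : E N :=
  (1 - cutoff N R x) • G x + v x • gradient (fun x => 1 - cutoff N R x) x

theorem gradient_one_sub_cutoff (R : ℝ) (x : E N) :
    gradient (fun x => 1 - cutoff N R x) x = - gradient (cutoff N R) x := by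
  rw [gradient, gradient, fderiv_const_sub, map_neg]

/-- The values 0 and 1 are global extrema of the cutoff. -/
theorem gradient_cutoff_eq_zero (R : ℝ) {x : E N} (h : cutoff N R x = 0 ∨ cutoff N R x = 1) :
    gradient (cutoff N R) x = 0 := by
  have : fderiv ℝ (cutoff N R) x = 0 := by
    rcases h with h | h
    · exact IsLocalMin.fderiv_eq_zero (Eventually.of_forall fun y => by
        rw [h]; exact cutoff_nonneg R y)
    · exact IsLocalMax.fderiv_eq_zero (Eventually.of_forall fun y => by
        rw [h]; exact cutoff_le_one R y)
  rw [gradient, this, map_zero]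

theorem norm_extCutGrad_sq_le {C R : ℝ} (hC : ∀ R > 0, ∀ x : E N, ‖fderiv ℝ (cutoff N R) x‖ ≤ C / R)
    (hC0 : 0 ≤ C) (hR : 1 ≤ R) (v : E N → ℝ) (G : E N → E N) (x : E N) :
    ‖extCutGrad R v G x‖ ^ 2 ≤ 2 * ‖G x‖ ^ 2 + 2 * C ^ 2 * v x ^ 2 := by
  have h1 : ‖extCutGrad R v G x‖ ≤ ‖G x‖ + |v x| * C := by
    refine (norm_add_le _ _).trans (add_le_add ?_ ?_)
    · rw [norm_smul, Real.norm_of_nonneg (by linarith [cutoff_le_one R x])]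
      exact mul_le_of_le_one_left (norm_nonneg _) (by linarith [cutoff_nonneg R x])
    · rw [norm_smul, gradient_one_sub_cutoff, norm_neg, norm_gradient, Real.norm_eq_abs]
      refine mul_le_mul_of_nonneg_left ((hC R (by linarith) x).trans ?_) (abs_nonneg _)
      exact div_le_self hC0 hR
  have h2 := pow_le_pow_left₀ (norm_nonneg _) h1 2
  have h3 : (|v x| * C) ^ 2 = C ^ 2 * v x ^ 2 := by rw [mul_pow, sq_abs]; ring
  nlinarith [sq_nonneg (‖G x‖ - |v x| * C)]

theorem abs_extCut_le (R : ℝ) (v : E N → ℝ) (x : E N) : |extCut R v x| ≤ |v x| := by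
  rw [extCut, abs_mul, abs_of_nonneg (by linarith [cutoff_le_one R x])]
  exact mul_le_of_le_one_left (abs_nonneg _) (by linarith [cutoff_nonneg R x])

theorem IsX.extCut {v : E N → ℝ} {G : E N → E N} (h : IsX v G) {R : ℝ} (hR : 1 ≤ R) :
    IsX (extCut R v) (extCutGrad R v G) := by
  obtain ⟨C, hC0, hC⟩ := exists_norm_fderiv_cutoff_le N
  have hχ : ContDiff ℝ ∞ (fun x => 1 - cutoff N R x) := contDiff_const.sub (contDiff_cutoff R)
  obtain ⟨h1, h2, h3⟩ := h.grad.bddSmooth_mul h.memLp h.memLp_grad hχ (C := 1 + C) (fun x => by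
      rw [Real.norm_of_nonneg (by linarith [cutoff_le_one R x])]
      linarith [cutoff_nonneg R x]) (fun x => by
      rw [fderiv_const_sub, norm_neg]
      have := (hC R (by linarith) x).trans (div_le_self hC0 hR)
      linarith)
  refine ⟨h1, h2, h3, ?_, ?_⟩
  -- The derivative of the cutoff turns u∇u into a multiple of v², which is in `L²` by the
  -- definition of `X`.
  · have hm : MemLp (fun x => 2 * ‖v x • G x‖ + 2 * C * v x ^ 2) 2 volume :=
      (h.memLp_smul.norm.const_mul 2).add (h.memLp_sq.const_mul (2 * C))
    refine hm.of_le (h2.1.smul h3.1) (Eventually.of_forall fun x => ?_)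
    have k1 := norm_extCutGrad_sq_le hC hC0 hR v G x
    have k2 : ‖extCutGrad R v G x‖ ≤ 2 * ‖G x‖ + 2 * C * |v x| := by
      refine abs_le_of_sq_le_sq' ?_ (by positivity) |>.2
      have : (|v x|) ^ 2 = v x ^ 2 := sq_abs _
      have p : 0 ≤ ‖G x‖ * (C * |v x|) := by positivity
      nlinarith [sq_nonneg ‖G x‖, sq_nonneg (C * |v x|)]
    rw [Real.norm_of_nonneg (by positivity), norm_smul, norm_smul]
    calc ‖ModNLS.extCut R v x‖ * ‖extCutGrad R v G x‖
        ≤ |v x| * (2 * ‖G x‖ + 2 * C * |v x|) :=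
          mul_le_mul (abs_extCut_le R v x) k2 (norm_nonneg _) (abs_nonneg _)
      _ = _ := by rw [Real.norm_eq_abs, ← sq_abs]; ring
  · refine h.memLp_sq.of_le (h2.1.pow 2) (Eventually.of_forall fun x => ?_)
    rw [norm_pow, norm_pow]
    exact pow_le_pow_left₀ (norm_nonneg _) (abs_extCut_le R v x) 2

/-- Energy estimate for the exterior cutoff. -/
theorem exists_integral_dens_extCut_le (hN : 3 ≤ N) {p : ℝ} (hp : 1 < p)
    (hpc : p + 1 < critExp N) {c₁ c₂ κ W : ℝ} (hc₁ : 0 ≤ c₁) (hc₂ : 0 ≤ c₂) (hκ : 0 ≤ κ)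
    (hW0 : 0 ≤ W) :
    ∃ K : ℝ, 0 ≤ K ∧ ∀ (w : E N → ℝ), Measurable w → (∀ x, |w x| ≤ W) →
      ∀ (v : E N → ℝ) (G : E N → E N), IsX v G → ∀ R : ℝ, 1 ≤ R →
      ∫ x, dens c₁ c₂ κ p w (extCut R v) (extCutGrad R v G) x
        ≤ (∫ x, dens c₁ c₂ κ p w v G x) - (∫ x in Metric.ball 0 (2 * R), dens c₁ c₂ κ p w v G x)
          + K * ∫ x in Metric.ball 0 (2 * R) \ Metric.ball 0 R, energyDensity v G x := by
  obtain ⟨C, hC0, hC⟩ := exists_norm_fderiv_cutoff_le N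
  refine ⟨(2 + 2 * C ^ 2) * c₁ + (2 + 2 * C ^ 2) * c₂ + W, by positivity,
    fun w hw hW v G h R hR => ?_⟩
  set K := (2 + 2 * C ^ 2) * c₁ + (2 + 2 * C ^ 2) * c₂ + W
  have hR0 : 0 < R := by linarith
  set B1 := Metric.ball (0 : E N) R
  set B2 := Metric.ball (0 : E N) (2 * R)
  have hB1 : MeasurableSet B1 := Metric.isOpen_ball.measurableSet
  have hB2 : MeasurableSet B2 := Metric.isOpen_ball.measurableSet
  have ib := (h.extCut hR).integrable_dens hN hp hpc hw hW c₁ c₂ κ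
  have iv := h.integrable_dens hN hp hpc hw hW c₁ c₂ κ
  have ie : Integrable (fun x => K * energyDensity v G x) volume :=
    (h.integrable_energyDensity hN).const_mul K
  -- Nothing remains inside the smaller ball and nothing changes outside the larger one. On the
  -- annulus the power term has a favourable sign and is dropped, and the rest is bounded by the
  -- energy density; its summand v⁴ absorbs v²·v²|∇χ|².
  have hpt : ∀ x, dens c₁ c₂ κ p w (extCut R v) (extCutGrad R v G) x
      ≤ B2ᶜ.indicator (dens c₁ c₂ κ p w v G) x
        + (B2 \ B1).indicator (fun x => K * energyDensity v G x) x := by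
    intro x
    by_cases h2 : x ∈ B2
    · have hnot : x ∉ B2ᶜ := by simpa using h2
      rw [indicator_of_notMem hnot, zero_add]
      by_cases h1 : x ∈ B1
      · have hχ : cutoff N R x = 1 := cutoff_eq_one hR0 (mem_ball_zero_iff.1 h1).le
        have e1 : extCut R v x = 0 := by simp [extCut, hχ]
        have e2 : extCutGrad R v G x = 0 := by
          simp [extCutGrad, gradient_one_sub_cutoff, hχ, gradient_cutoff_eq_zero R (Or.inr hχ)]
        rw [indicator_of_notMem (fun h => h.2 h1), dens, e1, e2]
        simp [Real.zero_rpow (show p + 1 ≠ 0 by linarith)]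
      · rw [indicator_of_mem (show x ∈ B2 \ B1 from ⟨h2, h1⟩)]
        have k1 := norm_extCutGrad_sq_le hC hC0 hR v G x
        have k2 : extCut R v x ^ 2 ≤ v x ^ 2 := sq_le_sq.2 (abs_extCut_le R v x)
        have k3 : 0 ≤ κ * |extCut R v x| ^ (p + 1) := by positivity
        have k4 : w x * extCut R v x ^ 2 ≤ W * v x ^ 2 :=
          mul_le_mul (abs_le.1 (hW x)).2 k2 (sq_nonneg _) hW0
        have k5 : extCut R v x ^ 2 * ‖extCutGrad R v G x‖ ^ 2
            ≤ v x ^ 2 * (2 * ‖G x‖ ^ 2 + 2 * C ^ 2 * v x ^ 2) :=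
          mul_le_mul k2 k1 (sq_nonneg _) (sq_nonneg _)
        have k6 := mul_le_mul_of_nonneg_left k1 hc₁
        have k7 := mul_le_mul_of_nonneg_left k5 hc₂
        have q1 : 0 ≤ ‖G x‖ ^ 2 := by positivity
        have q2 : 0 ≤ v x ^ 2 := by positivity
        have q3 : 0 ≤ v x ^ 2 * ‖G x‖ ^ 2 := by positivity
        have q4 : 0 ≤ v x ^ 4 := by positivity
        have q5 : 0 ≤ |v x| ^ critExp N := by positivity
        have he : energyDensity v G x = ‖G x‖ ^ 2 + v x ^ 2 + v x ^ 2 * ‖G x‖ ^ 2 + v x ^ 4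
          + |v x| ^ critExp N := rfl
        have m1 : c₁ * (2 * ‖G x‖ ^ 2 + 2 * C ^ 2 * v x ^ 2)
            ≤ (2 + 2 * C ^ 2) * c₁ * energyDensity v G x := by
          rw [show c₁ * (2 * ‖G x‖ ^ 2 + 2 * C ^ 2 * v x ^ 2)
            = c₁ * 2 * ‖G x‖ ^ 2 + c₁ * (2 * C ^ 2) * v x ^ 2 by ring]
          have a1 : c₁ * 2 * ‖G x‖ ^ 2 ≤ c₁ * 2 * energyDensity v G x :=
            mul_le_mul_of_nonneg_left (by linarith) (by positivity)
          have a2 : c₁ * (2 * C ^ 2) * v x ^ 2 ≤ c₁ * (2 * C ^ 2) * energyDensity v G x :=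
            mul_le_mul_of_nonneg_left (by linarith) (by positivity)
          linarith
        have m2 : c₂ * (v x ^ 2 * (2 * ‖G x‖ ^ 2 + 2 * C ^ 2 * v x ^ 2))
            ≤ (2 + 2 * C ^ 2) * c₂ * energyDensity v G x := by
          rw [show c₂ * (v x ^ 2 * (2 * ‖G x‖ ^ 2 + 2 * C ^ 2 * v x ^ 2))
            = c₂ * 2 * (v x ^ 2 * ‖G x‖ ^ 2) + c₂ * (2 * C ^ 2) * v x ^ 4 by ring]
          have a1 : c₂ * 2 * (v x ^ 2 * ‖G x‖ ^ 2) ≤ c₂ * 2 * energyDensity v G x :=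
            mul_le_mul_of_nonneg_left (by linarith) (by positivity)
          have a2 : c₂ * (2 * C ^ 2) * v x ^ 4 ≤ c₂ * (2 * C ^ 2) * energyDensity v G x :=
            mul_le_mul_of_nonneg_left (by linarith) (by positivity)
          linarith
        have m3 : W * v x ^ 2 ≤ W * energyDensity v G x :=
          mul_le_mul_of_nonneg_left (by linarith) hW0
        simp only [dens, K]
        linarith
    · have hnot : x ∉ B2 \ B1 := fun h => h2 h.1
      rw [indicator_of_notMem hnot, add_zero, indicator_of_mem (by simpa using h2)]
      have hχ : cutoff N R x = 0 := cutoff_eq_zero hR0 (by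
        simpa [B2] using h2)
      have e1 : extCut R v x = v x := by simp [extCut, hχ]
      have e2 : extCutGrad R v G x = G x := by
        simp [extCutGrad, gradient_one_sub_cutoff, hχ, gradient_cutoff_eq_zero R (Or.inl hχ)]
      rw [dens, dens, e1, e2]
  have j1 := iv.indicator hB2.compl
  have j2 := ie.indicator (hB2.diff hB1)
  calc _ ≤ ∫ x, (B2ᶜ.indicator (dens c₁ c₂ κ p w v G) x
        + (B2 \ B1).indicator (fun x => K * energyDensity v G x) x) :=
        integral_mono ib (j1.add j2) hpt
    _ = (∫ x in B2ᶜ, dens c₁ c₂ κ p w v G x)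
        + ∫ x in B2 \ B1, K * energyDensity v G x := by
        rw [integral_add j1 j2, integral_indicator hB2.compl, integral_indicator (hB2.diff hB1)]
    _ = _ := by
        have := integral_add_compl hB2 iv
        rw [integral_const_mul]; linarith

/-! ### Concentration compactness -/

theorem eventually_setIntegral_ball {f : E N → ℝ} (hf : Integrable f volume) {ε : ℝ} (hε : 0 < ε) :
    ∀ᶠ R : ℝ in atTop, (∫ x, f x) - ε < ∫ x in Metric.ball 0 R, f x := by
  have hc : AECover (volume : Measure (E N)) atTop (fun R : ℝ => Metric.ball (0 : E N) R) :=
    aecover_ball tendsto_id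
  exact (hc.integral_tendsto_of_countably_generated hf).eventually (lt_mem_nhds (by linarith))

/-- Among many dyadic annuli one carries little mass. -/
theorem exists_dyadic_annulus {f : E N → ℝ} (hf : Integrable f volume) (h0 : ∀ x, 0 ≤ f x) {E₀ : ℝ}
    (hE : ∫ x, f x ≤ E₀) {ρ : ℝ} (hρ : 0 < ρ) {K : ℕ} (hK : 0 < K) :
    ∃ k < K, ∫ x in Metric.ball 0 (2 * (2 ^ k * ρ)) \ Metric.ball 0 (2 ^ k * ρ), f x
      ≤ E₀ / K := by
  set g : ℕ → ℝ := fun k => ∫ x in Metric.ball (0 : E N) (2 ^ k * ρ), f x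
  have e : ∀ k, ∫ x in Metric.ball (0 : E N) (2 * (2 ^ k * ρ)) \ Metric.ball 0 (2 ^ k * ρ), f x
      = g (k + 1) - g k := by
    intro k
    have hr : 2 * (2 ^ k * ρ) = 2 ^ (k + 1) * ρ := by ring
    rw [hr, setIntegral_sdiff Metric.isOpen_ball.measurableSet hf.integrableOn]
    refine Metric.ball_subset_ball ?_
    rw [← hr]
    have : 0 < 2 ^ k * ρ := by positivity
    linarith
  -- The annuli are consecutive, so their integrals telescope to at most `E₀`; one of `K` of them
  -- carries at most the average.
  have hs : ∑ k ∈ Finset.range K, (g (k + 1) - g k) ≤ ∑ _k ∈ Finset.range K, E₀ / K := by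
    rw [Finset.sum_range_sub, Finset.sum_const, Finset.card_range, nsmul_eq_mul,
      mul_div_cancel₀ _ (by positivity)]
    have h1 : g K ≤ ∫ x, f x := setIntegral_le_integral hf (Eventually.of_forall h0)
    have h2 : 0 ≤ g 0 := integral_nonneg h0
    linarith
  obtain ⟨k, hk, hle⟩ := Finset.exists_le_of_sum_le (Finset.nonempty_range_iff.2 hK.ne') hs
  exact ⟨k, Finset.mem_range.1 hk, (e k).trans_le hle⟩

/-- Concentration compactness: minimizing sequences with local mass have a nontrivial weak limit
satisfying the limit constraint and the limit energy bound. -/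
theorem exists_limit_of_minimizing (hN : 3 ≤ N) {p : ℝ} (hp : 1 < p) (hpc : p + 1 < critExp N)
    {c₁ c₂ κ d₁ d₂ W m E₀ : ℝ} (hc₁ : 0 ≤ c₁) (hc₂ : 0 ≤ c₂) (hκ : 0 ≤ κ) (hd₁ : 0 ≤ d₁)
    (hd₂ : 0 ≤ d₂) {a b : ℕ → E N → ℝ} {a₀ b₀ : E N → ℝ}
    (ham : ∀ n, Measurable (a n)) (hbm : ∀ n, Measurable (b n))
    (ham₀ : Measurable a₀) (hbm₀ : Measurable b₀)
    (ha : ∀ n x, |a n x| ≤ W) (hb : ∀ n x, |b n x| ≤ W)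
    (ha₀ : ∀ x, |a₀ x| ≤ W) (hb₀ : ∀ x, |b₀ x| ≤ W)
    (hb_nonneg : ∀ n x, 0 ≤ b n x) (hb₀_pos : ∀ x, 0 < b₀ x)
    (hal : ∀ x, Tendsto (fun n => a n x) atTop (𝓝 (a₀ x)))
    (hbl : ∀ x, Tendsto (fun n => b n x) atTop (𝓝 (b₀ x)))
    {v : ℕ → E N → ℝ} {G : ℕ → E N → E N} (hv : ∀ n, IsX (v n) (G n))
    (hE : ∀ n, ∫ x, energyDensity (v n) (G n) x ≤ E₀)
    (hJ : ∀ n, ∫ x, dens c₁ c₂ κ p (a n) (v n) (G n) x ≤ 0)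
    (hP : Tendsto (fun n => ∫ x, dens d₁ d₂ 0 p (b n) (v n) (G n) x) atTop (𝓝 m))
    (hmin : ∀ n u H, IsX u H → ¬ (u =ᵐ[volume] 0) → ∫ x, dens c₁ c₂ κ p (a n) u H x ≤ 0 →
      m ≤ ∫ x, dens d₁ d₂ 0 p (b n) u H x)
    {R₀ δ : ℝ} (hδ : 0 < δ) (hmass : ∀ n, δ ≤ ∫ x in Metric.ball 0 R₀, v n x ^ 2) :
    ∃ v₀ G₀, IsX v₀ G₀ ∧ ¬ (v₀ =ᵐ[volume] 0) ∧ ∫ x, dens c₁ c₂ κ p a₀ v₀ G₀ x ≤ 0 ∧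
      ∫ x, dens d₁ d₂ 0 p b₀ v₀ G₀ x ≤ m := by
  obtain ⟨φ, hφ, v₀, G₀, hv₀, t1, t2, t3⟩ := exists_isX_weak_limit hN hv hE
  have hφt := hφ.tendsto_atTop
  -- Strong convergence on the fixed ball of radius `R₀` preserves the mass `δ`.
  have hne : ¬ (v₀ =ᵐ[volume] 0) := by
    intro h0
    have h1 : Tendsto (fun n => eLpNorm (v (φ n)) 2
        (volume.restrict (Metric.ball (0 : E N) R₀))) atTop (𝓝 0) := by
      refine (t3 R₀).congr fun n => eLpNorm_congr_ae (ae_restrict_of_ae ?_)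
      filter_upwards [h0] with x hx
      simp [hx]
    have h2 := ((ENNReal.tendsto_toReal ENNReal.zero_ne_top).comp h1).pow 2
    simp only [ENNReal.toReal_zero, ne_eq, OfNat.ofNat_ne_zero, not_false_eq_true, zero_pow] at h2
    obtain ⟨n, hn⟩ := (h2.eventually (gt_mem_nhds hδ)).exists
    have h3 := hmass (φ n)
    rw [Function.comp, ← ENNReal.toReal_pow, eLpNorm_two_sq] at hn
    rw [integral_eq_lintegral_of_nonneg_ae (Eventually.of_forall fun x => by positivity)
      (hv (φ n)).integrable_sq.restrict.1] at h3
    refine absurd h3 (not_le.2 (lt_of_eq_of_lt ?_ hn))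
    congr 1
    refine lintegral_congr fun x => ?_
    rw [← ofReal_norm, ← ENNReal.ofReal_pow (norm_nonneg _), Real.norm_eq_abs, sq_abs]
  have lscJ : ∀ R : ℝ, ∀ η > 0, ∀ᶠ n in atTop,
      (∫ x in Metric.ball 0 R, dens c₁ c₂ κ p a₀ v₀ G₀ x) - η
        ≤ ∫ x in Metric.ball 0 R, dens c₁ c₂ κ p (a (φ n)) (v (φ n)) (G (φ n)) x :=
    fun R η hη => eventually_integral_dens_sub_le hN hp hpc hc₁ hc₂ hκ (fun n => ham (φ n)) ham₀
      (fun n => ha (φ n)) ha₀ (fun x => (hal x).comp hφt) (fun n => hv (φ n)) hv₀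
      (fun n => hE (φ n)) t1 t2 R (t3 R) hη
  have lscP : ∀ R : ℝ, ∀ η > 0, ∀ᶠ n in atTop,
      (∫ x in Metric.ball 0 R, dens d₁ d₂ 0 p b₀ v₀ G₀ x) - η
        ≤ ∫ x in Metric.ball 0 R, dens d₁ d₂ 0 p (b (φ n)) (v (φ n)) (G (φ n)) x :=
    fun R η hη => eventually_integral_dens_sub_le hN hp hpc hd₁ hd₂ le_rfl (fun n => hbm (φ n))
      hbm₀ (fun n => hb (φ n)) hb₀ (fun x => (hbl x).comp hφt) (fun n => hv (φ n)) hv₀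
      (fun n => hE (φ n)) t1 t2 R (t3 R) hη
  have iJ := hv₀.integrable_dens hN hp hpc ham₀ ha₀ c₁ c₂ κ
  have iP := hv₀.integrable_dens hN hp hpc hbm₀ hb₀ d₁ d₂ 0
  have hP' := hP.comp hφt
  have Pnn : ∀ n x, 0 ≤ dens d₁ d₂ 0 p (b (φ n)) (v (φ n)) (G (φ n)) x := by
    intro n x
    have := hb_nonneg (φ n) x
    simp only [dens, zero_mul, sub_zero]
    positivity
  refine ⟨v₀, G₀, hv₀, hne, ?_, ?_⟩
  -- If the limit had positive constraint value, `v n` without a large ball would be a better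
  -- competitor: it loses a positive amount of both functionals, at an arbitrarily small cutting
  -- cost.
  · by_contra! hJpos
    have hPpos : 0 < ∫ x, dens d₁ d₂ 0 p b₀ v₀ G₀ x := by
      have hnn : ∀ x, b₀ x * v₀ x ^ 2 ≤ dens d₁ d₂ 0 p b₀ v₀ G₀ x := fun x => by
        have h1 : 0 ≤ d₁ * ‖G₀ x‖ ^ 2 := by positivity
        have h2 : 0 ≤ d₂ * (v₀ x ^ 2 * ‖G₀ x‖ ^ 2) := by positivity
        simp only [dens, zero_mul, sub_zero]; linarith
      have iw := hv₀.integrable_weight hbm₀ hb₀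
      have hwnn : ∀ x, 0 ≤ b₀ x * v₀ x ^ 2 := fun x => mul_nonneg (hb₀_pos x).le (sq_nonneg _)
      refine lt_of_lt_of_le ?_ (integral_mono iw iP hnn)
      refine lt_of_le_of_ne (integral_nonneg hwnn) fun h0 => hne ?_
      have := (integral_eq_zero_iff_of_nonneg hwnn iw).1 h0.symm
      filter_upwards [this] with x hx
      have := mul_eq_zero.1 hx
      rcases this with h | h
      · exact absurd h (hb₀_pos x).ne'
      · simpa using h
    set J0 := ∫ x, dens c₁ c₂ κ p a₀ v₀ G₀ x
    set P0 := ∫ x, dens d₁ d₂ 0 p b₀ v₀ G₀ x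
    -- Bookkeeping: the limit has at least 4θ of each functional. Restriction to a large ball and
    -- semicontinuity each lose θ, so 2θ is removed from `v n`; cutting returns at most θ and the
    -- minimizing sequence exceeds `m` by less than θ. The exterior part thus has constraint value
    -- at most -θ and energy below `m`.
    set θ := min J0 P0 / 4
    have hθ : 0 < θ := by have := lt_min hJpos hPpos; positivity
    have hθJ : 4 * θ ≤ J0 := by simp only [θ]; linarith [min_le_left J0 P0]
    have hθP : 4 * θ ≤ P0 := by simp only [θ]; linarith [min_le_right J0 P0]
    have hW0 : 0 ≤ W := (abs_nonneg _).trans (ha₀ 0)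
    obtain ⟨K1, hK1, hcut1⟩ := exists_integral_dens_extCut_le hN hp hpc hc₁ hc₂ hκ hW0
    obtain ⟨K2, hK2, hcut2⟩ := exists_integral_dens_extCut_le hN hp hpc hd₁ hd₂ le_rfl hW0
    have hE0 : 0 ≤ E₀ := (integral_nonneg (energyDensity_nonneg _ _)).trans (hE 0)
    obtain ⟨ρ, hρ⟩ := eventually_atTop.1 (((eventually_setIntegral_ball iJ hθ).and
      (eventually_setIntegral_ball iP hθ)).and (eventually_ge_atTop 1))
    have hρ1 : 1 ≤ ρ := (hρ ρ le_rfl).2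
    have hρ0 : 0 < ρ := by linarith
    obtain ⟨K, hK⟩ := exists_nat_gt ((K1 + K2) * E₀ / θ)
    have hKpos : (0 : ℝ) < K := lt_of_le_of_lt (by positivity) hK
    have hKsmall : (K1 + K2) * (E₀ / K) ≤ θ := by
      rw [div_lt_iff₀ hθ] at hK
      rw [← mul_div_assoc, div_le_iff₀ hKpos]; linarith
    -- The good annulus depends on `n`, so the bounds are secured first for all of the finitely many
    -- radii, and only then are `n` and the annulus chosen.
    have ev : ∀ᶠ n in atTop, ∀ k ∈ Finset.range K,
        2 * θ ≤ ∫ x in Metric.ball 0 (2 * (2 ^ k * ρ)),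
          dens c₁ c₂ κ p (a (φ n)) (v (φ n)) (G (φ n)) x ∧
        2 * θ ≤ ∫ x in Metric.ball 0 (2 * (2 ^ k * ρ)),
          dens d₁ d₂ 0 p (b (φ n)) (v (φ n)) (G (φ n)) x := by
      rw [Filter.eventually_all_finset]
      intro k _
      have hge : ρ ≤ 2 * (2 ^ k * ρ) := by
        have : (1 : ℝ) ≤ 2 ^ k := one_le_pow₀ (by norm_num)
        nlinarith
      obtain ⟨⟨h1, h2⟩, -⟩ := hρ _ hge
      filter_upwards [lscJ (2 * (2 ^ k * ρ)) θ hθ, lscP (2 * (2 ^ k * ρ)) θ hθ] with n h3 h4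
      constructor <;> linarith
    obtain ⟨n, hn1, hn2⟩ := (ev.and (hP'.eventually (gt_mem_nhds (show m < m + θ by linarith)))).exists
    obtain ⟨k, hkK, hk⟩ := exists_dyadic_annulus ((hv (φ n)).integrable_energyDensity hN)
      (energyDensity_nonneg _ _) (hE (φ n)) hρ0 (Nat.cast_pos.1 hKpos)
    obtain ⟨hj, hpn⟩ := hn1 k (Finset.mem_range.2 hkK)
    have hR1 : 1 ≤ 2 ^ k * ρ := by
      have : (1 : ℝ) ≤ 2 ^ k := one_le_pow₀ (by norm_num)
      nlinarith
    have q1 := hcut1 (a (φ n)) (ham _) (ha _) _ _ (hv (φ n)) _ hR1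
    have q2 := hcut2 (b (φ n)) (hbm _) (hb _) _ _ (hv (φ n)) _ hR1
    have q3 := mul_le_mul_of_nonneg_left hk hK1
    have q4 := mul_le_mul_of_nonneg_left hk hK2
    have hEK : 0 ≤ E₀ / K := by positivity
    have q5 : K1 * (E₀ / K) ≤ θ := by nlinarith [mul_nonneg hK2 hEK]
    have q6 : K2 * (E₀ / K) ≤ θ := by nlinarith [mul_nonneg hK1 hEK]
    have hJb : ∫ x, dens c₁ c₂ κ p (a (φ n)) (extCut (2 ^ k * ρ) (v (φ n)))
        (extCutGrad (2 ^ k * ρ) (v (φ n)) (G (φ n))) x < 0 := by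
      have := hJ (φ n)
      linarith
    have hbX := (hv (φ n)).extCut hR1
    -- For a function vanishing almost everywhere only the nonnegative gradient term of the density
    -- survives, contrary to `hJb`.
    have hbne : ¬ (extCut (2 ^ k * ρ) (v (φ n)) =ᵐ[volume] 0) := by
      intro h0
      refine absurd hJb (not_lt.2 (integral_nonneg_of_ae ?_))
      filter_upwards [h0] with x hx
      simp only [dens, hx, Pi.zero_apply, abs_zero,
        Real.zero_rpow (show p + 1 ≠ 0 by linarith)]
      have : 0 ≤ c₁ * ‖extCutGrad (2 ^ k * ρ) (v (φ n)) (G (φ n)) x‖ ^ 2 := by positivity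
      simpa using this
    have hm := hmin (φ n) _ _ hbX hbne hJb.le
    simp only [Function.comp] at hn2
    linarith
  -- The second density is nonnegative, so its integral over a ball is at most the total one, which
  -- tends to `m`.
  · refine le_of_forall_pos_le_add fun ε hε => ?_
    obtain ⟨R, hR⟩ := (eventually_setIntegral_ball iP (show 0 < ε / 3 by positivity)).exists
    obtain ⟨n, h1, h2⟩ := ((lscP R (ε / 3) (by positivity)).and
      (hP'.eventually (gt_mem_nhds (show m < m + ε / 3 by linarith)))).exists
    have h3 : ∫ x in Metric.ball 0 R, dens d₁ d₂ 0 p (b (φ n)) (v (φ n)) (G (φ n)) x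
        ≤ ∫ x, dens d₁ d₂ 0 p (b (φ n)) (v (φ n)) (G (φ n)) x :=
      setIntegral_le_integral ((hv (φ n)).integrable_dens hN hp hpc (hbm _) (hb _) d₁ d₂ 0)
        (Eventually.of_forall (Pnn n))
    simp only [Function.comp] at h2
    linarith

/-! ### The potential and its weights -/

/-- The hypotheses on the potential, with the bound on `x · ∇V` pointwise. -/
structure IsPotential (N : ℕ) (p V₀ Vinf K : ℝ) (V : E N → ℝ) : Prop where
  contDiff : ContDiff ℝ 1 V
  lower : ∀ x, V₀ ≤ V x
  upper : ∀ x, V x ≤ Vinf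
  radial : ∀ x, |fderiv ℝ V x x| ≤ K
  concave : ∀ x : E N, ConcaveOn ℝ (Ioi (0 : ℝ))
    (fun s : ℝ => s ^ (((N : ℝ) + 2) / ((N : ℝ) + p + 1)) *
      V (s ^ (1 / ((N : ℝ) + p + 1)) • x))

/-- For a continuous function the set where the essential bound fails is open and null, hence empty.
-/
theorem abs_le_of_memLp_top {k : E N → ℝ} (hk : Continuous k) (h : MemLp k ⊤ volume) :
    ∃ K, ∀ x, |k x| ≤ K := by
  refine ⟨(eLpNorm k ⊤ volume).toReal, ?_⟩
  have hopen : IsOpen {x | (eLpNorm k ⊤ volume).toReal < |k x|} :=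
    isOpen_lt continuous_const hk.abs
  have hae : ∀ᵐ x, |k x| ≤ (eLpNorm k ⊤ volume).toReal := by
    filter_upwards [ae_le_eLpNormEssSup (f := k) (μ := volume)] with x hx
    rw [← eLpNorm_exponent_top] at hx
    have := ENNReal.toReal_mono h.2.ne hx
    simpa using this
  have h0 : volume {x | (eLpNorm k ⊤ volume).toReal < |k x|} = 0 := by
    have := ae_iff.1 hae
    simpa using this
  have h1 := (hopen.measure_eq_zero_iff (volume : Measure (E N))).1 h0
  intro x
  by_contra! hx
  have : x ∈ {x | (eLpNorm k ⊤ volume).toReal < |k x|} := hx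
  rw [h1] at this
  exact this

/-- The weight of `u²` in the functional `J`. -/
noncomputable def weightJ (V : E N → ℝ) (x : E N) : ℝ :=
  (((N : ℝ) + 2) * V x + fderiv ℝ V x x) / 2

/-- The weight of `u²` in `I - J / (N + p + 1)`. -/
noncomputable def weightP (p : ℝ) (V : E N → ℝ) (x : E N) : ℝ :=
  V x / 2 - weightJ V x / ((N : ℝ) + p + 1)

theorem continuous_radial {V : E N → ℝ} (hV : ContDiff ℝ 1 V) :
    Continuous fun x => fderiv ℝ V x x :=
  (hV.continuous_fderiv one_ne_zero).clm_apply continuous_id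

theorem continuous_weightJ {V : E N → ℝ} (hV : ContDiff ℝ 1 V) : Continuous (weightJ V) :=
  ((continuous_const.mul hV.continuous).add (continuous_radial hV)).div_const 2

theorem continuous_weightP {p : ℝ} {V : E N → ℝ} (hV : ContDiff ℝ 1 V) :
    Continuous (weightP p V) :=
  (hV.continuous.div_const 2).sub ((continuous_weightJ hV).div_const _)

/-- The potential at infinity belongs to the same class with the same constants, so the uniform
bounds on the weights apply to it as well. Its profile is a nonnegative multiple of a power with
exponent at most 1. -/
theorem isPotential_const {p V₀ Vinf K : ℝ} (hp : 1 < p) (hV : 0 ≤ Vinf) (hle : V₀ ≤ Vinf)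
    (hK : 0 ≤ K) : IsPotential N p V₀ Vinf K (fun _ => Vinf) := by
  refine ⟨contDiff_const, fun _ => hle, fun _ => le_rfl, fun x => by simpa using hK, fun x => ?_⟩
  have h := ((Real.concaveOn_rpow (p := ((N : ℝ) + 2) / ((N : ℝ) + p + 1)) (by positivity)
    ((div_le_one (by positivity)).2 (by linarith))).subset Ioi_subset_Ici_self
      (convex_Ioi 0)).smul hV
  refine h.congr fun s _ => ?_
  simp [mul_comm]

namespace IsPotential

variable {p V₀ Vinf K : ℝ} {V : E N → ℝ}

/-- This links (V3) to the functionals: up to the factor 2 / (N + p + 1), the weight of u² in J is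
the slope at s = 1 of the concave profile. -/
theorem hasDerivAt_profile (h : IsPotential N p V₀ Vinf K V) (hp : 1 < p) (x : E N) :
    HasDerivAt (fun s : ℝ => s ^ (((N : ℝ) + 2) / ((N : ℝ) + p + 1)) *
      V (s ^ (1 / ((N : ℝ) + p + 1)) • x)) (2 / ((N : ℝ) + p + 1) * weightJ V x) 1 := by
  have h1 : HasDerivAt (fun s : ℝ => s ^ (((N : ℝ) + 2) / ((N : ℝ) + p + 1)))
      (((N : ℝ) + 2) / ((N : ℝ) + p + 1)) 1 := by
    simpa using Real.hasDerivAt_rpow_const (x := 1)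
      (p := ((N : ℝ) + 2) / ((N : ℝ) + p + 1)) (Or.inl one_ne_zero)
  have h2 : HasDerivAt (fun s : ℝ => s ^ (1 / ((N : ℝ) + p + 1)) • x)
      ((1 / ((N : ℝ) + p + 1)) • x) 1 := by
    have := (Real.hasDerivAt_rpow_const (x := 1)
      (p := 1 / ((N : ℝ) + p + 1)) (Or.inl one_ne_zero)).smul_const x
    simpa using this
  have h3 : HasFDerivAt V (fderiv ℝ V x) ((1 : ℝ) ^ (1 / ((N : ℝ) + p + 1)) • x) := by
    rw [Real.one_rpow, one_smul]
    exact (h.contDiff.differentiable one_ne_zero x).hasFDerivAt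
  have h4 := h1.mul (h3.comp_hasDerivAt 1 h2)
  refine h4.congr_deriv ?_
  simp only [Function.comp, Real.one_rpow, one_smul, map_smul, smul_eq_mul, weightJ]
  have : (N : ℝ) + p + 1 ≠ 0 := by positivity
  field_simp

/-- The concavity assumption gives a tangent inequality at `s = 1`. -/
theorem tangent (h : IsPotential N p V₀ Vinf K V) (hp : 1 < p) (x : E N) {s : ℝ} (hs : 0 < s) :
    s ^ (((N : ℝ) + 2) / ((N : ℝ) + p + 1)) * V (s ^ (1 / ((N : ℝ) + p + 1)) • x)
      ≤ V x + 2 / ((N : ℝ) + p + 1) * weightJ V x * (s - 1) := by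
  have hd := h.hasDerivAt_profile hp x
  have hc := h.concave x
  rcases lt_trichotomy s 1 with h1 | rfl | h1
  · have := hc.le_slope_of_hasDerivAt (mem_Ioi.2 hs) (mem_Ioi.2 one_pos) h1 hd
    rw [slope_def_field, le_div_iff₀ (by linarith)] at this
    simp only [Real.one_rpow, one_smul, one_mul] at this
    linarith
  · simp
  · have := hc.slope_le_of_hasDerivAt (mem_Ioi.2 one_pos) (mem_Ioi.2 hs) h1 hd
    rw [slope_def_field, div_le_iff₀ (by linarith)] at this
    simp only [Real.one_rpow, one_smul, one_mul] at this
    linarith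

theorem abs_weightJ_le (h : IsPotential N p V₀ Vinf K V) (hV₀ : 0 < V₀) (x : E N) :
    |weightJ V x| ≤ ((N + 2) * Vinf + K) / 2 := by
  have h1 := abs_le.1 (h.radial x)
  have h2 := h.upper x
  have h3 := h.lower x
  have h4 : 0 ≤ ((N : ℝ) + 2) * V x := by
    have : 0 ≤ V x := by linarith
    positivity
  have h5 : ((N : ℝ) + 2) * V x ≤ (N + 2) * Vinf := mul_le_mul_of_nonneg_left h2 (by positivity)
  rw [weightJ, abs_le]
  constructor <;> linarith

end IsPotential

/-- The profile lies above V₀ s ^ α, with α = (N + 2) / (N + p + 1), and so reaches 2 V_∞ at a fixed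
`S`, while at s = 1 it is at most V_∞. A tangent at 1 that stays above it must rise by V_∞ over the
length S - 1. Neither `S` nor the bound depends on `K` or on the particular `V`. -/
theorem exists_weightJ_lower (N : ℕ) {p V₀ Vinf : ℝ} (hp : 1 < p) (hV₀ : 0 < V₀)
    (hle : V₀ ≤ Vinf) : ∃ c, 0 < c ∧ ∀ (K : ℝ) (V : E N → ℝ), IsPotential N p V₀ Vinf K V →
      ∀ x, c ≤ weightJ V x := by
  set α := ((N : ℝ) + 2) / ((N : ℝ) + p + 1)
  have hα : 0 < α := by positivity
  have hVi : 0 < Vinf := by linarith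
  set S := (2 * Vinf / V₀) ^ (1 / α)
  have hS1 : 1 < S := Real.one_lt_rpow (by rw [one_lt_div hV₀]; linarith) (by positivity)
  have hSα : S ^ α = 2 * Vinf / V₀ := by
    rw [← Real.rpow_mul (by positivity), one_div_mul_cancel hα.ne', Real.rpow_one]
  have hq : 0 < (N : ℝ) + p + 1 := by positivity
  have hS0 : 0 < S - 1 := by linarith
  refine ⟨((N : ℝ) + p + 1) / 2 * (Vinf / (S - 1)), by positivity, fun K V h x => ?_⟩
  have ht := h.tangent hp x (show 0 < S by linarith)
  have h1 : 2 * Vinf ≤ S ^ α * V (S ^ (1 / ((N : ℝ) + p + 1)) • x) := by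
    rw [hSα]
    calc 2 * Vinf = 2 * Vinf / V₀ * V₀ := by field_simp
      _ ≤ _ := mul_le_mul_of_nonneg_left (h.lower _) (by positivity)
  have h2 := h.upper x
  have h3 : Vinf ≤ 2 / ((N : ℝ) + p + 1) * weightJ V x * (S - 1) := by linarith
  have h4 : Vinf / (S - 1) ≤ 2 / ((N : ℝ) + p + 1) * weightJ V x := by
    rwa [div_le_iff₀ hS0]
  calc _ ≤ ((N : ℝ) + p + 1) / 2 * (2 / ((N : ℝ) + p + 1) * weightJ V x) :=
        mul_le_mul_of_nonneg_left h4 (by positivity)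
    _ = _ := by field_simp

/-- Twice this weight is the value at s = 0 of the tangent to the profile at s = 1. With slope at
most `D`, that value is at least V₀ s ^ α - D s for every s > 0, which is positive for small s since
α < 1. -/
theorem exists_weightP_lower (N : ℕ) {p V₀ Vinf K : ℝ} (hp : 1 < p) (hV₀ : 0 < V₀)
    (hle : V₀ ≤ Vinf) (hK : 0 ≤ K) : ∃ c, 0 < c ∧ ∀ (V : E N → ℝ), IsPotential N p V₀ Vinf K V →
      ∀ x, c ≤ weightP p V x := by
  set α := ((N : ℝ) + 2) / ((N : ℝ) + p + 1)
  have hq : 0 < (N : ℝ) + p + 1 := by positivity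
  have hα1 : α < 1 := by rw [div_lt_one hq]; linarith
  have hVi : 0 < Vinf := by linarith
  set D := 2 / ((N : ℝ) + p + 1) * (((N + 2) * Vinf + K) / 2)
  have hD : 0 < D := by positivity
  -- Chosen so that V₀ s ^ α = 2 D s, which makes the intercept at least D s.
  set s := (V₀ / (2 * D)) ^ (1 / (1 - α))
  have hs : 0 < s := by positivity
  have hsα : s ^ α * V₀ = 2 * D * s := by
    have h1 : s ^ (1 - α) = V₀ / (2 * D) := by
      rw [← Real.rpow_mul (by positivity), one_div_mul_cancel (by linarith), Real.rpow_one]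
    have h2 : s = s ^ α * s ^ (1 - α) := by
      rw [← Real.rpow_add hs, add_sub_cancel, Real.rpow_one]
    have h3 : V₀ = 2 * D * s ^ (1 - α) := by rw [h1]; field_simp
    calc s ^ α * V₀ = 2 * D * (s ^ α * s ^ (1 - α)) := by rw [h3]; ring
      _ = _ := by rw [← h2]
  refine ⟨s * D / 2, by positivity, fun V h x => ?_⟩
  have ht := h.tangent hp x hs
  have h1 : 2 * D * s ≤ s ^ α * V (s ^ (1 / ((N : ℝ) + p + 1)) • x) := by
    rw [← hsα]
    exact mul_le_mul_of_nonneg_left (h.lower _) (by positivity)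
  have h2 : 2 / ((N : ℝ) + p + 1) * weightJ V x ≤ D :=
    mul_le_mul_of_nonneg_left (abs_le.1 (h.abs_weightJ_le hV₀ x)).2 (by positivity)
  have h3 : weightP p V x = (V x - 2 / ((N : ℝ) + p + 1) * weightJ V x) / 2 := by
    rw [weightP]; field_simp
  have h4 := mul_le_mul_of_nonneg_left h2 hs.le
  rw [h3]
  nlinarith

namespace IsPotential

variable {p V₀ Vinf K : ℝ} {V : E N → ℝ}

theorem abs_weightP_le (h : IsPotential N p V₀ Vinf K V) (hp : 1 < p) (hV₀ : 0 < V₀) (x : E N) :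
    |weightP p V x| ≤ Vinf + ((N + 2) * Vinf + K) / 2 := by
  have h1 := h.abs_weightJ_le hV₀ x
  have h2 := h.upper x
  have h3 := h.lower x
  have h4 : |weightJ V x / ((N : ℝ) + p + 1)| ≤ |weightJ V x| := by
    rw [abs_div]
    refine div_le_self (abs_nonneg _) ?_
    have : (0 : ℝ) ≤ N := Nat.cast_nonneg N
    rw [abs_of_nonneg (by positivity)]; linarith
  rw [weightP]
  refine (abs_sub _ _).trans ?_
  rw [abs_of_nonneg (show 0 ≤ V x / 2 by linarith)]
  linarith

/-- The weight of `J` converges at infinity. -/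
theorem tendsto_weightJ (h : IsPotential N p V₀ Vinf K V) (hp : 1 < p)
    (hlim : Tendsto V (cocompact (E N)) (𝓝 Vinf)) :
    Tendsto (weightJ V) (cocompact (E N)) (𝓝 (((N : ℝ) + 2) * Vinf / 2)) := by
  set α := ((N : ℝ) + 2) / ((N : ℝ) + p + 1)
  have hq : 0 < (N : ℝ) + p + 1 := by positivity
  have hd : HasDerivAt (fun s : ℝ => s ^ α * Vinf) (α * Vinf) 1 := by
    have := (Real.hasDerivAt_rpow_const (x := 1) (p := α) (Or.inl one_ne_zero)).mul_const Vinf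
    simpa using this
  have hsl := hasDerivAt_iff_tendsto_slope.1 hd
  have hslope : ∀ s, 0 < s → s ≠ 1 → Tendsto (fun y => (s ^ α * V (s ^ (1 / ((N : ℝ) + p + 1)) • y)
      - V y) / (s - 1)) (cocompact (E N)) (𝓝 (slope (fun s : ℝ => s ^ α * Vinf) 1 s)) := by
    intro s hs hs1
    have hsm : Tendsto (fun y : E N => s ^ (1 / ((N : ℝ) + p + 1)) • y) (cocompact _)
        (cocompact _) :=
      (Homeomorph.smulOfNeZero (s ^ (1 / ((N : ℝ) + p + 1)))
        (by positivity)).isClosedEmbedding.tendsto_cocompact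
    have := (((hlim.comp hsm).const_mul (s ^ α)).sub hlim).div_const (s - 1)
    rw [slope_def_field]
    simpa using this
  -- For fixed s the difference quotient of the profile between 1 and s converges at infinity to
  -- that of s ^ α · V_∞. By concavity the slope at 1 lies above the quotients with s > 1 and below
  -- those with s < 1; letting s → 1 squeezes it, without any assumption on the decay of x · ∇V.
  have key : Tendsto (fun y => 2 / ((N : ℝ) + p + 1) * weightJ V y) (cocompact (E N))
      (𝓝 (α * Vinf)) := by
    rw [tendsto_order]
    constructor
    · intro c hc
      have h1 : ∀ᶠ s in 𝓝[>] (1 : ℝ), c < slope (fun s : ℝ => s ^ α * Vinf) 1 s :=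
        (hsl.mono_left (nhdsWithin_mono _ fun s hs => ne_of_gt hs)).eventually (lt_mem_nhds hc)
      obtain ⟨s, hs, hs1⟩ := (h1.and self_mem_nhdsWithin).exists
      filter_upwards [(hslope s (by linarith) hs1.ne').eventually (lt_mem_nhds hs)] with y hy
      refine hy.trans_le ?_
      rw [div_le_iff₀ (by linarith)]
      linarith [h.tangent hp y (show 0 < s by linarith)]
    · intro c hc
      have h1 : ∀ᶠ s in 𝓝[<] (1 : ℝ), slope (fun s : ℝ => s ^ α * Vinf) 1 s < c :=
        (hsl.mono_left (nhdsWithin_mono _ fun s hs => ne_of_lt hs)).eventually (gt_mem_nhds hc)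
      have h2 : ∀ᶠ s in 𝓝[<] (1 : ℝ), 0 < s :=
        (eventually_gt_nhds one_pos).filter_mono nhdsWithin_le_nhds
      obtain ⟨s, ⟨hs, hs0⟩, hs1⟩ := ((h1.and h2).and self_mem_nhdsWithin).exists
      filter_upwards [(hslope s hs0 hs1.ne).eventually (gt_mem_nhds hs)] with y hy
      refine lt_of_le_of_lt ?_ hy
      rw [le_div_iff_of_neg (by linarith)]
      linarith [h.tangent hp y hs0]
  have := key.const_mul (((N : ℝ) + p + 1) / 2)
  have e1 : ((N : ℝ) + p + 1) / 2 * (α * Vinf) = ((N : ℝ) + 2) * Vinf / 2 := by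
    simp only [α]; field_simp
  rw [e1] at this
  refine this.congr fun y => ?_
  field_simp

end IsPotential

theorem weightJ_const (Vinf : ℝ) (x : E N) :
    weightJ (fun _ : E N => Vinf) x = ((N : ℝ) + 2) * Vinf / 2 := by
  simp [weightJ]

theorem add_one_lt_critExp (hN : 3 ≤ N) {p : ℝ} (hp2 : p < (3 * (N : ℝ) + 2) / ((N : ℝ) - 2)) :
    p + 1 < critExp N := by
  have hN' : (3 : ℝ) ≤ N := by exact_mod_cast hN
  have h : critExp N = (3 * (N : ℝ) + 2) / ((N : ℝ) - 2) + 1 := by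
    rw [critExp, div_add_one (by linarith)]
    ring
  linarith

/-! ### The functionals `I`, `J` and `P` -/

theorem J_eq {p V₀ Vinf K : ℝ} {V : E N → ℝ} (hpot : IsPotential N p V₀ Vinf K V) (hV₀ : 0 < V₀)
    {u : E N → ℝ} {G : E N → E N} (h : IsX u G) :
    J p V u = (N : ℝ) / 2 * (∫ x, ‖G x‖ ^ 2) + ((N : ℝ) + 2) / 2 * (∫ x, u x ^ 2 * ‖G x‖ ^ 2)
      + (∫ x, weightJ V x * u x ^ 2)
      - ((N : ℝ) + p + 1) / (p + 1) * ∫ x, |u x| ^ (p + 1) := by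
  have hG := h.grad.weakGrad_ae_eq
  have iV : Integrable (fun x => V x * u x ^ 2) volume :=
    h.integrable_weight hpot.contDiff.continuous.measurable (W := Vinf) fun x => by
      rw [abs_of_nonneg (hV₀.le.trans (hpot.lower x))]
      exact hpot.upper x
  have iR : Integrable (fun x => fderiv ℝ V x x * u x ^ 2) volume :=
    h.integrable_weight (continuous_radial hpot.contDiff).measurable hpot.radial
  have e1 : ∫ x, ‖weakGrad u x‖ ^ 2 = ∫ x, ‖G x‖ ^ 2 :=
    integral_congr_ae (hG.mono fun x hx => by simp only [hx])
  have e2 : ∫ x, (V x * u x ^ 2 + ‖weakGrad u x‖ ^ 2 * u x ^ 2)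
      = (∫ x, V x * u x ^ 2) + ∫ x, u x ^ 2 * ‖G x‖ ^ 2 := by
    rw [← integral_add iV h.integrable_mul]
    exact integral_congr_ae (hG.mono fun x hx => by simp only [hx]; ring)
  have e3 : ∫ x, weightJ V x * u x ^ 2
      = ((N : ℝ) + 2) / 2 * (∫ x, V x * u x ^ 2) + 1 / 2 * ∫ x, fderiv ℝ V x x * u x ^ 2 := by
    rw [← integral_const_mul, ← integral_const_mul,
      ← integral_add (iV.const_mul _) (iR.const_mul _)]
    refine integral_congr_ae (Eventually.of_forall fun x => ?_)
    simp only [weightJ]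
    ring
  rw [J, e1, e2, e3]
  ring

theorem I_eq {p V₀ Vinf K : ℝ} {V : E N → ℝ} (hpot : IsPotential N p V₀ Vinf K V) (hV₀ : 0 < V₀)
    {u : E N → ℝ} {G : E N → E N} (h : IsX u G) :
    I p V u = 1 / 2 * (∫ x, ‖G x‖ ^ 2) + 1 / 2 * (∫ x, u x ^ 2 * ‖G x‖ ^ 2)
      + 1 / 2 * (∫ x, V x * u x ^ 2) - 1 / (p + 1) * ∫ x, |u x| ^ (p + 1) := by
  have hG := h.grad.weakGrad_ae_eq
  have iV : Integrable (fun x => V x * u x ^ 2) volume :=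
    h.integrable_weight hpot.contDiff.continuous.measurable (W := Vinf) fun x => by
      rw [abs_of_nonneg (hV₀.le.trans (hpot.lower x))]
      exact hpot.upper x
  have e1 : ∫ x, (‖weakGrad u x‖ ^ 2 + V x * u x ^ 2 + u x ^ 2 * ‖weakGrad u x‖ ^ 2)
      = (∫ x, ‖G x‖ ^ 2) + (∫ x, V x * u x ^ 2) + ∫ x, u x ^ 2 * ‖G x‖ ^ 2 := by
    rw [← integral_add h.integrable_grad iV, ← integral_add _ h.integrable_mul]
    · exact integral_congr_ae (hG.mono fun x hx => by simp only [hx])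
    · exact h.integrable_grad.add iV
  rw [I, e1]
  ring

/-- The functional `I - J / (N + p + 1)`, which contains no power `|u|^(p+1)`. -/
noncomputable def P (p : ℝ) (V u : E N → ℝ) (G : E N → E N) : ℝ :=
  ∫ x, dens ((p + 1) / (2 * ((N : ℝ) + p + 1))) ((p - 1) / (2 * ((N : ℝ) + p + 1))) 0 p
    (weightP p V) u G x

section

variable {p V₀ Vinf K : ℝ} {V : E N → ℝ} {u : E N → ℝ} {G : E N → E N}

theorem integral_dens_weightJ (hN : 3 ≤ N) (hp : 1 < p) (hpc : p + 1 < critExp N)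
    (hpot : IsPotential N p V₀ Vinf K V) (hV₀ : 0 < V₀) (h : IsX u G) :
    ∫ x, dens ((N : ℝ) / 2) (((N : ℝ) + 2) / 2) (((N : ℝ) + p + 1) / (p + 1)) p (weightJ V) u G x
      = J p V u := by
  have := h.integral_dens hN hp hpc (continuous_weightJ hpot.contDiff).measurable
    (hpot.abs_weightJ_le hV₀) ((N : ℝ) / 2) (((N : ℝ) + 2) / 2) (((N : ℝ) + p + 1) / (p + 1)) univ
  simp only [setIntegral_univ] at this
  rw [this, J_eq hpot hV₀ h]

theorem P_eq (hN : 3 ≤ N) (hp : 1 < p) (hpc : p + 1 < critExp N)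
    (hpot : IsPotential N p V₀ Vinf K V) (hV₀ : 0 < V₀) (h : IsX u G) :
    P p V u G = (p + 1) / (2 * ((N : ℝ) + p + 1)) * (∫ x, ‖G x‖ ^ 2)
      + (p - 1) / (2 * ((N : ℝ) + p + 1)) * (∫ x, u x ^ 2 * ‖G x‖ ^ 2)
      + ∫ x, weightP p V x * u x ^ 2 := by
  have := h.integral_dens hN hp hpc (continuous_weightP (p := p) hpot.contDiff).measurable
    (hpot.abs_weightP_le hp hV₀) ((p + 1) / (2 * ((N : ℝ) + p + 1)))
    ((p - 1) / (2 * ((N : ℝ) + p + 1))) 0 univ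
  simp only [setIntegral_univ] at this
  rw [P, this]
  ring

/-- Division of J by q = N + p + 1 matches the coefficient 1 / (p + 1) of the power. What is left is
1/2 - N / (2q) = (p + 1) / (2q) for |∇u|² and 1/2 - (N + 2) / (2q) = (p - 1) / (2q) for u²|∇u|². -/
theorem I_eq_P_add (hN : 3 ≤ N) (hp : 1 < p) (hpc : p + 1 < critExp N)
    (hpot : IsPotential N p V₀ Vinf K V) (hV₀ : 0 < V₀) (h : IsX u G) :
    I p V u = P p V u G + J p V u / ((N : ℝ) + p + 1) := by
  have iV : Integrable (fun x => V x * u x ^ 2) volume :=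
    h.integrable_weight hpot.contDiff.continuous.measurable (W := Vinf) fun x => by
      rw [abs_of_nonneg (hV₀.le.trans (hpot.lower x))]
      exact hpot.upper x
  have iJ : Integrable (fun x => weightJ V x * u x ^ 2) volume :=
    h.integrable_weight (continuous_weightJ hpot.contDiff).measurable (hpot.abs_weightJ_le hV₀)
  have e : ∫ x, weightP p V x * u x ^ 2 = 1 / 2 * (∫ x, V x * u x ^ 2)
      - 1 / ((N : ℝ) + p + 1) * ∫ x, weightJ V x * u x ^ 2 := by
    rw [← integral_const_mul, ← integral_const_mul,
      ← integral_sub (iV.const_mul _) (iJ.const_mul _)]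
    refine integral_congr_ae (Eventually.of_forall fun x => ?_)
    simp only [weightP]
    ring
  rw [P_eq hN hp hpc hpot hV₀ h, I_eq hpot hV₀ h, J_eq hpot hV₀ h, e]
  have : (0 : ℝ) < (N : ℝ) + p + 1 := by positivity
  have : (0 : ℝ) < p + 1 := by positivity
  field_simp
  ring

/-! ### Scaling -/

theorem integral_grad_dilate (G : E N → E N) {t : ℝ} (ht : 0 < t) :
    ∫ x, ‖G (t⁻¹ • x)‖ ^ 2 = t ^ N * ∫ x, ‖G x‖ ^ 2 :=
  integral_comp_inv_smul_E ht fun x => ‖G x‖ ^ 2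

theorem integral_mul_dilate (u : E N → ℝ) (G : E N → E N) {t : ℝ} (ht : 0 < t) :
    ∫ x, dilate t u x ^ 2 * ‖G (t⁻¹ • x)‖ ^ 2 = t ^ (N + 2) * ∫ x, u x ^ 2 * ‖G x‖ ^ 2 := by
  have := integral_comp_inv_smul_E ht fun x => (t * u x) ^ 2 * ‖G x‖ ^ 2
  simp only [dilate]
  rw [this, pow_add, mul_assoc, ← integral_const_mul (t ^ 2)]
  simp only [mul_pow, mul_assoc]

theorem integral_weight_dilate (w u : E N → ℝ) {t : ℝ} (ht : 0 < t) :
    ∫ x, w x * dilate t u x ^ 2 = t ^ (N + 2) * ∫ x, w (t • x) * u x ^ 2 := by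
  have := integral_comp_smul_E ht fun x => w x * dilate t u x ^ 2
  rw [this, pow_add, mul_assoc, ← integral_const_mul (t ^ 2)]
  simp only [dilate, inv_smul_smul₀ ht.ne']
  congr 2
  ext x
  ring

theorem integral_rpow_dilate (u : E N → ℝ) (a : ℝ) {t : ℝ} (ht : 0 < t) :
    ∫ x, |dilate t u x| ^ a = t ^ N * t ^ a * ∫ x, |u x| ^ a := by
  have := integral_comp_inv_smul_E ht fun x => |t * u x| ^ a
  simp only [dilate]
  rw [this, mul_assoc, ← integral_const_mul (t ^ a)]
  congr 2
  ext x
  rw [abs_mul, abs_of_pos ht, Real.mul_rpow ht.le (abs_nonneg _)]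

theorem I_dilate (hpot : IsPotential N p V₀ Vinf K V) (hV₀ : 0 < V₀) (h : IsX u G)
    {t : ℝ} (ht : 0 < t) :
    I p V (dilate t u) = 1 / 2 * (t ^ N * ∫ x, ‖G x‖ ^ 2)
      + 1 / 2 * (t ^ (N + 2) * ∫ x, u x ^ 2 * ‖G x‖ ^ 2)
      + 1 / 2 * (t ^ (N + 2) * ∫ x, V (t • x) * u x ^ 2)
      - 1 / (p + 1) * (t ^ N * t ^ (p + 1) * ∫ x, |u x| ^ (p + 1)) := by
  rw [I_eq hpot hV₀ (h.dilate ht), integral_grad_dilate G ht, integral_mul_dilate u G ht,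
    integral_weight_dilate V u ht, integral_rpow_dilate u _ ht]

theorem J_dilate (hpot : IsPotential N p V₀ Vinf K V) (hV₀ : 0 < V₀) (h : IsX u G)
    {t : ℝ} (ht : 0 < t) :
    J p V (dilate t u) = (N : ℝ) / 2 * (t ^ N * ∫ x, ‖G x‖ ^ 2)
      + ((N : ℝ) + 2) / 2 * (t ^ (N + 2) * ∫ x, u x ^ 2 * ‖G x‖ ^ 2)
      + t ^ (N + 2) * (∫ x, weightJ V (t • x) * u x ^ 2)
      - ((N : ℝ) + p + 1) / (p + 1) * (t ^ N * t ^ (p + 1) * ∫ x, |u x| ^ (p + 1)) := by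
  rw [J_eq hpot hV₀ (h.dilate ht), integral_grad_dilate G ht, integral_mul_dilate u G ht,
    integral_weight_dilate _ u ht, integral_rpow_dilate u _ ht]

/-- `J` is the derivative of `I` along dilations. -/
theorem hasDerivAt_I_dilate (hpot : IsPotential N p V₀ Vinf K V) (hV₀ : 0 < V₀) (hp : 1 < p)
    (h : IsX u G) : HasDerivAt (fun t => I p V (dilate t u)) (J p V u) 1 := by
  have hVd := hpot.contDiff.differentiable one_ne_zero
  have iR : Integrable (fun x => fderiv ℝ V x x * u x ^ 2) volume :=
    h.integrable_weight (continuous_radial hpot.contDiff).measurable hpot.radial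
  have iV : ∀ t : ℝ, Integrable (fun x => V (t • x) * u x ^ 2) volume := fun t =>
    h.integrable_weight (hpot.contDiff.continuous.comp (continuous_const_smul t)).measurable
      (W := Vinf) fun x => by
        rw [abs_of_nonneg (hV₀.le.trans (hpot.lower _))]
        exact hpot.upper _
  have hd : HasDerivAt (fun t : ℝ => ∫ x, V (t • x) * u x ^ 2)
      (∫ x, fderiv ℝ V ((1 : ℝ) • x) x * u x ^ 2) 1 := by
    -- For t > 1/2 the bound |∇V(tx) · tx| ≤ K gives |∇V(tx) · x| ≤ 2K, whence the dominating
    -- function.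
    refine (hasDerivAt_integral_of_dominated_loc_of_deriv_le (μ := volume)
      (F := fun (t : ℝ) x => V (t • x) * u x ^ 2)
      (F' := fun (t : ℝ) x => fderiv ℝ V (t • x) x * u x ^ 2)
      (bound := fun x => 2 * K * u x ^ 2) (s := Metric.ball 1 (1 / 2))
      (Metric.ball_mem_nhds _ (by norm_num)) (Eventually.of_forall fun t =>
        (iV t).aestronglyMeasurable) (iV 1) ?_ ?_ (h.integrable_sq.const_mul _) ?_).2
    · simpa using iR.aestronglyMeasurable
    · refine Eventually.of_forall fun x t ht => ?_
      rw [Metric.mem_ball, Real.dist_eq, abs_lt] at ht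
      have ht0 : 0 < t := by linarith
      have hr := hpot.radial (t • x)
      rw [map_smul, smul_eq_mul, abs_mul, abs_of_pos ht0] at hr
      rw [norm_mul, Real.norm_eq_abs, Real.norm_of_nonneg (sq_nonneg _)]
      refine mul_le_mul_of_nonneg_right ?_ (sq_nonneg _)
      nlinarith [abs_nonneg (fderiv ℝ V (t • x) x)]
    · refine Eventually.of_forall fun x t _ => ?_
      have h1 : HasDerivAt (fun s : ℝ => s • x) x t := by
        simpa using (hasDerivAt_id t).smul_const x
      exact ((hVd _).hasFDerivAt.comp_hasDerivAt t h1).mul_const _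
  have hpow : ∀ k : ℕ, HasDerivAt (fun t : ℝ => t ^ k) (k : ℝ) 1 := fun k => by
    simpa using hasDerivAt_pow k (1 : ℝ)
  have hr : HasDerivAt (fun t : ℝ => t ^ (p + 1)) (p + 1) 1 := by
    simpa using Real.hasDerivAt_rpow_const (x := 1) (p := p + 1) (Or.inl one_ne_zero)
  have hall := (((((hpow N).mul_const (∫ x, ‖G x‖ ^ 2)).const_mul (1 / 2 : ℝ)).add
    (((hpow (N + 2)).mul_const (∫ x, u x ^ 2 * ‖G x‖ ^ 2)).const_mul (1 / 2 : ℝ))).add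
    (((hpow (N + 2)).mul hd).const_mul (1 / 2 : ℝ))).sub
    ((((hpow N).mul hr).mul_const (∫ x, |u x| ^ (p + 1))).const_mul (1 / (p + 1)))
  have hall' := hall.congr_of_eventuallyEq (f₁ := fun t => I p V (dilate t u)) (by
    filter_upwards [eventually_gt_nhds one_pos] with t ht
    exact I_dilate hpot hV₀ h ht)
  refine hall'.congr_deriv ?_
  have e3 : ∫ x, weightJ V x * u x ^ 2
      = ((N : ℝ) + 2) / 2 * (∫ x, V x * u x ^ 2) + 1 / 2 * ∫ x, fderiv ℝ V x x * u x ^ 2 := by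
    have iV1 := iV 1
    simp only [one_smul] at iV1
    rw [← integral_const_mul, ← integral_const_mul,
      ← integral_add (iV1.const_mul _) (iR.const_mul _)]
    refine integral_congr_ae (Eventually.of_forall fun x => ?_)
    simp only [weightJ]
    ring
  rw [J_eq hpot hV₀ h, e3]
  simp only [one_smul, one_pow, Real.one_rpow]
  push_cast
  have : p + 1 ≠ 0 := by positivity
  field_simp
  ring

/-- Concavity along dilations, integrated. -/
theorem I_dilate_le (hN : 3 ≤ N) (hp : 1 < p) (hpc : p + 1 < critExp N)
    (hpot : IsPotential N p V₀ Vinf K V) (hV₀ : 0 < V₀) (h : IsX u G) {t : ℝ} (ht : 0 < t) :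
    I p V (dilate t u)
      ≤ P p V u G + t ^ ((N : ℝ) + p + 1) * (J p V u / ((N : ℝ) + p + 1)) := by
  set q := (N : ℝ) + p + 1
  have hq : 0 < q := by positivity
  -- In this variable every term is concave, and the power term, with t ^ N · t ^ (p + 1) = s, is
  -- linear.
  set s := t ^ q
  have hs : 0 < s := by positivity
  have hst : s ^ (1 / q) = t := by
    rw [← Real.rpow_mul ht.le, mul_one_div_cancel hq.ne', Real.rpow_one]
  have hsk : ∀ k : ℕ, s ^ ((k : ℝ) / q) = t ^ k := fun k => by
    rw [← Real.rpow_mul ht.le, mul_div_cancel₀ _ hq.ne', Real.rpow_natCast]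
  -- Tangent at s = 1 of the concave power s ^ (k / q); it is used for k = N and k = N + 2.
  have hbern : ∀ k : ℕ, (k : ℝ) ≤ q → t ^ k ≤ 1 + (k : ℝ) / q * (s - 1) := fun k hk => by
    rw [← hsk]
    have := rpow_one_add_le_one_add_mul_self (s := s - 1) (by linarith)
      (p := (k : ℝ) / q) (by positivity) ((div_le_one hq).2 hk)
    simpa using this
  have hsD : t ^ N * t ^ (p + 1) = s := by
    rw [← Real.rpow_natCast, ← Real.rpow_add ht, ← add_assoc]
  have iV : Integrable (fun x => V x * u x ^ 2) volume :=
    h.integrable_weight hpot.contDiff.continuous.measurable (W := Vinf) fun x => by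
      rw [abs_of_nonneg (hV₀.le.trans (hpot.lower x))]
      exact hpot.upper x
  have iVt : Integrable (fun x => V (t • x) * u x ^ 2) volume :=
    h.integrable_weight (hpot.contDiff.continuous.comp (continuous_const_smul t)).measurable
      (W := Vinf) fun x => by
        rw [abs_of_nonneg (hV₀.le.trans (hpot.lower _))]
        exact hpot.upper _
  have iJ : Integrable (fun x => weightJ V x * u x ^ 2) volume :=
    h.integrable_weight (continuous_weightJ hpot.contDiff).measurable (hpot.abs_weightJ_le hV₀)
  have hVle : t ^ (N + 2) * ∫ x, V (t • x) * u x ^ 2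
      ≤ (∫ x, V x * u x ^ 2) + 2 / q * (s - 1) * ∫ x, weightJ V x * u x ^ 2 := by
    rw [← integral_const_mul, ← integral_const_mul, ← integral_add iV (iJ.const_mul _)]
    refine integral_mono (iVt.const_mul _) (iV.add (iJ.const_mul _)) fun x => ?_
    have := hpot.tangent hp x hs
    rw [hst] at this
    have e := hsk (N + 2)
    push_cast at e
    rw [e] at this
    have := mul_le_mul_of_nonneg_right this (sq_nonneg (u x))
    calc _ = t ^ (N + 2) * V (t • x) * u x ^ 2 := by ring
      _ ≤ _ := this
      _ = _ := by ring
  have hA : 0 ≤ ∫ x, ‖G x‖ ^ 2 := integral_nonneg fun x => by positivity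
  have hB : 0 ≤ ∫ x, u x ^ 2 * ‖G x‖ ^ 2 := integral_nonneg fun x => by positivity
  have b1 := mul_le_mul_of_nonneg_right (hbern N (by simp only [q]; linarith)) hA
  have b2 := mul_le_mul_of_nonneg_right
    (hbern (N + 2) (by simp only [q]; push_cast; linarith)) hB
  push_cast at b2
  have hPI := I_eq_P_add hN hp hpc hpot hV₀ h
  have eP : P p V u G = I p V u - J p V u / q := by linarith
  rw [eP, I_dilate hpot hV₀ h ht, hsD, I_eq hpot hV₀ h, J_eq hpot hV₀ h]
  have hp1 : 0 < p + 1 := by linarith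
  generalize (∫ x, ‖G x‖ ^ 2) = A at *
  generalize (∫ x, u x ^ 2 * ‖G x‖ ^ 2) = B at *
  generalize (∫ x, V x * u x ^ 2) = C at *
  generalize (∫ x, V (t • x) * u x ^ 2) = C' at *
  generalize (∫ x, weightJ V x * u x ^ 2) = L at *
  generalize (∫ x, |u x| ^ (p + 1)) = D at *
  have key : 1 / 2 * A + 1 / 2 * B + 1 / 2 * C - 1 / (p + 1) * D
      - ((N : ℝ) / 2 * A + ((N : ℝ) + 2) / 2 * B + L - q / (p + 1) * D) / q
      + s * (((N : ℝ) / 2 * A + ((N : ℝ) + 2) / 2 * B + L - q / (p + 1) * D) / q)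
      = 1 / 2 * ((1 + (N : ℝ) / q * (s - 1)) * A)
        + 1 / 2 * ((1 + ((N : ℝ) + 2) / q * (s - 1)) * B)
        + 1 / 2 * (C + 2 / q * (s - 1) * L) - 1 / (p + 1) * (s * D) := by
    field_simp
    ring
  rw [key]
  linarith

end

/-! ### The constraint set and the infimum `m` -/

theorem IsX.integral_sq_pos {u : E N → ℝ} {G : E N → E N} (h : IsX u G)
    (hu : ¬ (u =ᵐ[volume] 0)) : 0 < ∫ x, u x ^ 2 := by
  refine lt_of_le_of_ne (integral_nonneg fun x => sq_nonneg _) fun h0 => hu ?_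
  have := (integral_eq_zero_iff_of_nonneg (fun x => sq_nonneg (u x)) h.integrable_sq).1 h0.symm
  filter_upwards [this] with x hx
  simpa using hx

theorem IsX.integral_rpow_pos (hN : 3 ≤ N) {u : E N → ℝ} {G : E N → E N} (h : IsX u G)
    (hu : ¬ (u =ᵐ[volume] 0)) {a : ℝ} (ha : 2 ≤ a) (har : a ≤ critExp N) :
    0 < ∫ x, |u x| ^ a := by
  have hnn : ∀ x, 0 ≤ |u x| ^ a := fun x => by positivity
  refine lt_of_le_of_ne (integral_nonneg hnn) fun h0 => hu ?_
  have := (integral_eq_zero_iff_of_nonneg hnn (h.integrable_rpow hN ha har)).1 h0.symm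
  filter_upwards [this] with x hx
  simpa using (Real.rpow_eq_zero (abs_nonneg _) (by linarith)).1 hx

theorem IsX.dilate_ne_zero {u : E N → ℝ} {G : E N → E N} (h : IsX u G)
    (hu : ¬ (u =ᵐ[volume] 0)) {t : ℝ} (ht : 0 < t) : ¬ (ModNLS.dilate t u =ᵐ[volume] 0) := by
  intro h0
  have h1 := integral_weight_dilate (fun _ => 1) u ht
  have h2 : ∫ x, (1 : ℝ) * ModNLS.dilate t u x ^ 2 = 0 :=
    integral_eq_zero_of_ae (h0.mono fun x hx => by simp [hx])
  have h3 := h.integral_sq_pos hu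
  simp only [one_mul] at h1 h2
  rw [h2] at h1
  have : 0 < t ^ (N + 2) * ∫ x, u x ^ 2 := by positivity
  linarith

theorem isX_of_contDiff {u : E N → ℝ} {G : E N → E N} (hu : ContDiff ℝ 1 u)
    (hc : HasCompactSupport u) (hG : Continuous G) (hGc : HasCompactSupport G)
    (h : ∀ x v, fderiv ℝ u x v = inner ℝ (G x) v) : IsX u G := by
  have h1 : Continuous fun x => u x • G x := hu.continuous.smul hG
  have h2 : HasCompactSupport fun x => u x • G x :=
    hc.mono fun x hx h0 => hx (by simp only [h0, zero_smul])
  have h3 : Continuous fun x => u x ^ 2 := hu.continuous.pow 2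
  have h4 : HasCompactSupport fun x => u x ^ 2 :=
    hc.comp_left (g := fun s : ℝ => s ^ 2) (by norm_num)
  exact ⟨hasWeakGradient_of_contDiff hu hG h, hu.continuous.memLp_of_hasCompactSupport hc,
    hG.memLp_of_hasCompactSupport hGc, h1.memLp_of_hasCompactSupport h2,
    h3.memLp_of_hasCompactSupport h4⟩

theorem exists_contDiff_eq_one (N : ℕ) :
    ∃ u : E N → ℝ, ContDiff ℝ 1 u ∧ HasCompactSupport u ∧ u 0 = 1 :=
  ⟨unitBump N, (unitBump N).contDiff, (unitBump N).hasCompactSupport,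
    (unitBump N).one_of_mem_closedBall (Metric.mem_closedBall_self zero_le_one)⟩

theorem exists_isX_ne_zero (N : ℕ) : ∃ (u : E N → ℝ) (G : E N → E N), IsX u G ∧
    ¬ (u =ᵐ[volume] 0) := by
  obtain ⟨u, hu, hc, hu0⟩ := exists_contDiff_eq_one N
  have hG : Continuous (gradient u) :=
    (InnerProductSpace.toDual ℝ (E N)).symm.continuous.comp (hu.continuous_fderiv one_ne_zero)
  have hGc : HasCompactSupport (gradient u) :=
    (hc.fderiv ℝ).comp_left (g := (InnerProductSpace.toDual ℝ (E N)).symm) (map_zero _)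
  refine ⟨u, gradient u, isX_of_contDiff hu hc hG hGc fun x v => ?_, fun h0 => ?_⟩
  · rw [gradient, InnerProductSpace.toDual_symm_apply]
  · have h1 := (hu.continuous.ae_eq_iff_eq volume continuous_zero).1 h0
    simp [h1] at hu0

section

variable {p V₀ Vinf K : ℝ} {V : E N → ℝ}

/-- Every dilation orbit meets the constraint set. -/
theorem exists_J_dilate_eq_zero (hN : 3 ≤ N) (hp : 1 < p) (hpc : p + 1 < critExp N)
    (hV₀ : 0 < V₀) (hle : V₀ ≤ Vinf) (hpot : IsPotential N p V₀ Vinf K V)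
    {u : E N → ℝ} {G : E N → E N} (h : IsX u G) (hu : ¬ (u =ᵐ[volume] 0)) :
    ∃ t, 0 < t ∧ J p V (dilate t u) = 0 := by
  obtain ⟨c, hc, hcl⟩ := exists_weightJ_lower N hp hV₀ hle
  have hcl := hcl K V hpot
  have hC := h.integral_sq_pos hu
  have hD := h.integral_rpow_pos hN hu (a := p + 1) (by linarith) hpc.le
  have hA : 0 ≤ ∫ x, ‖G x‖ ^ 2 := integral_nonneg fun x => by positivity
  have hB : 0 ≤ ∫ x, u x ^ 2 * ‖G x‖ ^ 2 := integral_nonneg fun x => by positivity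
  set κ := ((N : ℝ) + p + 1) / (p + 1)
  have hκ : 0 < κ := by positivity
  set W := (((N : ℝ) + 2) * Vinf + K) / 2
  have hWle : ∀ x, weightJ V x ≤ W := fun x => (abs_le.1 (hpot.abs_weightJ_le hV₀ x)).2
  have hW : 0 < W := hc.trans_le ((hcl 0).trans (hWle 0))
  have iJ : ∀ t : ℝ, Integrable (fun x => weightJ V (t • x) * u x ^ 2) volume := fun t =>
    h.integrable_weight ((continuous_weightJ hpot.contDiff).comp
      (continuous_const_smul t)).measurable fun x => hpot.abs_weightJ_le hV₀ _
  have hJc : Continuous fun t : ℝ => ∫ x, weightJ V (t • x) * u x ^ 2 := by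
    refine continuous_of_dominated (bound := fun x => W * u x ^ 2)
      (fun t => (iJ t).aestronglyMeasurable) (fun t => Eventually.of_forall fun x => ?_)
      (h.integrable_sq.const_mul _) (Eventually.of_forall fun x => ?_)
    · rw [norm_mul, Real.norm_of_nonneg (sq_nonneg (u x))]
      exact mul_le_mul_of_nonneg_right (hpot.abs_weightJ_le hV₀ _) (sq_nonneg _)
    · exact ((continuous_weightJ hpot.contDiff).comp
        (continuous_id.smul continuous_const)).mul continuous_const
  have hJl : ∀ t : ℝ, c * ∫ x, u x ^ 2 ≤ ∫ x, weightJ V (t • x) * u x ^ 2 := fun t => by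
    rw [← integral_const_mul]
    exact integral_mono (h.integrable_sq.const_mul _) (iJ t) fun x =>
      mul_le_mul_of_nonneg_right (hcl _) (sq_nonneg _)
  have hJu : ∀ t : ℝ, ∫ x, weightJ V (t • x) * u x ^ 2 ≤ W * ∫ x, u x ^ 2 := fun t => by
    rw [← integral_const_mul]
    exact integral_mono (iJ t) (h.integrable_sq.const_mul _) fun x =>
      mul_le_mul_of_nonneg_right (hWle _) (sq_nonneg _)
  have hform := fun (t : ℝ) (ht : 0 < t) => J_dilate (p := p) hpot hV₀ h ht
  generalize (∫ x, ‖G x‖ ^ 2) = A at *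
  generalize (∫ x, u x ^ 2 * ‖G x‖ ^ 2) = B at *
  generalize (∫ x, u x ^ 2) = C at *
  generalize (∫ x, |u x| ^ (p + 1)) = D at *
  generalize hL : (fun t : ℝ => ∫ x, weightJ V (t • x) * u x ^ 2) = L at *
  replace hJl : ∀ t, c * C ≤ L t := fun t => by rw [← hL]; exact hJl t
  replace hJu : ∀ t, L t ≤ W * C := fun t => by rw [← hL]; exact hJu t
  have hform' : ∀ t, 0 < t → J p V (dilate t u) = (N : ℝ) / 2 * (t ^ N * A)
      + ((N : ℝ) + 2) / 2 * (t ^ (N + 2) * B) + t ^ (N + 2) * L t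
      - κ * (t ^ N * t ^ (p + 1) * D) := fun t ht => by rw [← hL]; exact hform t ht
  -- After t ^ (N + 2) is factored out, the power term keeps t ^ (p - 1): negligible for small t and
  -- dominant for large t.
  have hsplit : ∀ t : ℝ, 0 < t → t ^ N * t ^ (p + 1) = t ^ (N + 2) * t ^ (p - 1) := fun t ht => by
    rw [pow_add, mul_assoc, ← Real.rpow_two, ← Real.rpow_add ht]
    ring_nf
  set F : ℝ → ℝ := fun t => (N : ℝ) / 2 * (t ^ N * A)
      + ((N : ℝ) + 2) / 2 * (t ^ (N + 2) * B) + t ^ (N + 2) * L t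
      - κ * (t ^ N * t ^ (p + 1) * D)
  have hFc : Continuous F := by
    have := Real.continuous_rpow_const (q := p + 1) (by linarith)
    fun_prop
  have hp1 : 0 < p - 1 := by linarith
  have hroot : ∀ s : ℝ, 0 < s → (s ^ (1 / (p - 1))) ^ (p - 1) = s := fun s hs => by
    rw [← Real.rpow_mul hs.le, one_div_mul_cancel hp1.ne', Real.rpow_one]
  -- At `t₁` the power term is exactly half of the lower bound `c * C` for the weight term.
  set s₁ := c * C / (2 * κ * D)
  set t₁ := s₁ ^ (1 / (p - 1))
  have hs₁ : 0 < s₁ := by positivity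
  have ht₁ : 0 < t₁ := by positivity
  have hF₁ : 0 ≤ F t₁ := by
    have e : κ * (t₁ ^ N * t₁ ^ (p + 1) * D) = t₁ ^ (N + 2) * (c * C / 2) := by
      rw [hsplit t₁ ht₁, hroot s₁ hs₁]
      simp only [s₁]
      field_simp
    have h1 : t₁ ^ (N + 2) * (c * C / 2) ≤ t₁ ^ (N + 2) * L t₁ :=
      mul_le_mul_of_nonneg_left (by linarith [hJl t₁, mul_pos hc hC]) (by positivity)
    have h2 : 0 ≤ (N : ℝ) / 2 * (t₁ ^ N * A) := by positivity
    have h3 : 0 ≤ ((N : ℝ) + 2) / 2 * (t₁ ^ (N + 2) * B) := by positivity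
    simp only [F, e]
    linarith
  set Z := (N : ℝ) / 2 * A + ((N : ℝ) + 2) / 2 * B + W * C
  have hZ : 0 ≤ Z := by positivity
  -- At `t₂` the power term exceeds all positive terms together. The summand 1 ensures t₂ ≥ 1, so
  -- that t₂ ^ N can be replaced by t₂ ^ (N + 2).
  set s₂ := 1 + Z / (κ * D)
  have hs₂ : 1 ≤ s₂ := by
    have : 0 ≤ Z / (κ * D) := by positivity
    linarith
  set t₂ := s₂ ^ (1 / (p - 1))
  have ht₂ : 1 ≤ t₂ := Real.one_le_rpow hs₂ (by positivity)
  have hF₂ : F t₂ ≤ 0 := by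
    have e : κ * (t₂ ^ N * t₂ ^ (p + 1) * D) = t₂ ^ (N + 2) * (κ * D + Z) := by
      rw [hsplit t₂ (by linarith), hroot s₂ (by linarith)]
      simp only [s₂]
      field_simp
    have h0 : t₂ ^ N * A ≤ t₂ ^ (N + 2) * A :=
      mul_le_mul_of_nonneg_right (pow_le_pow_right₀ ht₂ (by omega)) hA
    have h1 : t₂ ^ (N + 2) * L t₂ ≤ t₂ ^ (N + 2) * (W * C) :=
      mul_le_mul_of_nonneg_left (hJu t₂) (by positivity)
    have h2 : (N : ℝ) / 2 * (t₂ ^ N * A) ≤ (N : ℝ) / 2 * (t₂ ^ (N + 2) * A) :=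
      mul_le_mul_of_nonneg_left h0 (by positivity)
    have h3 : 0 ≤ t₂ ^ (N + 2) * (κ * D) := by positivity
    have h4 : t₂ ^ (N + 2) * Z = (N : ℝ) / 2 * (t₂ ^ (N + 2) * A)
        + ((N : ℝ) + 2) / 2 * (t₂ ^ (N + 2) * B) + t₂ ^ (N + 2) * (W * C) := by
      simp only [Z]; ring
    simp only [F, e]
    linarith
  obtain ⟨t, ht, hFt⟩ := isPreconnected_Ioi.intermediate_value (s := Ioi (0 : ℝ))
    (show t₂ ∈ Ioi (0 : ℝ) from by simp only [mem_Ioi]; linarith) ht₁ hFc.continuousOn ⟨hF₂, hF₁⟩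
  exact ⟨t, ht, (hform' t ht).trans hFt⟩

/-- Functions with `J ≤ 0` stay away from zero. -/
theorem exists_lower_of_J_nonpos (hN : 3 ≤ N) (hp : 1 < p) (hpc : p + 1 < critExp N)
    (hV₀ : 0 < V₀) (hle : V₀ ≤ Vinf) (hpot : IsPotential N p V₀ Vinf K V) :
    ∃ b d : ℝ, 0 < b ∧ 0 < d ∧ ∀ (u : E N → ℝ) (G : E N → E N), IsX u G →
      ¬ (u =ᵐ[volume] 0) → J p V u ≤ 0 →
      b ≤ ∫ x, u x ^ 2 * ‖G x‖ ^ 2 ∧ d ≤ ∫ x, |u x| ^ (p + 1) := by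
  obtain ⟨c, hc, hcl⟩ := exists_weightJ_lower N hp hV₀ hle
  have hcl := hcl K V hpot
  have hN' : (3 : ℝ) ≤ N := by exact_mod_cast hN
  obtain ⟨S, hS, hSob⟩ := exists_integral_crit_le hN
  set κ := ((N : ℝ) + p + 1) / (p + 1)
  have hκ : 0 < κ := by positivity
  -- With η = c / κ the quadratic part of the power integral is absorbed exactly by the weight term
  -- of J; taking q = r leaves only the critical power.
  obtain ⟨C, hC, hint⟩ := exists_rpow_interpolation (a := p + 1) (r := critExp N) (q := critExp N)
    (η := c / κ) (by linarith) hpc (by positivity)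
  set θ := (N : ℝ) / (N - 2)
  have hθ : 0 < θ - 1 := by
    have : 1 < θ := by rw [one_lt_div (by linarith)]; linarith
    linarith
  set L := κ * ((c / κ + C) * S)
  have hL : 0 ≤ L := by positivity
  -- J ≤ 0 reduces to B (N + 2) / 2 ≤ L B ^ θ with θ > 1, which bounds a positive `B` from below; L
  -- + 1 in place of L avoids a vanishing denominator.
  set b := (((N : ℝ) + 2) / (2 * (L + 1))) ^ (1 / (θ - 1))
  have hb : 0 < b := by positivity
  refine ⟨b, ((N : ℝ) + 2) / 2 * b / κ, hb, by positivity, fun u G h hu hJ => ?_⟩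
  obtain ⟨iR, hR⟩ := hSob u G h
  have hRpos := h.integral_rpow_pos hN hu (a := critExp N) (by linarith) le_rfl
  have iD := h.integrable_rpow hN (a := p + 1) (by linarith) hpc.le
  have iJ : Integrable (fun x => weightJ V x * u x ^ 2) volume :=
    h.integrable_weight (continuous_weightJ hpot.contDiff).measurable (hpot.abs_weightJ_le hV₀)
  have hJl : c * ∫ x, u x ^ 2 ≤ ∫ x, weightJ V x * u x ^ 2 := by
    rw [← integral_const_mul]
    exact integral_mono (h.integrable_sq.const_mul _) iJ fun x =>
      mul_le_mul_of_nonneg_right (hcl _) (sq_nonneg _)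
  have hDle : ∫ x, |u x| ^ (p + 1) ≤ c / κ * ((∫ x, u x ^ 2) + ∫ x, |u x| ^ critExp N)
      + C * ∫ x, |u x| ^ critExp N := by
    have i1 : Integrable (fun x => c / κ * (u x ^ 2 + |u x| ^ critExp N)) volume :=
      (h.integrable_sq.add iR).const_mul _
    rw [← integral_add h.integrable_sq iR, ← integral_const_mul, ← integral_const_mul,
      ← integral_add i1 (iR.const_mul _)]
    refine integral_mono iD (i1.add (iR.const_mul _)) fun x => ?_
    have := hint |u x| (abs_nonneg _)
    rwa [sq_abs] at this
  have hA : 0 ≤ ∫ x, ‖G x‖ ^ 2 := integral_nonneg fun x => by positivity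
  have hB : 0 ≤ ∫ x, u x ^ 2 * ‖G x‖ ^ 2 := integral_nonneg fun x => by positivity
  have hC2 := h.integral_sq_pos hu
  rw [J_eq hpot hV₀ h] at hJ
  generalize (∫ x, ‖G x‖ ^ 2) = A at *
  generalize (∫ x, u x ^ 2 * ‖G x‖ ^ 2) = B at *
  generalize (∫ x, u x ^ 2) = C₂ at *
  generalize (∫ x, |u x| ^ (p + 1)) = D at *
  generalize (∫ x, weightJ V x * u x ^ 2) = Q at *
  generalize (∫ x, |u x| ^ critExp N) = R at *
  have hNA : 0 ≤ (N : ℝ) / 2 * A := by positivity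
  have h1 : ((N : ℝ) + 2) / 2 * B + c * C₂ ≤ κ * D := by linarith
  -- If `B` were 0, Sobolev would make the critical integral vanish, although u ≠ 0.
  have hBpos : 0 < B := by
    refine lt_of_le_of_ne hB fun h0 => ?_
    rw [← h0, Real.zero_rpow (by linarith), mul_zero] at hR
    linarith
  have h2 : ((N : ℝ) + 2) / 2 * B ≤ L * B ^ θ := by
    have e1 := mul_le_mul_of_nonneg_left hDle hκ.le
    have e2 : κ * (c / κ * (C₂ + R) + C * R) = c * C₂ + κ * ((c / κ + C) * R) := by
      field_simp
      ring
    have e3 : κ * ((c / κ + C) * R) ≤ κ * ((c / κ + C) * (S * B ^ θ)) := by gcongr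
    have e4 : κ * ((c / κ + C) * (S * B ^ θ)) = L * B ^ θ := by simp only [L]; ring
    linarith
  have hbB : b ≤ B := by
    by_contra! hlt
    have e1 : B ^ (θ - 1) < ((N : ℝ) + 2) / (2 * (L + 1)) := by
      have := Real.rpow_lt_rpow hB hlt hθ
      rwa [← Real.rpow_mul (by positivity), one_div_mul_cancel hθ.ne', Real.rpow_one] at this
    have e2 : B ^ θ = B * B ^ (θ - 1) := by
      rw [← Real.rpow_one_add' hB (by linarith)]
      ring_nf
    rw [lt_div_iff₀ (by positivity)] at e1
    have e3 : 0 < B ^ (θ - 1) := by positivity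
    rw [e2] at h2
    have e4 : ((N : ℝ) + 2) / 2 ≤ L * B ^ (θ - 1) :=
      le_of_mul_le_mul_right (by linarith) hBpos
    linarith
  refine ⟨hbB, ?_⟩
  rw [div_le_iff₀ hκ]
  have : ((N : ℝ) + 2) / 2 * b ≤ ((N : ℝ) + 2) / 2 * B :=
    mul_le_mul_of_nonneg_left hbB (by positivity)
  linarith [mul_pos hc hC2]

/-- Lower bound for `P`. -/
theorem exists_P_lower (hN : 3 ≤ N) (hp : 1 < p) (hpc : p + 1 < critExp N)
    (hV₀ : 0 < V₀) (hle : V₀ ≤ Vinf) (hpot : IsPotential N p V₀ Vinf K V) :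
    ∃ c, 0 < c ∧ ∀ (u : E N → ℝ) (G : E N → E N), IsX u G →
      c * ((∫ x, ‖G x‖ ^ 2) + (∫ x, u x ^ 2 * ‖G x‖ ^ 2) + ∫ x, u x ^ 2) ≤ P p V u G := by
  have hK : 0 ≤ K := (abs_nonneg _).trans (hpot.radial 0)
  obtain ⟨c, hc, hcl⟩ := exists_weightP_lower N hp hV₀ hle hK
  have hcl := hcl V hpot
  set c₁ := (p + 1) / (2 * ((N : ℝ) + p + 1))
  set c₂ := (p - 1) / (2 * ((N : ℝ) + p + 1))
  have hc₁ : 0 < c₁ := by positivity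
  have hc₂ : 0 < c₂ := div_pos (by linarith) (by positivity)
  refine ⟨min c (min c₁ c₂), by positivity, fun u G h => ?_⟩
  have iP : Integrable (fun x => weightP p V x * u x ^ 2) volume :=
    h.integrable_weight (continuous_weightP hpot.contDiff).measurable (hpot.abs_weightP_le hp hV₀)
  have hPl : c * ∫ x, u x ^ 2 ≤ ∫ x, weightP p V x * u x ^ 2 := by
    rw [← integral_const_mul]
    exact integral_mono (h.integrable_sq.const_mul _) iP fun x =>
      mul_le_mul_of_nonneg_right (hcl _) (sq_nonneg _)
  have hA : 0 ≤ ∫ x, ‖G x‖ ^ 2 := integral_nonneg fun x => by positivity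
  have hB : 0 ≤ ∫ x, u x ^ 2 * ‖G x‖ ^ 2 := integral_nonneg fun x => by positivity
  have hC : 0 ≤ ∫ x, u x ^ 2 := integral_nonneg fun x => by positivity
  rw [P_eq hN hp hpc hpot hV₀ h]
  have m1 : min c (min c₁ c₂) ≤ c := min_le_left _ _
  have m2 : min c (min c₁ c₂) ≤ c₁ := (min_le_right _ _).trans (min_le_left _ _)
  have m3 : min c (min c₁ c₂) ≤ c₂ := (min_le_right _ _).trans (min_le_right _ _)
  have := mul_le_mul_of_nonneg_right m1 hC
  have := mul_le_mul_of_nonneg_right m2 hA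
  have := mul_le_mul_of_nonneg_right m3 hB
  linarith

theorem P_nonneg (hN : 3 ≤ N) (hp : 1 < p) (hpc : p + 1 < critExp N)
    (hV₀ : 0 < V₀) (hle : V₀ ≤ Vinf) (hpot : IsPotential N p V₀ Vinf K V)
    {u : E N → ℝ} {G : E N → E N} (h : IsX u G) : 0 ≤ P p V u G := by
  obtain ⟨c, hc, hP⟩ := exists_P_lower hN hp hpc hV₀ hle hpot
  refine le_trans (mul_nonneg hc.le (add_nonneg (add_nonneg ?_ ?_) ?_)) (hP u G h) <;>
  exact integral_nonneg fun x => by positivity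

theorem IsX.dilate_mem_M {u : E N → ℝ} {G : E N → E N} (h : IsX u G)
    (hu : ¬ (u =ᵐ[volume] 0)) {t : ℝ} (ht : 0 < t) (hJ : J p V (ModNLS.dilate t u) = 0) :
    ModNLS.dilate t u ∈ M p V :=
  ⟨(h.dilate ht).mem, h.dilate_ne_zero hu ht, hJ⟩

theorem bddBelow_I_image (hN : 3 ≤ N) (hp : 1 < p) (hpc : p + 1 < critExp N)
    (hV₀ : 0 < V₀) (hle : V₀ ≤ Vinf) (hpot : IsPotential N p V₀ Vinf K V) :
    BddBelow (I p V '' M p V) := by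
  refine ⟨0, ?_⟩
  rintro _ ⟨u, ⟨huX, -, hJ⟩, rfl⟩
  obtain ⟨G, h⟩ := exists_isX_of_mem huX
  rw [I_eq_P_add hN hp hpc hpot hV₀ h, hJ, zero_div, add_zero]
  exact P_nonneg hN hp hpc hV₀ hle hpot h

theorem M_nonempty (hN : 3 ≤ N) (hp : 1 < p) (hpc : p + 1 < critExp N)
    (hV₀ : 0 < V₀) (hle : V₀ ≤ Vinf) (hpot : IsPotential N p V₀ Vinf K V) :
    (M p V).Nonempty := by
  obtain ⟨u, G, h, hu⟩ := exists_isX_ne_zero N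
  obtain ⟨t, ht, hJ⟩ := exists_J_dilate_eq_zero hN hp hpc hV₀ hle hpot h hu
  exact ⟨_, h.dilate_mem_M hu ht hJ⟩

/-- The orbit of `u` is followed to the constraint set; since J(u) ≤ 0, the linear term of the
tangent inequality only helps. This is what allows competitors that merely satisfy J ≤ 0. -/
theorem m_le_P (hN : 3 ≤ N) (hp : 1 < p) (hpc : p + 1 < critExp N)
    (hV₀ : 0 < V₀) (hle : V₀ ≤ Vinf) (hpot : IsPotential N p V₀ Vinf K V)
    {u : E N → ℝ} {G : E N → E N} (h : IsX u G) (hu : ¬ (u =ᵐ[volume] 0)) (hJ : J p V u ≤ 0) :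
    m p V ≤ P p V u G := by
  obtain ⟨t, ht, hJt⟩ := exists_J_dilate_eq_zero hN hp hpc hV₀ hle hpot h hu
  refine (csInf_le (bddBelow_I_image hN hp hpc hV₀ hle hpot)
    ⟨_, h.dilate_mem_M hu ht hJt, rfl⟩).trans ((I_dilate_le hN hp hpc hpot hV₀ h ht).trans ?_)
  have h1 : t ^ ((N : ℝ) + p + 1) * (J p V u / ((N : ℝ) + p + 1)) ≤ 0 :=
    mul_nonpos_of_nonneg_of_nonpos (by positivity)
      (div_nonpos_of_nonpos_of_nonneg hJ (by positivity))
  linarith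

theorem m_pos (hN : 3 ≤ N) (hp : 1 < p) (hpc : p + 1 < critExp N)
    (hV₀ : 0 < V₀) (hle : V₀ ≤ Vinf) (hpot : IsPotential N p V₀ Vinf K V) : 0 < m p V := by
  obtain ⟨c, hc, hP⟩ := exists_P_lower hN hp hpc hV₀ hle hpot
  obtain ⟨b, d, hb, -, hlow⟩ := exists_lower_of_J_nonpos hN hp hpc hV₀ hle hpot
  refine (mul_pos hc hb).trans_le
    (le_csInf ((M_nonempty hN hp hpc hV₀ hle hpot).image _) ?_)
  rintro _ ⟨u, ⟨huX, hu, hJ⟩, rfl⟩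
  obtain ⟨G, h⟩ := exists_isX_of_mem huX
  rw [I_eq_P_add hN hp hpc hpot hV₀ h, hJ, zero_div, add_zero]
  refine le_trans (mul_le_mul_of_nonneg_left ?_ hc.le) (hP u G h)
  have h1 := (hlow u G h hu hJ.le).1
  have h2 : 0 ≤ ∫ x, ‖G x‖ ^ 2 := integral_nonneg fun x => by positivity
  have h3 : 0 ≤ ∫ x, u x ^ 2 := integral_nonneg fun x => by positivity
  linarith

end

/-! ### Minimizing sequences and attainment -/

theorem setIntegral_ball_translate (f : E N → ℝ) (y : E N) (r : ℝ) :
    ∫ x in Metric.ball 0 r, f (x + y) = ∫ x in Metric.ball y r, f x := by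
  have h := (measurePreserving_add_right (volume : Measure (E N)) y).setIntegral_preimage_emb
    (Homeomorph.addRight y).measurableEmbedding f (Metric.ball y r)
  rw [← h]
  congr 2
  ext x
  simp

theorem integral_dens_translate (c₁ c₂ κ p : ℝ) (w u : E N → ℝ) (G : E N → E N) (z : E N) :
    ∫ x, dens c₁ c₂ κ p (fun x => w (x + z)) (fun x => u (x + z)) (fun x => G (x + z)) x
      = ∫ x, dens c₁ c₂ κ p w u G x :=
  integral_add_right_eq_self (μ := volume) (dens c₁ c₂ κ p w u G) z

theorem IsX.translate_ne_zero {u : E N → ℝ} {G : E N → E N} (h : IsX u G)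
    (hu : ¬ (u =ᵐ[volume] 0)) (z : E N) : ¬ ((fun x => u (x + z)) =ᵐ[volume] 0) := by
  intro h0
  have h1 := integral_add_right_eq_self (μ := volume) (fun x => u x ^ 2) z
  have h2 : ∫ x, u (x + z) ^ 2 = 0 :=
    integral_eq_zero_of_ae (h0.mono fun x hx => by
      simp only [Pi.zero_apply] at hx
      simp [hx])
  have h3 := h.integral_sq_pos hu
  linarith

section

variable {p V₀ Vinf K : ℝ} {V : E N → ℝ}

/-- A minimizing sequence with uniform energy bounds and a uniform local mass. -/
theorem exists_minimizing_seq (hN : 3 ≤ N) (hp : 1 < p) (hpc : p + 1 < critExp N)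
    (hV₀ : 0 < V₀) (hle : V₀ ≤ Vinf) (hpot : IsPotential N p V₀ Vinf K V) :
    ∃ (u : ℕ → E N → ℝ) (G : ℕ → E N → E N) (y : ℕ → E N) (E₀ δ : ℝ), 0 < δ ∧
      (∀ n, IsX (u n) (G n)) ∧ (∀ n, J p V (u n) = 0) ∧
      Tendsto (fun n => P p V (u n) (G n)) atTop (𝓝 (m p V)) ∧
      (∀ n, ∫ x, energyDensity (u n) (G n) x ≤ E₀) ∧
      ∀ n, δ ≤ ∫ x in Metric.ball (y n) 2, u n x ^ 2 := by
  -- The values are taken antitone, so the first one bounds them all and coercivity gives a single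
  -- energy bound.
  obtain ⟨s, hs_anti, hs_lim, hs_mem⟩ := exists_seq_tendsto_sInf
    ((M_nonempty hN hp hpc hV₀ hle hpot).image (I p V))
    (bddBelow_I_image hN hp hpc hV₀ hle hpot)
  choose u huM hus using hs_mem
  choose G hG using fun n => exists_isX_of_mem (huM n).1
  have hPI : ∀ n, P p V (u n) (G n) = s n := fun n => by
    have := I_eq_P_add hN hp hpc hpot hV₀ (hG n)
    rw [(huM n).2.2, zero_div, add_zero, hus] at this
    exact this.symm
  obtain ⟨c, hc, hPl⟩ := exists_P_lower hN hp hpc hV₀ hle hpot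
  obtain ⟨b, d, -, hd, hlow⟩ := exists_lower_of_J_nonpos hN hp hpc hV₀ hle hpot
  have hs0 : 0 ≤ s 0 := hPI 0 ▸ P_nonneg hN hp hpc hV₀ hle hpot (hG 0)
  obtain ⟨E₀, hE₀, hE⟩ := exists_energy_le hN (E₁ := s 0 / c) (by positivity)
  have hen : ∀ n, ∫ x, energyDensity (u n) (G n) x ≤ E₀ := fun n => by
    have h0 : c * _ ≤ s 0 := (hPl (u n) (G n) (hG n)).trans
      ((hPI n).le.trans (hs_anti (Nat.zero_le n)))
    rw [mul_comm, ← le_div_iff₀ hc] at h0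
    have hA : 0 ≤ ∫ x, ‖G n x‖ ^ 2 := integral_nonneg fun x => by positivity
    have hB : 0 ≤ ∫ x, u n x ^ 2 * ‖G n x‖ ^ 2 := integral_nonneg fun x => by positivity
    have hC : 0 ≤ ∫ x, u n x ^ 2 := integral_nonneg fun x => by positivity
    exact hE _ _ (hG n) (by linarith) (by linarith) (by linarith)
  obtain ⟨δ, hδ, hmass⟩ := exists_local_mass hN (a := p + 1) (by linarith) hpc hd hE₀
  choose y hy using fun n => hmass (u n) (G n) (hG n) (hen n)
    (hlow (u n) (G n) (hG n) (huM n).2.1 (huM n).2.2.le).2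
  refine ⟨u, G, y, E₀, δ, hδ, hG, fun n => (huM n).2.2, ?_, hen, hy⟩
  simp only [hPI]
  exact hs_lim

/-- The weak limit of a minimizing sequence, possibly after a translation to infinity, in which
case the potential is replaced by its limit. -/
theorem exists_limit_potential (hN : 3 ≤ N) (hp : 1 < p) (hpc : p + 1 < critExp N)
    (hV₀ : 0 < V₀) (hle : V₀ ≤ Vinf) (hpot : IsPotential N p V₀ Vinf K V)
    (hlim : Tendsto V (cocompact (E N)) (𝓝 Vinf)) :
    ∃ (V' : E N → ℝ) (v : E N → ℝ) (G : E N → E N), IsPotential N p V₀ Vinf K V' ∧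
      (∀ x, V x ≤ V' x) ∧ IsX v G ∧ ¬ (v =ᵐ[volume] 0) ∧ J p V' v ≤ 0 ∧
      P p V' v G ≤ m p V := by
  have hK : 0 ≤ K := (abs_nonneg _).trans (hpot.radial 0)
  have hVi : 0 < Vinf := hV₀.trans_le hle
  obtain ⟨u, G, y, E₀, δ, hδ, hX, hJ, hP, hE, hmass⟩ :=
    exists_minimizing_seq hN hp hpc hV₀ hle hpot
  obtain ⟨c, hc, hcl⟩ := exists_weightP_lower N hp hV₀ hle hK
  set W := Vinf + ((N + 2) * Vinf + K) / 2
  have hWJ : ∀ V', IsPotential N p V₀ Vinf K V' → ∀ x, |weightJ V' x| ≤ W := fun V' h x =>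
    (h.abs_weightJ_le hV₀ x).trans (by simp only [W]; linarith)
  have hWP : ∀ V', IsPotential N p V₀ Vinf K V' → ∀ x, |weightP p V' x| ≤ W := fun V' h x =>
    h.abs_weightP_le hp hV₀ x
  have hc₂ : 0 ≤ (p - 1) / (2 * ((N : ℝ) + p + 1)) :=
    div_nonneg (by linarith) (by positivity)
  have hJm := (continuous_weightJ hpot.contDiff).measurable
  have hPm := (continuous_weightP (p := p) hpot.contDiff).measurable
  have hmin : ∀ u H, IsX u H → ¬ (u =ᵐ[volume] 0) →
      ∫ x, dens ((N : ℝ) / 2) (((N : ℝ) + 2) / 2) (((N : ℝ) + p + 1) / (p + 1)) p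
        (weightJ V) u H x ≤ 0 → m p V ≤ P p V u H := fun u H h hu hJu => by
    rw [integral_dens_weightJ hN hp hpc hpot hV₀ h] at hJu
    exact m_le_P hN hp hpc hV₀ hle hpot h hu hJu
  have hJ' : ∀ n, ∫ x, dens ((N : ℝ) / 2) (((N : ℝ) + 2) / 2) (((N : ℝ) + p + 1) / (p + 1)) p
      (weightJ V) (u n) (G n) x ≤ 0 := fun n => by
    rw [integral_dens_weightJ hN hp hpc hpot hV₀ (hX n), hJ]
  -- Either infinitely many centres stay in one ball, and the mass survives there without
  -- translation, or the centres tend to infinity.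
  by_cases hbd : ∃ R, ∃ᶠ n in atTop, ‖y n‖ ≤ R
  · obtain ⟨R, hR⟩ := hbd
    obtain ⟨φ, hφ, hφR⟩ := extraction_of_frequently_atTop hR
    obtain ⟨v, H, hv, hv0, h1, h2⟩ := exists_limit_of_minimizing hN hp hpc
      (c₁ := (N : ℝ) / 2) (c₂ := ((N : ℝ) + 2) / 2) (κ := ((N : ℝ) + p + 1) / (p + 1))
      (d₁ := (p + 1) / (2 * ((N : ℝ) + p + 1))) (d₂ := (p - 1) / (2 * ((N : ℝ) + p + 1)))
      (W := W) (a := fun _ => weightJ V) (b := fun _ => weightP p V)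
      (a₀ := weightJ V) (b₀ := weightP p V) (by positivity) (by positivity) (by positivity)
      (by positivity) hc₂ (fun _ => hJm) (fun _ => hPm) hJm hPm
      (fun _ => hWJ V hpot) (fun _ => hWP V hpot) (hWJ V hpot) (hWP V hpot)
      (fun _ x => hc.le.trans (hcl V hpot x)) (fun x => hc.trans_le (hcl V hpot x))
      (fun _ => tendsto_const_nhds) (fun _ => tendsto_const_nhds)
      (fun n => hX (φ n)) (fun n => hE (φ n)) (fun n => hJ' (φ n))
      (hP.comp hφ.tendsto_atTop) (fun _ => hmin) (R₀ := R + 2) hδ (fun n => by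
        refine (hmass (φ n)).trans (setIntegral_mono_set (hX (φ n)).integrable_sq.integrableOn
          (Eventually.of_forall fun x => sq_nonneg _) (Metric.ball_subset_ball' ?_).eventuallyLE)
        rw [dist_zero_right]
        linarith [hφR n])
    rw [integral_dens_weightJ hN hp hpc hpot hV₀ hv] at h1
    exact ⟨V, v, H, hpot, fun _ => le_rfl, hv, hv0, h1, h2⟩
  · push Not at hbd
    have hy : Tendsto y atTop (cocompact (E N)) := by
      rw [← Metric.cobounded_eq_cocompact, ← tendsto_norm_atTop_iff_cobounded]
      refine tendsto_atTop.2 fun R => ?_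
      filter_upwards [hbd R] with n hn
      exact hn.le
    have hyx : ∀ x, Tendsto (fun n => x + y n) atTop (cocompact (E N)) := fun x =>
      (Homeomorph.addLeft x).isClosedEmbedding.tendsto_cocompact.comp hy
    have hpot' := isPotential_const (N := N) hp hVi.le hle hK
    have hJm' := (continuous_weightJ hpot'.contDiff).measurable
    have hPm' := (continuous_weightP (p := p) hpot'.contDiff).measurable
    have hJlim : ∀ x, Tendsto (fun n => weightJ V (x + y n)) atTop
        (𝓝 (weightJ (fun _ : E N => Vinf) x)) := fun x => by
      rw [weightJ_const]
      exact (hpot.tendsto_weightJ hp hlim).comp (hyx x)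
    have hPlim : ∀ x, Tendsto (fun n => weightP p V (x + y n)) atTop
        (𝓝 (weightP p (fun _ : E N => Vinf) x)) := fun x =>
      ((hlim.comp (hyx x)).div_const 2).sub ((hJlim x).div_const _)
    obtain ⟨v, H, hv, hv0, h1, h2⟩ := exists_limit_of_minimizing hN hp hpc
      (c₁ := (N : ℝ) / 2) (c₂ := ((N : ℝ) + 2) / 2) (κ := ((N : ℝ) + p + 1) / (p + 1))
      (d₁ := (p + 1) / (2 * ((N : ℝ) + p + 1))) (d₂ := (p - 1) / (2 * ((N : ℝ) + p + 1)))
      (W := W) (a := fun n x => weightJ V (x + y n)) (b := fun n x => weightP p V (x + y n))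
      (a₀ := weightJ fun _ => Vinf) (b₀ := weightP p fun _ => Vinf)
      (v := fun n x => u n (x + y n)) (G := fun n x => G n (x + y n))
      (by positivity) (by positivity) (by positivity)
      (by positivity) hc₂ (fun n => hJm.comp (measurable_add_const _))
      (fun n => hPm.comp (measurable_add_const _)) hJm' hPm'
      (fun _ _ => hWJ V hpot _) (fun _ _ => hWP V hpot _) (hWJ _ hpot') (hWP _ hpot')
      (fun _ x => hc.le.trans (hcl V hpot _)) (fun x => hc.trans_le (hcl _ hpot' x))
      hJlim hPlim
      (fun n => (hX n).translate (y n))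
      (fun n => (integral_add_right_eq_self (μ := volume) (energyDensity (u n) (G n))
        (y n)).trans_le (hE n))
      (fun n => (integral_dens_translate _ _ _ _ _ _ _ _).trans_le (hJ' n))
      (hP.congr fun n => (integral_dens_translate _ _ _ _ _ _ _ _).symm)
      -- A competitor for the translated problem is moved back by `-y n`, where it competes for the
      -- original potential.
      (fun n w H hw hw0 hwJ => by
        have h1 := hw.translate (-y n)
        have h2 := hw.translate_ne_zero hw0 (-y n)
        have h3 := integral_dens_translate ((N : ℝ) / 2) (((N : ℝ) + 2) / 2)
          (((N : ℝ) + p + 1) / (p + 1)) p (weightJ V) (fun x => w (x + -y n))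
          (fun x => H (x + -y n)) (y n)
        have h4 := integral_dens_translate ((p + 1) / (2 * ((N : ℝ) + p + 1)))
          ((p - 1) / (2 * ((N : ℝ) + p + 1))) 0 p (weightP p V) (fun x => w (x + -y n))
          (fun x => H (x + -y n)) (y n)
        simp only [add_neg_cancel_right] at h3 h4
        rw [h4]
        exact hmin _ _ h1 h2 (h3 ▸ hwJ))
      (R₀ := 2) hδ (fun n => (hmass n).trans
        (setIntegral_ball_translate (fun x => u n x ^ 2) (y n) 2).ge)
    rw [integral_dens_weightJ hN hp hpc hpot' hV₀ hv] at h1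
    exact ⟨fun _ => Vinf, v, H, hpot', hpot.upper, hv, hv0, h1, h2⟩

/-- Replacing V by its upper bound at infinity only raises the energy; this lets a limit found for
the potential at infinity yield a minimizer for V itself. -/
theorem I_mono {V' : E N → ℝ} (hpot : IsPotential N p V₀ Vinf K V)
    (hpot' : IsPotential N p V₀ Vinf K V') (hV₀ : 0 < V₀) (hVV' : ∀ x, V x ≤ V' x)
    {u : E N → ℝ} {G : E N → E N} (h : IsX u G) : I p V u ≤ I p V' u := by
  have iV : ∀ V', IsPotential N p V₀ Vinf K V' → Integrable (fun x => V' x * u x ^ 2) volume :=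
    fun V' hV' => h.integrable_weight hV'.contDiff.continuous.measurable (W := Vinf) fun x => by
      rw [abs_of_nonneg (hV₀.le.trans (hV'.lower x))]
      exact hV'.upper x
  have : ∫ x, V x * u x ^ 2 ≤ ∫ x, V' x * u x ^ 2 :=
    integral_mono (iV V hpot) (iV V' hpot') fun x =>
      mul_le_mul_of_nonneg_right (hVV' x) (sq_nonneg _)
  rw [I_eq hpot hV₀ h, I_eq hpot' hV₀ h]
  linarith

theorem exists_mem_M_I_eq_m (hN : 3 ≤ N) (hp : 1 < p) (hpc : p + 1 < critExp N)
    (hV₀ : 0 < V₀) (hle : V₀ ≤ Vinf) (hpot : IsPotential N p V₀ Vinf K V)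
    (hlim : Tendsto V (cocompact (E N)) (𝓝 Vinf)) : ∃ u ∈ M p V, I p V u = m p V := by
  obtain ⟨V', v, G, hpot', hVV', hv, hv0, hJ, hP⟩ :=
    exists_limit_potential hN hp hpc hV₀ hle hpot hlim
  -- The dilation is chosen for `V`, so that v_t lies in M, whereas the tangent inequality is used
  -- for `V'`, for which it holds at every t.
  obtain ⟨t, ht, hJt⟩ := exists_J_dilate_eq_zero hN hp hpc hV₀ hle hpot hv hv0
  have hM := hv.dilate_mem_M hv0 ht hJt
  refine ⟨_, hM, le_antisymm ?_ (csInf_le (bddBelow_I_image hN hp hpc hV₀ hle hpot)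
    ⟨_, hM, rfl⟩)⟩
  have h1 : t ^ ((N : ℝ) + p + 1) * (J p V' v / ((N : ℝ) + p + 1)) ≤ 0 :=
    mul_nonpos_of_nonneg_of_nonpos (by positivity)
      (div_nonpos_of_nonpos_of_nonneg hJ (by positivity))
  have h2 := I_mono (p := p) hpot hpot' hV₀ hVV' (hv.dilate ht)
  have h3 := I_dilate_le hN hp hpc hpot' hV₀ hv ht
  linarith

end

end ModNLS

/-- Under the assumptions on `V` and `p`, `J(u)` is the derivative of `t ↦ I(u_t)` at `t = 1` for
every `u ∈ X`, and `m = inf_M I` is positive and achieved on `M`. -/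
theorem theorem2p1 (N : ℕ) (hN : 3 ≤ N) (p : ℝ) (hp1 : 1 < p)
    (hp2 : p < (3 * (N : ℝ) + 2) / ((N : ℝ) - 2))
    (V : ModNLS.E N → ℝ) (hV : ContDiff ℝ 1 V)
    (V₀ Vinf : ℝ) (hV₀ : 0 < V₀) (hV1 : ∀ x, V₀ ≤ V x ∧ V x ≤ Vinf)
    (hVlim : Tendsto V (cocompact (ModNLS.E N)) (𝓝 Vinf))
    (hV2 : MemLp (fun x => fderiv ℝ V x x) ⊤ volume)
    (hV3 : ∀ x : ModNLS.E N, ConcaveOn ℝ (Ioi (0 : ℝ))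
      (fun s : ℝ => s ^ (((N : ℝ) + 2) / ((N : ℝ) + p + 1)) *
        V (s ^ (1 / ((N : ℝ) + p + 1)) • x))) :
    (∀ u ∈ ModNLS.X N,
      HasDerivAt (fun t : ℝ => ModNLS.I p V (ModNLS.dilate t u)) (ModNLS.J p V u) 1) ∧
    0 < ModNLS.m p V ∧
    ∃ u ∈ ModNLS.M p V, ModNLS.I p V u = ModNLS.m p V := by
  obtain ⟨K, hK⟩ := ModNLS.abs_le_of_memLp_top (ModNLS.continuous_radial hV) hV2
  have hpot : ModNLS.IsPotential N p V₀ Vinf K V :=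
    ⟨hV, fun x => (hV1 x).1, fun x => (hV1 x).2, hK, hV3⟩
  have hle : V₀ ≤ Vinf := (hV1 0).1.trans (hV1 0).2
  have hpc := ModNLS.add_one_lt_critExp hN hp2
  refine ⟨fun u hu => ?_, ModNLS.m_pos hN hp1 hpc hV₀ hle hpot,
    ModNLS.exists_mem_M_I_eq_m hN hp1 hpc hV₀ hle hpot hVlim⟩
  obtain ⟨G, h⟩ := ModNLS.exists_isX_of_mem hu
  exact ModNLS.hasDerivAt_I_dilate hpot hV₀ hp1 h
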